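/- **Setting.** Let $\mathbb X$ be a $C^\infty$ compact connected Riemannian manifold with geodesic distance $\rho$, $\mu$ a Borel probability measure on $\mathbb X$, $B(x,t)=\{y:\rho(x,y)\le t\}$, and let $\alpha>0$ satisfy $\mu(B(x,t))\le c\,t^\alpha$ for all $x\in\mathbb X$, $t>0$. Let $\{\phi_j\}_{j\ge0}$ be continuous real functions, orthonormal in $L^2(\mu)$, $\phi_0\equiv1$, and let $0=\ell_0\le\ell_1\le\cdots$, $\ell_j\to\infty$. The series $K_t(x,y)=\sum_j e^{-\ell_j^2t}\phi_j(x)\phi_j(y)$ is assumed to converge for $t\in(0,1]$, $x,y\in\mathbb X$, with $\int K_t(x,y)\,d\mu(y)=1$, $|K_t(x,y)|\le c_1t^{-\alpha/2}e^{-c\rho(x,y)^2/t}$, and, $K_t$ being differentiable in $y$, $|\partial_yK_t(x,y)|\le c_1t^{-\alpha/2-1}e^{-c\rho(x,y)^2/t}$ for directional derivatives along unit tangent vectors. For $L\in\mathbb R$ let $\Pi_L=\mathrm{span}_{\mathbb C}\{\phi_j:\ell_j\le L\}$. Let $A\ge2$ be such that $L^c\sup_{\ell_j,\ell_k\le L}\mathrm{dist}_{L^\infty}(\phi_j\phi_k,\Pi_{AL})\to0$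 as $L\to\infty$ for every $c>0$. Write $\langle f,\phi_k\rangle=\int f\phi_k\,d\mu$, let $\|\cdot\|_p$ be the norm of $L^p(\mu)$ (complex-valued functions), $1/p+1/p'=1$, and let $X^p$ be the $L^p$-closure of $\bigcup_L\Pi_L$. For $r>0$, $(\Delta^*)^rf$ is given by $\langle(\Delta^*)^rf,\phi_k\rangle=(1+\ell_k)^r\langle f,\phi_k\rangle$ for all $k$; $W^p_r=\{f\in X^p:(\Delta^*)^rf\in X^p\}$, and $$\omega_r(p;f,\delta)=\inf\{\|f-f_1\|_p+\delta^r\|(\Delta^*)^rf_1\|_p: f_1\in W^p_r\}.$$ Let $S>\alpha$ be an integer, and let $b:\mathbb R\to\mathbb R$ be an even $C^S$ function (a mask of type $\beta$) such that $b(t)=(1+t)^{-\beta}F(\log t)$ for $t>0$, where $F\in C^S(\mathbb R)$ has bounded derivatives of orders $0,\dots,S$ and $F\ge c_1>0$. Let $G:\mathbb X\times\mathbb X\to\mathbb R$ have the formal expansion $\sum_jb(\ell_j)\phi_j(x)\phi_j(y)$, i.e. for every $y$, $G(\cdot,y)\in L^1(\mu)$ and $\langle G(\cdot,y),\phi_k\rangle=b(\ell_k)\phi_k(y)$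 for all $k$. Let $h:\mathbb R\to\mathbb R$ be $C^\infty$, even, nonincreasing on $[0,\infty)$, with $h(t)=1$ for $|t|\le1/2$ and $h(t)=0$ for $|t|\ge1$. For finite $\mathcal C\subset\mathbb X$, $\mathbf W=\{w_y\}_{y\in\mathcal C}\subset\mathbb R$, $L>0$, and $P\in\bigcup_L\Pi_L$, put $$\sigma_L(f)=\sum_kh(\ell_k/L)\langle f,\phi_k\rangle\phi_k,\qquad \sigma_L(\mathcal C;\mathbf W;f)=\sum_kh(\ell_k/L)\Big\{\sum_{y\in\mathcal C}w_yf(y)\phi_k(y)\Big\}\phi_k,$$ $$\mathcal D_GP=\sum_k\frac{\langle P,\phi_k\rangle}{b(\ell_k)}\phi_k,\qquad \mathbb G(\mathcal C;\mathbf W;P)=\sum_{y\in\mathcal C}w_y\,(\mathcal D_GP)(y)\,G(\cdot,y).$$ Put $\delta(\mathcal C)=\sup_x\rho(x,\mathcal C)$ and $q(\mathcal C)=\min_{x\ne y\in\mathcal C}\rho(x,y)$ ($=\infty$ if $\mathcal C$ has at most one point). The weights $\mathbf W$ are $d$-regular with constant $\kappa$ if $\sum_{y\in\mathcal C\cap B(x,t)}|w_y|\le\kappa\{\mu(B(x,t))+d^\alpha\}$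 for all $x\in\mathbb X$, $t>0$, and are quadrature weights of order $N$ if $\int P\,d\mu=\sum_{y\in\mathcal C}w_yP(y)$ for all $P\in\Pi_N$. **Theorem 3.2.** Let $1\le p\le\infty$, $\beta>\alpha/p'$, $0<r<\beta-\alpha/p'$, and let $\kappa_1,\kappa_2$ be constants. There is a constant $c>0$, depending only on the setting (including $A,S,b,G,h$) and on $p,r,\kappa_1,\kappa_2$, such that the following holds for every $L>0$, every finite $\mathcal C^*\subset\mathbb X$ with $\delta(\mathcal C^*)\le2q(\mathcal C^*)$ and $\kappa_1^{-1}q(\mathcal C^*)^{-1}\le L\le\kappa_1q(\mathcal C^*)^{-1}$, and every family $\mathbf W^*$ of quadrature weights of order $2AL$ on $\mathcal C^*$ that is $1/L$-regular with constant $\kappa_2$. (a) For every $f\in X^p$, the function $\mathbb G_L(f)=\mathbb G(\mathcal C^*;\mathbf W^*;\sigma_L(f))$ lies in $W^p_r$, $$\|f-\mathbb G_L(f)\|_p+L^{-r}\|(\Delta^*)^r\mathbb G_L(f)\|_p\le c\,\omega_r(p;f,1/L),$$ and, in particular, $\|\mathbb G_L(f)\|_p\le c\|f\|_p$. (b) Let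 $\mathcal C\subset\mathbb X$ be finite with $\delta(\mathcal C)\le2q(\mathcal C)$, let $\mathbf W=\{w_y\}_{y\in\mathcal C}$ be quadrature weights of order $2AL$ on $\mathcal C$ that are $1/L$-regular with constant $\kappa_2$, and put $\tilde{\mathbb G}_L(\mathcal C;\mathbf W;f)=\mathbb G(\mathcal C^*;\mathbf W^*;\sigma_L(\mathcal C;\mathbf W;f))$. For every $f:\mathbb X\to\mathbb C$, $\tilde{\mathbb G}_L(\mathcal C;\mathbf W;f)\in X^p$ and $$\|\tilde{\mathbb G}_L(\mathcal C;\mathbf W;f)\|_p\le c\Big\{\sum_{y\in\mathcal C}|w_y||f(y)|^p\Big\}^{1/p}$$ (for $p=\infty$ the right-hand side is $c\max\{|f(y)|:y\in\mathcal C,\ w_y\ne0\}$). If $p=\infty$ (so that $0<r<\beta-\alpha$), then for every continuous $f\in X^\infty$, $\tilde{\mathbb G}_L(\mathcal C;\mathbf W;f)\in W^\infty_r$ and $$\|f-\tilde{\mathbb G}_L(\mathcal C;\mathbf W;f)\|_\infty+L^{-r}\|(\Delta^*)^r\tilde{\mathbb G}_L(\mathcal C;\mathbf W;f)\|_\infty\le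 c\{\omega_r(\infty;f,1/L)+L^{-r}\|f\|_\infty\}.$$ -/

import Mathlib

open MeasureTheory Filter Topology Bundle
open scoped ENNReal Manifold

namespace Eignet

noncomputable section

/-- The heat kernel `K_t(x,y) = ∑_j exp(-ℓ_j² t) φ_j(x) φ_j(y)`. -/
def heatKernel {X : Type*} (φ : ℕ → X → ℝ) (ℓ : ℕ → ℝ) (t : ℝ) (x y : X) : ℝ :=
  ∑' j, Real.exp (-(ℓ j) ^ 2 * t) * φ j x * φ j y

/-- The directional derivative of a real function `F` at `y` along the tangent vector `v`. -/
def dirDeriv (E : Type*) [NormedAddCommGroup E] [NormedSpace ℝ E]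
    {X : Type*} [TopologicalSpace X] [ChartedSpace E X]
    (F : X → ℝ) (y : X) (v : TangentSpace 𝓘(ℝ, E) y) : ℝ :=
  mfderiv 𝓘(ℝ, E) 𝓘(ℝ, ℝ) F y v

/-- Diffusion polynomials of degree at most `L`: the span of the `φ_j` with `ℓ_j ≤ L`. -/
def polySpace {X : Type*} (φ : ℕ → X → ℝ) (ℓ : ℕ → ℝ) (L : ℝ) : Submodule ℂ (X → ℂ) :=
  Submodule.span ℂ ((fun j x => (φ j x : ℂ)) '' {j | ℓ j ≤ L})

/-- `ε_L`, the supremum over `ℓ_j, ℓ_k ≤ L` of the `L^∞` distance of `φ_j φ_k` from `Π_{AL}`. -/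
def productDefect {X : Type*} [MeasurableSpace X] (μ : Measure X) (φ : ℕ → X → ℝ) (ℓ : ℕ → ℝ)
    (A L : ℝ) : ℝ≥0∞ :=
  ⨆ (j : ℕ) (k : ℕ) (_ : ℓ j ≤ L) (_ : ℓ k ≤ L),
    ⨅ P ∈ polySpace φ ℓ (A * L), eLpNorm (fun x => (φ j x : ℂ) * (φ k x : ℂ) - P x) ⊤ μ

/-- The standing assumptions on the compact Riemannian manifold `X` (modelled on `E`), the
probability measure `μ`, its dimension parameter `α`, the orthonormal system `φ`, the frequencies
`ℓ` and the constant `A` of the product assumption. -/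
structure IsDiffusionSystem (E : Type*) [NormedAddCommGroup E] [NormedSpace ℝ E]
    {X : Type*} [MetricSpace X] [ChartedSpace E X]
    [RiemannianBundle (fun x : X => TangentSpace 𝓘(ℝ, E) x)]
    [MeasurableSpace X] (μ : Measure X) (α : ℝ) (φ : ℕ → X → ℝ) (ℓ : ℕ → ℝ) (A : ℝ) : Prop where
  alpha_pos : 0 < α
  /-- `μ(B(x,r)) ≤ c r^α` -/
  ball_le : ∃ c > 0, ∀ (x : X) (r : ℝ), 0 < r → μ.real (Metric.closedBall x r) ≤ c * r ^ α
  phi_continuous : ∀ j, Continuous (φ j)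
  phi_orthonormal : ∀ j k, ∫ x, φ j x * φ k x ∂μ = if j = k then 1 else 0
  phi_zero : ∀ x, φ 0 x = 1
  ell_mono : Monotone ℓ
  ell_zero : ℓ 0 = 0
  ell_tendsto : Tendsto ℓ atTop atTop
  heat_summable : ∀ (t : ℝ), 0 < t → t ≤ 1 → ∀ x y : X,
    Summable fun j => Real.exp (-(ℓ j) ^ 2 * t) * φ j x * φ j y
  heat_integral : ∀ (t : ℝ), 0 < t → t ≤ 1 → ∀ x : X, ∫ y, heatKernel φ ℓ t x y ∂μ = 1
  /-- the Gaussian upper bound -/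
  heat_bound : ∃ c₁ > 0, ∃ c > 0, ∀ (t : ℝ), 0 < t → t ≤ 1 → ∀ x y : X,
    |heatKernel φ ℓ t x y| ≤ c₁ * t ^ (-α / 2) * Real.exp (-c * dist x y ^ 2 / t)
  heat_differentiable : ∀ (t : ℝ), 0 < t → t ≤ 1 → ∀ x y : X,
    MDifferentiableAt 𝓘(ℝ, E) 𝓘(ℝ, ℝ) (fun z => heatKernel φ ℓ t x z) y
  /-- the gradient bound: directional derivatives are taken along tangent vectors `v`, measured
  by the Riemannian metric -/
  heat_gradient : ∃ c₁ > 0, ∃ c > 0, ∀ (t : ℝ), 0 < t → t ≤ 1 → ∀ (x y : X)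
    (v : TangentSpace 𝓘(ℝ, E) y),
    |dirDeriv E (fun z => heatKernel φ ℓ t x z) y v| ≤
      c₁ * t ^ (-α / 2 - 1) * Real.exp (-c * dist x y ^ 2 / t) * ‖v‖
  two_le_A : 2 ≤ A
  /-- the product assumption: `L^c ε_L → 0` for every `c > 0` -/
  product : ∀ c : ℝ, 0 < c →
    Tendsto (fun L : ℝ => ENNReal.ofReal (L ^ c) * productDefect μ φ ℓ A L) atTop (𝓝 0)

/-- `b` is a mask of type `β` (with `S` derivatives). -/
structure IsMask (S : ℕ) (β : ℝ) (b : ℝ → ℝ) : Prop where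
  even : ∀ t, b (-t) = b t
  contDiff : ContDiff ℝ S b
  exists_log_form : ∃ F : ℝ → ℝ, ContDiff ℝ S F ∧
    (∀ t, 0 < t → b t = (1 + t) ^ (-β) * F (Real.log t)) ∧
    (∃ c, ∀ k ≤ S, ∀ t, |iteratedDeriv k F t| ≤ c) ∧ ∃ c₁ > 0, ∀ t, c₁ ≤ F t

/-- `h` is an admissible smooth low pass filter. -/
structure IsFilter (h : ℝ → ℝ) : Prop where
  contDiff : ContDiff ℝ ((⊤ : ℕ∞) : WithTop ℕ∞) h
  even : ∀ t, h (-t) = h t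
  antitone : AntitoneOn h (Set.Ici 0)
  eq_one : ∀ t, |t| ≤ 1 / 2 → h t = 1
  eq_zero : ∀ t, 1 ≤ |t| → h t = 0

/-- The coefficient `⟨f, φ_k⟩`. -/
def coeff {X : Type*} [MeasurableSpace X] (μ : Measure X) (φ : ℕ → X → ℝ) (f : X → ℂ) (k : ℕ) :
    ℂ :=
  ∫ x, f x * (φ k x : ℂ) ∂μ

/-- `G` has the formal expansion `∑_j b(ℓ_j) φ_j(x) φ_j(y)`: the coefficients of `G(·,y)` are
`b(ℓ_k) φ_k(y)`. -/
def IsKernel {X : Type*} [MeasurableSpace X] (μ : Measure X) (φ : ℕ → X → ℝ) (ℓ : ℕ → ℝ)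
    (b : ℝ → ℝ) (G : X → X → ℝ) : Prop :=
  ∀ y, Integrable (fun x => G x y) μ ∧ ∀ k, ∫ x, G x y * φ k x ∂μ = b (ℓ k) * φ k y

/-- `f` belongs to `X^p`, the `L^p` closure of the diffusion polynomials. -/
def MemX {X : Type*} [MeasurableSpace X] (μ : Measure X) (φ : ℕ → X → ℝ) (ℓ : ℕ → ℝ)
    (p : ℝ≥0∞) (f : X → ℂ) : Prop :=
  MemLp f p μ ∧ ∀ ε : ℝ≥0∞, 0 < ε →
    ∃ L : ℝ, ∃ P ∈ polySpace φ ℓ L, eLpNorm (fun x => f x - P x) p μ ≤ ε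

/-- `g = (Δ^*)^r f` with `g ∈ X^p`: the coefficients satisfy `⟨g,φ_k⟩ = (1+ℓ_k)^r ⟨f,φ_k⟩`. -/
def IsDeltaPow {X : Type*} [MeasurableSpace X] (μ : Measure X) (φ : ℕ → X → ℝ) (ℓ : ℕ → ℝ)
    (p : ℝ≥0∞) (r : ℝ) (f g : X → ℂ) : Prop :=
  MemX μ φ ℓ p g ∧ ∀ k, coeff μ φ g k = (((1 + ℓ k) ^ r : ℝ) : ℂ) * coeff μ φ f k

/-- The K-functional `ω_r(p;f,δ)`, the infimum of `‖f - f₁‖_p + δ^r ‖(Δ^*)^r f₁‖_p` over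
`f₁ ∈ W^p_r`; here `g` runs through the (unique) value of `(Δ^*)^r f₁`. -/
def kFunctional {X : Type*} [MeasurableSpace X] (μ : Measure X) (φ : ℕ → X → ℝ) (ℓ : ℕ → ℝ)
    (p : ℝ≥0∞) (r : ℝ) (f : X → ℂ) (δ : ℝ) : ℝ≥0∞ :=
  ⨅ (f₁ : X → ℂ) (g : X → ℂ) (_ : MemX μ φ ℓ p f₁) (_ : IsDeltaPow μ φ ℓ p r f₁ g),
    eLpNorm (fun x => f x - f₁ x) p μ + ENNReal.ofReal (δ ^ r) * eLpNorm g p μ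

/-- The summability operator `σ_L(f) = ∑_k h(ℓ_k/L) ⟨f,φ_k⟩ φ_k` (a finite sum). -/
def sigma {X : Type*} [MeasurableSpace X] (μ : Measure X) (φ : ℕ → X → ℝ) (ℓ : ℕ → ℝ)
    (h : ℝ → ℝ) (L : ℝ) (f : X → ℂ) (x : X) : ℂ :=
  ∑' k, (h (ℓ k / L) : ℂ) * coeff μ φ f k * (φ k x : ℂ)

/-- The discretized operator
`σ_L(C;W;f) = ∑_k h(ℓ_k/L) (∑_{y ∈ C} w_y f(y) φ_k(y)) φ_k` (a finite sum). -/
def discSigma {X : Type*} (φ : ℕ → X → ℝ) (ℓ : ℕ → ℝ) (h : ℝ → ℝ) (L : ℝ)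
    (C : Finset X) (w : X → ℝ) (f : X → ℂ) (x : X) : ℂ :=
  ∑' k, (h (ℓ k / L) : ℂ) * (∑ y ∈ C, (w y : ℂ) * f y * (φ k y : ℂ)) * (φ k x : ℂ)

/-- `D_G P = ∑_k (⟨P,φ_k⟩ / b(ℓ_k)) φ_k` for a diffusion polynomial `P` (a finite sum). -/
def derivG {X : Type*} [MeasurableSpace X] (μ : Measure X) (φ : ℕ → X → ℝ) (ℓ : ℕ → ℝ)
    (b : ℝ → ℝ) (P : X → ℂ) (x : X) : ℂ :=
  ∑' k, coeff μ φ P k / (b (ℓ k) : ℂ) * (φ k x : ℂ)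

/-- The eignet `𝔾(C;W;P) = ∑_{y ∈ C} w_y (D_G P)(y) G(·,y)` for a diffusion polynomial `P`. -/
def eignetOp {X : Type*} [MeasurableSpace X] (μ : Measure X) (φ : ℕ → X → ℝ) (ℓ : ℕ → ℝ)
    (b : ℝ → ℝ) (G : X → X → ℝ) (C : Finset X) (w : X → ℝ) (P : X → ℂ) (x : X) : ℂ :=
  ∑ y ∈ C, (w y : ℂ) * derivG μ φ ℓ b P y * (G x y : ℂ)

/-- The mesh norm `δ(C) = sup_x ρ(x,C)`. -/
def meshNorm {X : Type*} [MetricSpace X] (C : Finset X) : ℝ≥0∞ :=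
  ⨆ x : X, Metric.infEDist x (C : Set X)

/-- `δ(C) ≤ 2 q(C)`, with `q(C)` the minimal separation of `C`
(`⊤` when `C` has at most one point). -/
def IsQuasiUniform {X : Type*} [MetricSpace X] (C : Finset X) : Prop :=
  meshNorm C ≤ 2 * Set.einfsep (C : Set X)

/-- `L ~ q(C)⁻¹` with constant `κ`. -/
def ComparableToSeparation {X : Type*} [MetricSpace X] (κ : ℝ) (C : Finset X) (L : ℝ) : Prop :=
  ENNReal.ofReal L ≤ ENNReal.ofReal κ * (Set.einfsep (C : Set X))⁻¹ ∧
    (Set.einfsep (C : Set X))⁻¹ ≤ ENNReal.ofReal κ * ENNReal.ofReal L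

/-- The weights `w_y`, `y ∈ C`, are `d`-regular with constant `κ`. -/
def IsRegularWeights {X : Type*} [MetricSpace X] [MeasurableSpace X] (μ : Measure X)
    (α κ d : ℝ) (C : Finset X) (w : X → ℝ) : Prop :=
  ∀ (x : X) (r : ℝ), 0 < r →
    ∑ y ∈ C with dist y x ≤ r, |w y| ≤ κ * (μ.real (Metric.closedBall x r) + d ^ α)

/-- The weights `w_y`, `y ∈ C`, are quadrature weights of order `N`. -/
def IsQuadrature {X : Type*} [MeasurableSpace X] (μ : Measure X) (φ : ℕ → X → ℝ) (ℓ : ℕ → ℝ)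
    (N : ℝ) (C : Finset X) (w : X → ℝ) : Prop :=
  ∀ P ∈ polySpace φ ℓ N, ∫ y, P y ∂μ = ∑ y ∈ C, (w y : ℂ) * P y

/-- The weighted discrete norm `(∑_{y ∈ C} |w_y| |f(y)|^p)^{1/p}`; for `p = ∞`, the maximum of
`|f(y)|` over the `y ∈ C` that carry a nonzero weight. -/
def discNorm {X : Type*} (p : ℝ≥0∞) (C : Finset X) (w : X → ℝ) (f : X → ℂ) : ℝ≥0∞ :=
  if p = ⊤ then ⨆ y ∈ C, ⨆ _ : w y ≠ 0, ‖f y‖ₑ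
  else (∑ y ∈ C, ‖w y‖ₑ * ‖f y‖ₑ ^ p.toReal) ^ (1 / p.toReal)

end

end Eignet

/-!
The proof separates a purely spectral part, which needs only the Gaussian upper bound for the heat
kernel, the upper regularity of `μ` and the orthonormality of the `φ_j` (collected in
`IsHeatSystem`), from a discretization part, which uses the quadrature and product assumptions.

**Multipliers.** The kernel `∑_j m_j φ_j(x) φ_j(y)` of a multiplier `m` is measured by its `L¹` norm
in one variable, uniformly in the other (`knorm`); by Schur's test this bounds the multiplier on
every `L^p(μ)`. The central estimate concerns the heat operator `T = exp(-N^{-2} ℓ²)`: the kernel of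
`exp(iθT)T` has norm `O((1+|θ|)^{α/2})`, uniformly in `N` (`IsHeatSystem.knorm_oscSym_le`). Writing
`G(T)T` as a Fourier series in `T` then shows that `S > α` derivatives of `G` suffice for a bounded
kernel norm (`IsHeatSystem.exists_knorm_le_of_unifC`). A symbol `(1+u)^s Θ(log u)`, in particular a
mask, its reciprocal, or a power of `1+u`, is after rescaling a family of such functions `G` on the
dyadic pieces of the frequency axis, so that its `n`-th piece has norm `O(2^{ns})`
(`IsHeatSystem.exists_knorm_piece_le`, `HasOrder`). Geometric series give the low-pass and
high-pass estimates from which the direct theorem `‖f - σ_L f‖ ≲ ω_r(f, 1/L)` and the bounds for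
the derivatives of `σ_L f` follow (`IsHeatSystem.exists_sub_lowPass_le`,
`IsLowOrder.exists_le_kFunctional`).

**Weights.** The weights are viewed as a discrete measure `wMeas`. Its `1/L`-regularity allows the
heat kernel, hence every low-pass kernel, to be integrated against it as against `μ`, with a loss
`(2^n/L)^α` at frequencies `2^n ≥ L`. Schur's test between `wMeas` and `μ`, with explicit dependence
on `p`, gives a synthesis estimate with loss `(2^n/L)^{α/p'}` and a Marcinkiewicz–Zygmund inequality
(`IsHeatSystem.exists_eLpNorm_series_dcoeff_le`, `IsHeatSystem.exists_eLpNorm_wMeas_le`).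

**Eignets.** Let `P` be a diffusion polynomial of degree `L`, `D = D_G P`, and let `Ψ` be the eignet
built from `P`. The coefficients of `Ψ - P` are `b(ℓ_k)` times the quadrature errors for `D φ_k`. For
`ℓ_k ≤ 2L` these errors are negligible by the product assumption; for larger `ℓ_k` the exact
coefficient of `D` vanishes, and the dyadic pieces of the aliased part, of size
`2^{n(r-β)} (2^n/L)^{α/p'} ‖D‖_p` after `r` derivatives, are summable because `r < β - α/p'`
(`IsHeatSystem.exists_discretization`). Since the `φ_j` are complete in `L¹(μ)`
(`IsHeatSystem.ae_eq_zero_of_coeff`), the function constructed from these pieces is `Ψ - P` almost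
everywhere (`IsHeatSystem.exists_eignetOp_sub_le`). Both `P = σ_L f` and the polynomial obtained from
samples of `f` satisfy `L^{-β} ‖D_G P‖_p ≲ ω_r(f, 1/L)`, in the second case up to `L^{-r} ‖f‖_∞`
(`IsLowOrder.exists_dcoeff_le_kFunctional`). All constants are uniform in `L ≥ L₀`, which is enough:
the separation of a finite set cannot exceed the diameter of `X`, so the condition
`κ₁⁻¹ q(C*)⁻¹ ≤ L` bounds `L` from below.
-/

set_option linter.unusedSectionVars false

namespace Eignet

/-! ### Kernels of spectral multipliers -/

/-- The part of the standing assumptions on which the theory of spectral multipliers rests: upper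
regularity of the measure, orthonormality, and the Gaussian upper bound for the heat kernel. It is
stated on a metric measure space. -/
structure IsHeatSystem {X : Type*} [MetricSpace X] [MeasurableSpace X] (μ : Measure X) (α : ℝ)
    (φ : ℕ → X → ℝ) (ℓ : ℕ → ℝ) : Prop where
  alpha_pos : 0 < α
  ball_le : ∃ c > 0, ∀ (x : X) (r : ℝ), 0 < r → μ.real (Metric.closedBall x r) ≤ c * r ^ α
  phi_continuous : ∀ j, Continuous (φ j)
  phi_orthonormal : ∀ j k, ∫ x, φ j x * φ k x ∂μ = if j = k then 1 else 0
  ell_nonneg : ∀ j, 0 ≤ ℓ j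
  ell_tendsto : Tendsto ℓ atTop atTop
  heat_summable : ∀ (t : ℝ), 0 < t → t ≤ 1 → ∀ x y : X,
    Summable fun j => Real.exp (-(ℓ j) ^ 2 * t) * φ j x * φ j y
  heat_integral : ∀ (t : ℝ), 0 < t → t ≤ 1 → ∀ x : X, ∫ y, heatKernel φ ℓ t x y ∂μ = 1
  heat_bound : ∃ c₁ > 0, ∃ c > 0, ∀ (t : ℝ), 0 < t → t ≤ 1 → ∀ x y : X,
    |heatKernel φ ℓ t x y| ≤ c₁ * t ^ (-α / 2) * Real.exp (-c * dist x y ^ 2 / t)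

theorem IsDiffusionSystem.isHeatSystem {E : Type*} [NormedAddCommGroup E] [NormedSpace ℝ E]
    {X : Type*} [MetricSpace X] [ChartedSpace E X]
    [RiemannianBundle (fun x : X => TangentSpace 𝓘(ℝ, E) x)]
    [MeasurableSpace X] {μ : Measure X} {α : ℝ} {φ : ℕ → X → ℝ} {ℓ : ℕ → ℝ} {A : ℝ}
    (H : IsDiffusionSystem E μ α φ ℓ A) : IsHeatSystem μ α φ ℓ where
  alpha_pos := H.alpha_pos
  ball_le := H.ball_le
  phi_continuous := H.phi_continuous
  phi_orthonormal := H.phi_orthonormal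
  ell_nonneg j := by
    have := H.ell_mono (Nat.zero_le j)
    rwa [H.ell_zero] at this
  ell_tendsto := H.ell_tendsto
  heat_summable := H.heat_summable
  heat_integral := H.heat_integral
  heat_bound := H.heat_bound

/-- The kernel `∑_j m_j φ_j(x) φ_j(y)` of the spectral multiplier `m`. -/
noncomputable def kern {X : Type*} (φ : ℕ → X → ℝ) (m : ℕ → ℂ) (x y : X) : ℂ :=
  ∑' j, m j * (φ j x : ℂ) * (φ j y : ℂ)

/-- Admissible multipliers: those dominated by the symbol of some heat kernel. Their kernels
converge absolutely and are bounded. -/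
def Adm (ℓ : ℕ → ℝ) (m : ℕ → ℂ) : Prop :=
  ∃ t : ℝ, 0 < t ∧ t ≤ 1 ∧ ∃ C : ℝ, ∀ j, ‖m j‖ ≤ C * Real.exp (-(ℓ j) ^ 2 * t)

/-- The symbol `exp(-ℓ_j² t)` of the heat kernel. -/
noncomputable def heatSym (ℓ : ℕ → ℝ) (t : ℝ) (j : ℕ) : ℝ := Real.exp (-(ℓ j) ^ 2 * t)

theorem heatSym_pos (ℓ : ℕ → ℝ) (t : ℝ) (j : ℕ) : 0 < heatSym ℓ t j := Real.exp_pos _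

theorem heatSym_le_one (ℓ : ℕ → ℝ) {t : ℝ} (ht : 0 ≤ t) (j : ℕ) : heatSym ℓ t j ≤ 1 := by
  unfold heatSym
  rw [Real.exp_le_one_iff]
  nlinarith [mul_nonneg (sq_nonneg (ℓ j)) ht]

variable {X : Type*} [MetricSpace X] [CompactSpace X] [MeasurableSpace X] [BorelSpace X]
  {μ : Measure X} [IsProbabilityMeasure μ] {α : ℝ} {φ : ℕ → X → ℝ} {ℓ : ℕ → ℝ}

theorem kern_comm (m : ℕ → ℂ) (x y : X) : kern φ m x y = kern φ m y x := by
  unfold kern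
  exact tsum_congr fun j => by ring

theorem kern_heatSym (t : ℝ) (x y : X) :
    kern φ (fun j => (heatSym ℓ t j : ℂ)) x y = (heatKernel φ ℓ t x y : ℂ) := by
  unfold kern heatKernel
  rw [Complex.ofReal_tsum]
  exact tsum_congr fun j => by simp [heatSym]

/-- On-diagonal Gaussian bounds control the absolutely convergent series off the diagonal, by
`2|ab| ≤ a² + b²`. -/
theorem IsHeatSystem.abs_sum (H : IsHeatSystem μ α φ ℓ) :
    ∃ C > 0, ∀ t : ℝ, 0 < t → t ≤ 1 → ∀ x y : X,
      (Summable fun j => heatSym ℓ t j * (|φ j x| * |φ j y|)) ∧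
      ∑' j, heatSym ℓ t j * (|φ j x| * |φ j y|) ≤ C * t ^ (-α / 2) := by
  obtain ⟨c₁, hc₁, c, hc, hb⟩ := H.heat_bound
  refine ⟨c₁, hc₁, fun t ht ht1 x y => ?_⟩
  have hd : ∀ z : X, (Summable fun j => heatSym ℓ t j * φ j z * φ j z) ∧
      ∑' j, heatSym ℓ t j * φ j z * φ j z ≤ c₁ * t ^ (-α / 2) := by
    intro z
    refine ⟨H.heat_summable t ht ht1 z z, ?_⟩
    have := hb t ht ht1 z z
    simp only [dist_self, ne_eq, OfNat.ofNat_ne_zero, not_false_eq_true, zero_pow, mul_zero,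
      zero_div, Real.exp_zero, mul_one] at this
    exact (le_abs_self _).trans this
  have hs := ((hd x).1.add (hd y).1).mul_left (1 / 2)
  have hle : ∀ j, heatSym ℓ t j * (|φ j x| * |φ j y|) ≤
      1 / 2 * (heatSym ℓ t j * φ j x * φ j x + heatSym ℓ t j * φ j y * φ j y) := by
    intro j
    have h1 := heatSym_pos ℓ t j
    have h2 := sq_nonneg (|φ j x| - |φ j y|)
    have h3 := sq_abs (φ j x)
    have h4 := sq_abs (φ j y)
    nlinarith
  have hsum : Summable fun j => heatSym ℓ t j * (|φ j x| * |φ j y|) :=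
    Summable.of_nonneg_of_le (fun j => by have := heatSym_pos ℓ t j; positivity) hle hs
  refine ⟨hsum, (hsum.tsum_le_tsum hle hs).trans ?_⟩
  rw [tsum_mul_left, (hd x).1.tsum_add (hd y).1]
  linarith [(hd x).2, (hd y).2]

theorem Adm.abs_sum (H : IsHeatSystem μ α φ ℓ) {m : ℕ → ℂ} (hm : Adm ℓ m) :
    ∃ B : ℝ, 0 ≤ B ∧ ∀ x y : X, (Summable fun j => ‖m j‖ * (|φ j x| * |φ j y|)) ∧
      ∑' j, ‖m j‖ * (|φ j x| * |φ j y|) ≤ B := by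
  obtain ⟨t, ht, ht1, C, hC⟩ := hm
  obtain ⟨K, hK, hs⟩ := H.abs_sum
  have hC0 : 0 ≤ C := by
    have := (norm_nonneg _).trans (hC 0)
    exact nonneg_of_mul_nonneg_left this (Real.exp_pos _)
  refine ⟨C * (K * t ^ (-α / 2)), by positivity, fun x y => ?_⟩
  obtain ⟨h1, h2⟩ := hs t ht ht1 x y
  have hle : ∀ j, ‖m j‖ * (|φ j x| * |φ j y|) ≤ C * (heatSym ℓ t j * (|φ j x| * |φ j y|)) := by
    intro j
    rw [← mul_assoc C]
    exact mul_le_mul_of_nonneg_right (hC j) (by positivity)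
  have hsum := Summable.of_nonneg_of_le (fun j => by positivity) hle (h1.mul_left C)
  refine ⟨hsum, (hsum.tsum_le_tsum hle (h1.mul_left C)).trans ?_⟩
  rw [tsum_mul_left]
  gcongr

theorem norm_term (m : ℕ → ℂ) (j : ℕ) (x y : X) :
    ‖m j * (φ j x : ℂ) * (φ j y : ℂ)‖ = ‖m j‖ * (|φ j x| * |φ j y|) := by
  simp [mul_assoc]

theorem Adm.summable (H : IsHeatSystem μ α φ ℓ) {m : ℕ → ℂ} (hm : Adm ℓ m) (x y : X) :
    Summable fun j => m j * (φ j x : ℂ) * (φ j y : ℂ) := by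
  obtain ⟨B, -, hB⟩ := hm.abs_sum H
  refine Summable.of_norm ?_
  simp_rw [norm_term]
  exact (hB x y).1

theorem Adm.norm_kern_le (H : IsHeatSystem μ α φ ℓ) {m : ℕ → ℂ} (hm : Adm ℓ m) :
    ∃ B : ℝ, 0 ≤ B ∧ ∀ x y : X, ‖kern φ m x y‖ ≤ B := by
  obtain ⟨B, hB0, hB⟩ := hm.abs_sum H
  refine ⟨B, hB0, fun x y => ?_⟩
  have := (hB x y).1
  simp_rw [← norm_term] at this
  refine (norm_tsum_le_tsum_norm this).trans ?_
  simp_rw [norm_term]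
  exact (hB x y).2

theorem adm_heatSym {t : ℝ} (ht : 0 < t) (ht1 : t ≤ 1) : Adm ℓ (fun j => (heatSym ℓ t j : ℂ)) :=
  ⟨t, ht, ht1, 1, fun j => by
    rw [Complex.norm_real, Real.norm_of_nonneg (heatSym_pos ℓ t j).le, one_mul, heatSym]⟩

/-- Finitely supported multipliers are dominated by the heat symbol at time `1`, which is
bounded below on a finite set. -/
theorem adm_of_finite {m : ℕ → ℂ} (hm : m.support.Finite) : Adm ℓ m := by
  refine ⟨1, one_pos, le_rfl, ∑ j ∈ hm.toFinset, ‖m j‖ * Real.exp ((ℓ j) ^ 2), fun j => ?_⟩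
  by_cases hj : m j = 0
  · rw [hj, norm_zero]
    positivity
  · have hj' : j ∈ hm.toFinset := by simpa using hj
    calc ‖m j‖ = (‖m j‖ * Real.exp ((ℓ j) ^ 2)) * Real.exp (-(ℓ j) ^ 2 * 1) := by
          rw [mul_assoc, ← Real.exp_add]; simp
      _ ≤ _ := by
          gcongr
          exact Finset.single_le_sum (f := fun j => ‖m j‖ * Real.exp ((ℓ j) ^ 2))
            (fun i _ => by positivity) hj'

theorem measurable_kern (H : IsHeatSystem μ α φ ℓ) {m : ℕ → ℂ} (hm : Adm ℓ m) :
    Measurable fun z : X × X => kern φ m z.1 z.2 := by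
  refine measurable_of_tendsto_metrizable (f := fun (n : ℕ) (z : X × X) =>
    ∑ j ∈ Finset.range n, m j * (φ j z.1 : ℂ) * (φ j z.2 : ℂ)) (fun n => ?_) ?_
  · refine Continuous.measurable ?_
    have := H.phi_continuous
    fun_prop
  · rw [tendsto_pi_nhds]
    exact fun z => (hm.summable H z.1 z.2).hasSum.tendsto_sum_nat

theorem measurable_kern_left (H : IsHeatSystem μ α φ ℓ) {m : ℕ → ℂ} (hm : Adm ℓ m) (x : X) :
    Measurable fun z : X => kern φ m x z :=
  (measurable_kern H hm).comp measurable_prodMk_left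

theorem integrable_kern_left (H : IsHeatSystem μ α φ ℓ) {m : ℕ → ℂ} (hm : Adm ℓ m) (x : X) :
    Integrable (fun z : X => kern φ m x z) μ := by
  obtain ⟨B, -, hB⟩ := hm.norm_kern_le H
  exact Integrable.of_bound (measurable_kern_left H hm x).aestronglyMeasurable B
    (Eventually.of_forall fun z => hB x z)

/-- Termwise integration of a series that is absolutely and boundedly convergent, over a
probability space. -/
theorem hasSum_integral_of_tsum_norm_le {F : ℕ → X → ℂ}
    (hF : ∀ j, AEStronglyMeasurable (F j) μ) {B : ℝ}
    (hB : ∀ x, (Summable fun j => ‖F j x‖) ∧ ∑' j, ‖F j x‖ ≤ B) :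
    HasSum (fun j => ∫ x, F j x ∂μ) (∫ x, ∑' j, F j x ∂μ) := by
  have hint : ∀ j, Integrable (F j) μ := fun j =>
    Integrable.of_bound (hF j) B (Eventually.of_forall fun x =>
      ((hB x).1.le_tsum j (fun _ _ => norm_nonneg _)).trans (hB x).2)
  refine hasSum_integral_of_summable_integral_norm hint ?_
  refine summable_of_sum_le (c := B) (fun j => integral_nonneg fun _ => norm_nonneg _) fun u => ?_
  rw [← integral_finsetSum _ fun j _ => (hint j).norm]
  calc ∫ x, ∑ j ∈ u, ‖F j x‖ ∂μ ≤ ∫ _, B ∂μ := by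
        refine integral_mono (integrable_finsetSum _ fun j _ => (hint j).norm)
          (integrable_const _) fun x => ?_
        exact ((hB x).1.sum_le_tsum u (fun _ _ => norm_nonneg _)).trans (hB x).2
    _ = B := by simp

theorem integral_phi_mul (H : IsHeatSystem μ α φ ℓ) (j k : ℕ) :
    ∫ x, (φ j x : ℂ) * (φ k x : ℂ) ∂μ = if j = k then 1 else 0 := by
  have := H.phi_orthonormal j k
  simp_rw [← Complex.ofReal_mul]
  rw [integral_complex_ofReal, this]
  split_ifs <;> simp

theorem exists_phi_bound (H : IsHeatSystem μ α φ ℓ) (j : ℕ) :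
    ∃ B, 0 ≤ B ∧ ∀ x : X, |φ j x| ≤ B := by
  obtain ⟨B, hB⟩ := (isCompact_univ (X := X)).exists_bound_of_continuousOn
    (H.phi_continuous j).continuousOn
  exact ⟨max B 0, le_max_right _ _, fun x => (hB x trivial).trans (le_max_left _ _)⟩

theorem integral_kern_mul_phi (H : IsHeatSystem μ α φ ℓ) {m : ℕ → ℂ} (hm : Adm ℓ m) (x : X)
    (k : ℕ) : ∫ z, kern φ m x z * (φ k z : ℂ) ∂μ = m k * (φ k x : ℂ) := by
  obtain ⟨B, hB0, hB⟩ := hm.abs_sum H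
  obtain ⟨D, hD0, hD⟩ := exists_phi_bound H k
  have hc := H.phi_continuous
  have key := hasSum_integral_of_tsum_norm_le (μ := μ)
    (F := fun j z => m j * (φ j x : ℂ) * (φ j z : ℂ) * (φ k z : ℂ)) (B := B * D)
    (fun j => by
      refine Continuous.aestronglyMeasurable ?_
      fun_prop)
    (fun z => by
      have h1 : ∀ j, ‖m j * (φ j x : ℂ) * (φ j z : ℂ) * (φ k z : ℂ)‖ =
          ‖m j‖ * (|φ j x| * |φ j z|) * |φ k z| := fun j => by
        rw [norm_mul, norm_term]; simp
      simp_rw [h1]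
      refine ⟨(hB x z).1.mul_right _, ?_⟩
      rw [tsum_mul_right]
      exact mul_le_mul (hB x z).2 (hD z) (abs_nonneg _) hB0)
  have h2 : ∀ z, ∑' j, m j * (φ j x : ℂ) * (φ j z : ℂ) * (φ k z : ℂ) =
      kern φ m x z * (φ k z : ℂ) := fun z => by
    rw [tsum_mul_right]; rfl
  simp_rw [h2] at key
  rw [← key.tsum_eq]
  have h3 : ∀ j, ∫ z, m j * (φ j x : ℂ) * (φ j z : ℂ) * (φ k z : ℂ) ∂μ =
      if j = k then m k * (φ k x : ℂ) else 0 := fun j => by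
    simp_rw [mul_assoc (m j * (φ j x : ℂ))]
    rw [integral_const_mul, integral_phi_mul H]
    split_ifs with h
    · rw [h, mul_one]
    · rw [mul_zero]
  simp_rw [h3]
  rw [tsum_ite_eq]

/-- Composition of kernels corresponds to multiplication of symbols. -/
theorem integral_kern_mul_kern (H : IsHeatSystem μ α φ ℓ) {m m' : ℕ → ℂ} (hm : Adm ℓ m)
    (hm' : Adm ℓ m') (x y : X) :
    ∫ z, kern φ m x z * kern φ m' z y ∂μ = kern φ (fun j => m j * m' j) x y := by
  obtain ⟨B, hB0, hB⟩ := hm.abs_sum H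
  obtain ⟨D, hD0, hD⟩ := hm'.norm_kern_le H
  have hc := H.phi_continuous
  have hmeas := measurable_kern_left H hm' y
  have key := hasSum_integral_of_tsum_norm_le (μ := μ)
    (F := fun j z => m j * (φ j x : ℂ) * (φ j z : ℂ) * kern φ m' z y) (B := B * D)
    (fun j => by
      simp_rw [kern_comm m' _ y]
      have h1 : Measurable fun z => m j * (φ j x : ℂ) * (φ j z : ℂ) := by
        refine Continuous.measurable ?_
        fun_prop
      exact (h1.mul hmeas).aestronglyMeasurable)
    (fun z => by
      have h1 : ∀ j, ‖m j * (φ j x : ℂ) * (φ j z : ℂ) * kern φ m' z y‖ =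
          ‖m j‖ * (|φ j x| * |φ j z|) * ‖kern φ m' z y‖ := fun j => by
        rw [norm_mul, norm_term]
      simp_rw [h1]
      refine ⟨(hB x z).1.mul_right _, ?_⟩
      rw [tsum_mul_right]
      exact mul_le_mul (hB x z).2 (hD z y) (norm_nonneg _) hB0)
  have h2 : ∀ z, ∑' j, m j * (φ j x : ℂ) * (φ j z : ℂ) * kern φ m' z y =
      kern φ m x z * kern φ m' z y := fun z => by
    rw [tsum_mul_right]; rfl
  simp_rw [h2] at key
  rw [← key.tsum_eq]
  refine tsum_congr fun j => ?_
  have h4 : ∀ z, m j * (φ j x : ℂ) * (φ j z : ℂ) * kern φ m' z y =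
      m j * (φ j x : ℂ) * (kern φ m' y z * (φ j z : ℂ)) := fun z => by
    rw [kern_comm m' z y]; ring
  simp_rw [h4]
  rw [integral_const_mul, integral_kern_mul_phi H hm']
  ring

/-- The `L²` norm of a kernel in one variable, by composing it with its conjugate. -/
theorem lintegral_kern_sq (H : IsHeatSystem μ α φ ℓ) {m : ℕ → ℂ} (hm : Adm ℓ m) (x : X) :
    ∫⁻ z, ‖kern φ m x z‖ₑ ^ 2 ∂μ =
      ENNReal.ofReal (∑' j, ‖m j‖ ^ 2 * (|φ j x| * |φ j x|)) := by
  have hm' : Adm ℓ (fun j => (starRingEnd ℂ) (m j)) := by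
    obtain ⟨t, ht, ht1, C, hC⟩ := hm
    exact ⟨t, ht, ht1, C, fun j => by simpa using hC j⟩
  have hconj : ∀ z, kern φ (fun j => (starRingEnd ℂ) (m j)) z x =
      (starRingEnd ℂ) (kern φ m x z) := by
    intro z
    unfold kern
    rw [Complex.conj_tsum]
    refine tsum_congr fun j => ?_
    simp only [map_mul, Complex.conj_ofReal]
    ring
  have h1 := integral_kern_mul_kern H hm hm' x x
  simp_rw [hconj, Complex.mul_conj, Complex.normSq_eq_norm_sq] at h1
  rw [integral_complex_ofReal] at h1
  have h2 : kern φ (fun j => ((‖m j‖ ^ 2 : ℝ) : ℂ)) x x =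
      ((∑' j, ‖m j‖ ^ 2 * (|φ j x| * |φ j x|) : ℝ) : ℂ) := by
    unfold kern
    rw [Complex.ofReal_tsum]
    refine tsum_congr fun j => ?_
    rw [abs_mul_abs_self]
    push_cast
    ring
  rw [h2, Complex.ofReal_inj] at h1
  rw [← h1]
  obtain ⟨B, hB0, hB⟩ := hm.norm_kern_le H
  rw [ofReal_integral_eq_lintegral_ofReal]
  · refine lintegral_congr fun z => ?_
    rw [← ofReal_norm, ENNReal.ofReal_pow (norm_nonneg _)]
  · refine Integrable.of_bound (C := B ^ 2)
      ((measurable_kern_left H hm x).norm.pow_const 2).aestronglyMeasurable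
      (Eventually.of_forall fun z => ?_)
    rw [norm_pow, norm_norm]
    gcongr
    exact hB x z
  · exact Eventually.of_forall fun z => by positivity

/-! ### Gaussian integrals and growth bounds -/

theorem IsHeatSystem.finite_freq (H : IsHeatSystem μ α φ ℓ) (N : ℝ) : {j | ℓ j ≤ N}.Finite := by
  have := H.ell_tendsto.eventually_gt_atTop N
  rw [← Nat.cofinite_eq_atTop] at this
  simpa [Filter.eventually_cofinite] using this

/-- A measure with `ν(B(x,r)) ≤ D (r^α + d^α)` integrates `exp(-N ρ(x,·))` to at most a constant
times `D (N^{-α} + d^α)`. The summand `d^α` allows for discrete measures with mesh `d`. -/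
theorem lintegral_exp_dist_le (α : ℝ) :
    ∃ C > 0, ∀ (ν : Measure X) (D d N : ℝ), 0 ≤ D → 0 ≤ d → 0 < N → ∀ x : X,
      (∀ r, 0 < r → ν (Metric.closedBall x r) ≤ ENNReal.ofReal (D * (r ^ α + d ^ α))) →
      ∫⁻ y, ENNReal.ofReal (Real.exp (-(N * dist x y))) ∂ν ≤
        ENNReal.ofReal (C * D * (N ^ (-α) + d ^ α)) := by
  have hsum : Summable fun j : ℕ => Real.exp (-(j : ℝ)) * (((j : ℝ) + 1) ^ α + 1) := by
    obtain ⟨k, hk⟩ := exists_nat_ge (max α 0)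
    have h0 := ((summable_nat_add_iff 1).2
      (Real.summable_pow_mul_exp_neg_nat_mul k one_pos)).mul_left (Real.exp 1 * 2)
    refine Summable.of_nonneg_of_le (fun j => by positivity) (fun j => ?_) h0
    have hj1 : (1 : ℝ) ≤ (j : ℝ) + 1 := by simp
    have h1 : ((j : ℝ) + 1) ^ α ≤ ((j : ℝ) + 1) ^ k := by
      rw [← Real.rpow_natCast]
      exact Real.rpow_le_rpow_of_exponent_le hj1 ((le_max_left _ _).trans hk)
    have h2 : (1 : ℝ) ≤ ((j : ℝ) + 1) ^ k := one_le_pow₀ hj1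
    have h3 : Real.exp (-(j : ℝ)) = Real.exp 1 * Real.exp (-1 * ((j + 1 : ℕ) : ℝ)) := by
      rw [← Real.exp_add]; push_cast; ring_nf
    rw [h3]
    push_cast
    have := Real.exp_pos (-1 * ((j : ℝ) + 1))
    have := Real.exp_pos 1
    calc _ ≤ Real.exp 1 * Real.exp (-1 * ((j : ℝ) + 1)) *
          (((j : ℝ) + 1) ^ k + ((j : ℝ) + 1) ^ k) := by gcongr
      _ = _ := by ring
  refine ⟨∑' j : ℕ, Real.exp (-(j : ℝ)) * (((j : ℝ) + 1) ^ α + 1),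
    hsum.tsum_pos (fun j => by positivity) 0 (by positivity), ?_⟩
  intro ν D d N hD hd hN x hν
  -- the annulus `j ≤ N ρ(x,y) < j+1` lies in the ball of radius `(j+1)/N`, and the exponential is
  -- at most `exp(-j)` on it
  have hpt : ∀ y, ENNReal.ofReal (Real.exp (-(N * dist x y))) ≤
      ∑' j : ℕ, (Metric.closedBall x (((j : ℝ) + 1) / N)).indicator
        (fun _ => ENNReal.ofReal (Real.exp (-(j : ℝ)))) y := by
    intro y
    refine le_trans ?_ (ENNReal.le_tsum ⌊N * dist x y⌋₊)
    rw [Set.indicator_of_mem]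
    · refine ENNReal.ofReal_le_ofReal (Real.exp_le_exp.2 (neg_le_neg ?_))
      exact Nat.floor_le (by positivity)
    · rw [Metric.mem_closedBall, dist_comm, le_div_iff₀ hN, mul_comm]
      exact (Nat.lt_floor_add_one _).le
  calc _ ≤ ∫⁻ y, ∑' j : ℕ, (Metric.closedBall x (((j : ℝ) + 1) / N)).indicator
        (fun _ => ENNReal.ofReal (Real.exp (-(j : ℝ)))) y ∂ν := lintegral_mono hpt
    _ = ∑' j : ℕ, ENNReal.ofReal (Real.exp (-(j : ℝ))) *
        ν (Metric.closedBall x (((j : ℝ) + 1) / N)) := by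
        rw [lintegral_tsum]
        · refine tsum_congr fun j => ?_
          rw [lintegral_indicator_const Metric.isClosed_closedBall.measurableSet]
        · exact fun j => (measurable_const.indicator
            Metric.isClosed_closedBall.measurableSet).aemeasurable
    _ ≤ ∑' j : ℕ, ENNReal.ofReal (Real.exp (-(j : ℝ)) * (((j : ℝ) + 1) ^ α + 1) *
        (D * (N ^ (-α) + d ^ α))) := by
        refine ENNReal.tsum_le_tsum fun j => ?_
        have hj : 0 < ((j : ℝ) + 1) / N := by positivity
        refine (mul_le_mul_right (hν _ hj) _).trans ?_
        rw [← ENNReal.ofReal_mul (Real.exp_pos _).le]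
        refine ENNReal.ofReal_le_ofReal ?_
        rw [mul_assoc]
        refine mul_le_mul_of_nonneg_left ?_ (Real.exp_pos _).le
        rw [Real.div_rpow (by positivity) hN.le, Real.rpow_neg hN.le, div_eq_mul_inv]
        have h1 : 0 < ((j : ℝ) + 1) ^ α := by positivity
        have h2 : 0 < (N ^ α)⁻¹ := by positivity
        have h3 : 0 ≤ d ^ α := by positivity
        have : D * (((j : ℝ) + 1) ^ α * (N ^ α)⁻¹ + d ^ α) ≤
          D * (((((j : ℝ) + 1) ^ α) + 1) * ((N ^ α)⁻¹ + d ^ α)) := by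
          apply mul_le_mul_of_nonneg_left _ hD
          nlinarith [mul_nonneg h1.le h3]
        linarith
    _ = _ := by
        rw [← ENNReal.ofReal_tsum_of_nonneg (fun j => by positivity) (hsum.mul_right _),
          tsum_mul_right, mul_assoc]

/-- Integrals of the heat kernel at scale `N`, weighted by `exp(N ρ)`. -/
theorem IsHeatSystem.lintegral_heat_weighted_le (H : IsHeatSystem μ α φ ℓ) :
    ∃ M > 0, ∀ (ν : Measure X) (D d N : ℝ), 0 ≤ D → 0 ≤ d → 1 ≤ N → ∀ x : X,
      (∀ r, 0 < r → ν (Metric.closedBall x r) ≤ ENNReal.ofReal (D * (r ^ α + d ^ α))) →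
      ∫⁻ y, ‖kern φ (fun j => (heatSym ℓ (N ^ 2)⁻¹ j : ℂ)) x y‖ₑ *
        ENNReal.ofReal (Real.exp (N * dist x y)) ∂ν ≤
        ENNReal.ofReal (M * D * (1 + (N * d) ^ α)) := by
  obtain ⟨c₁, hc₁, c, hc, hb⟩ := H.heat_bound
  obtain ⟨C, hC, hI⟩ := lintegral_exp_dist_le (X := X) α
  refine ⟨c₁ * Real.exp (1 / c) * C, by positivity, fun ν D d N hD hd hN x hν => ?_⟩
  have hN0 : 0 < N := by linarith
  have ht0 : 0 < (N ^ 2)⁻¹ := by positivity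
  have ht1 : (N ^ 2)⁻¹ ≤ 1 := inv_le_one_of_one_le₀ (one_le_pow₀ hN)
  have hpow : ((N ^ 2)⁻¹) ^ (-α / 2) = N ^ α := by
    rw [← Real.rpow_natCast, ← Real.rpow_neg hN0.le, ← Real.rpow_mul hN0.le]
    congr 1
    push_cast
    ring
  have hpt : ∀ y, ‖kern φ (fun j => (heatSym ℓ (N ^ 2)⁻¹ j : ℂ)) x y‖ₑ *
        ENNReal.ofReal (Real.exp (N * dist x y)) ≤
      ENNReal.ofReal (c₁ * Real.exp (1 / c) * N ^ α) *
        ENNReal.ofReal (Real.exp (-(N * dist x y))) := by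
    intro y
    rw [kern_heatSym, ← ofReal_norm, Complex.norm_real, Real.norm_eq_abs,
      ← ENNReal.ofReal_mul (abs_nonneg _), ← ENNReal.ofReal_mul (by positivity)]
    refine ENNReal.ofReal_le_ofReal ?_
    have h1 := hb _ ht0 ht1 x y
    rw [hpow] at h1
    have h2 : -c * dist x y ^ 2 / (N ^ 2)⁻¹ = -c * (N * dist x y) ^ 2 := by
      field_simp
    rw [h2] at h1
    calc _ ≤ c₁ * N ^ α * Real.exp (-c * (N * dist x y) ^ 2) * Real.exp (N * dist x y) := by
          gcongr
      _ = c₁ * N ^ α * Real.exp (-c * (N * dist x y) ^ 2 + N * dist x y) := by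
          rw [mul_assoc, ← Real.exp_add]
      _ ≤ c₁ * N ^ α * Real.exp (1 / c + -(N * dist x y)) := by
          refine mul_le_mul_of_nonneg_left (Real.exp_le_exp.2 ?_) (by positivity)
          -- with `u = N ρ(x,y)`, completing the square gives `-cu² + u ≤ 1/c - u`
          have : 1 / c - 2 * (N * dist x y) + c * (N * dist x y) ^ 2 =
            c * (N * dist x y - 1 / c) ^ 2 := by
            field_simp
            ring
          nlinarith [mul_nonneg hc.le (sq_nonneg (N * dist x y - 1 / c))]
      _ = _ := by rw [Real.exp_add]; ring
  calc _ ≤ ∫⁻ y, ENNReal.ofReal (c₁ * Real.exp (1 / c) * N ^ α) *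
        ENNReal.ofReal (Real.exp (-(N * dist x y))) ∂ν := lintegral_mono hpt
    _ = ENNReal.ofReal (c₁ * Real.exp (1 / c) * N ^ α) *
        ∫⁻ y, ENNReal.ofReal (Real.exp (-(N * dist x y))) ∂ν := by
        rw [lintegral_const_mul' _ _ ENNReal.ofReal_ne_top]
    _ ≤ ENNReal.ofReal (c₁ * Real.exp (1 / c) * N ^ α) *
        ENNReal.ofReal (C * D * (N ^ (-α) + d ^ α)) := by
        gcongr
        exact hI ν D d N hD hd hN0 x hν
    _ = _ := by
        rw [← ENNReal.ofReal_mul (by positivity), Real.mul_rpow hN0.le hd]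
        congr 1
        have : N ^ α * N ^ (-α) = 1 := by
          rw [← Real.rpow_add hN0]; simp
        linear_combination c₁ * Real.exp (1 / c) * C * D * this

/-- The upper regularity of `μ` in the form used for discrete measures, with mesh `d = 0`: since
`α > 0`, the term `0 ^ α` vanishes. -/
theorem IsHeatSystem.measure_closedBall_le (H : IsHeatSystem μ α φ ℓ) :
    ∃ D > 0, ∀ (x : X) (r : ℝ), 0 < r →
      μ (Metric.closedBall x r) ≤ ENNReal.ofReal (D * (r ^ α + 0 ^ α)) := by
  obtain ⟨c, hc, hb⟩ := H.ball_le
  refine ⟨c, hc, fun x r hr => ?_⟩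
  rw [Real.zero_rpow H.alpha_pos.ne', add_zero, ← ENNReal.ofReal_toReal (measure_ne_top μ _)]
  exact ENNReal.ofReal_le_ofReal (hb x r hr)

/-- The weighted integrals of the heat kernel with respect to `μ` itself. The normalization
`M ≥ 1` is for later convenience. -/
theorem IsHeatSystem.lintegral_heat_weighted_le' (H : IsHeatSystem μ α φ ℓ) :
    ∃ M ≥ 1, ∀ N : ℝ, 1 ≤ N → ∀ x : X,
      ∫⁻ y, ‖kern φ (fun j => (heatSym ℓ (N ^ 2)⁻¹ j : ℂ)) x y‖ₑ *
        ENNReal.ofReal (Real.exp (N * dist x y)) ∂μ ≤ ENNReal.ofReal M := by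
  obtain ⟨M, hM, h⟩ := H.lintegral_heat_weighted_le
  obtain ⟨D, hD, hD'⟩ := H.measure_closedBall_le
  refine ⟨max (M * D) 1, le_max_right _ _, fun N hN x => ?_⟩
  refine (h μ D 0 N hD.le le_rfl hN x (hD' x)).trans (ENNReal.ofReal_le_ofReal ?_)
  rw [mul_zero, Real.zero_rpow H.alpha_pos.ne', add_zero, mul_one]
  exact le_max_left _ _

/-- The sum of the squares `φ_j(x)²` up to frequency `N` is `O(N^α)`: the heat symbol at time `N^{-2}` is
at least `exp(-1)` there, so the sum is dominated by the heat kernel on the diagonal. -/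
theorem IsHeatSystem.exists_growth (H : IsHeatSystem μ α φ ℓ) :
    ∃ C ≥ 1, ∀ N : ℝ, 1 ≤ N → ∀ s : Finset ℕ, (∀ j ∈ s, ℓ j ≤ N) → ∀ x : X,
      ∑ j ∈ s, φ j x ^ 2 ≤ C * N ^ α := by
  obtain ⟨K, hK, hs⟩ := H.abs_sum
  refine ⟨max (Real.exp 1 * K) 1, le_max_right _ _, fun N hN s hsN x => ?_⟩
  have hN0 : 0 < N := by linarith
  have ht0 : 0 < (N ^ 2)⁻¹ := by positivity
  have ht1 : (N ^ 2)⁻¹ ≤ 1 := inv_le_one_of_one_le₀ (one_le_pow₀ hN)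
  have hpow : ((N ^ 2)⁻¹) ^ (-α / 2) = N ^ α := by
    rw [← Real.rpow_natCast, ← Real.rpow_neg hN0.le, ← Real.rpow_mul hN0.le]
    congr 1
    push_cast
    ring
  obtain ⟨h1, h2⟩ := hs _ ht0 ht1 x x
  rw [hpow] at h2
  have h3 : ∀ j ∈ s, φ j x ^ 2 ≤
      Real.exp 1 * (heatSym ℓ (N ^ 2)⁻¹ j * (|φ j x| * |φ j x|)) := by
    intro j hj
    have h4 : Real.exp (-1) ≤ heatSym ℓ (N ^ 2)⁻¹ j := by
      refine Real.exp_le_exp.2 ?_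
      have h5 : ℓ j ^ 2 ≤ N ^ 2 := pow_le_pow_left₀ (H.ell_nonneg j) (hsN j hj) 2
      have : ℓ j ^ 2 * (N ^ 2)⁻¹ ≤ 1 := by
        rw [← div_eq_mul_inv]
        exact div_le_one_of_le₀ h5 (by positivity)
      linarith
    have h6 : 1 ≤ Real.exp 1 * heatSym ℓ (N ^ 2)⁻¹ j := by
      calc 1 = Real.exp 1 * Real.exp (-1) := by rw [← Real.exp_add]; simp
        _ ≤ _ := by gcongr
    rw [abs_mul_abs_self, ← mul_assoc, ← sq]
    exact le_mul_of_one_le_left (sq_nonneg _) h6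
  calc _ ≤ ∑ j ∈ s, Real.exp 1 * (heatSym ℓ (N ^ 2)⁻¹ j * (|φ j x| * |φ j x|)) :=
        Finset.sum_le_sum h3
    _ = Real.exp 1 * ∑ j ∈ s, (heatSym ℓ (N ^ 2)⁻¹ j * (|φ j x| * |φ j x|)) := by
        rw [Finset.mul_sum]
    _ ≤ Real.exp 1 * (K * N ^ α) := by
        gcongr
        refine (h1.sum_le_tsum s fun j _ => ?_).trans h2
        have := heatSym_pos ℓ (N ^ 2)⁻¹ j
        positivity
    _ ≤ _ := by
        rw [← mul_assoc]
        gcongr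
        exact le_max_left _ _

/-- Polynomial growth of the number of frequencies up to `N` and of the sup norms of the
corresponding `φ_j`. -/
theorem IsHeatSystem.exists_card_phi_le (H : IsHeatSystem μ α φ ℓ) :
    ∃ C ≥ 1, ∀ N : ℝ, 1 ≤ N → (∀ s : Finset ℕ, (∀ j ∈ s, ℓ j ≤ N) → (s.card : ℝ) ≤ C * N ^ α) ∧
      ∀ j, ℓ j ≤ N → ∀ x : X, |φ j x| ≤ C * N ^ α := by
  obtain ⟨C, hC, h⟩ := H.exists_growth
  refine ⟨C, hC, fun N hN => ⟨fun s hs => ?_, fun j hj x => ?_⟩⟩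
  · have hint : ∀ j, Integrable (fun x => φ j x ^ 2) μ := fun j =>
      Continuous.integrable_of_hasCompactSupport ((H.phi_continuous j).pow 2)
        (HasCompactSupport.of_compactSpace _)
    have h1 : ∫ x, ∑ j ∈ s, φ j x ^ 2 ∂μ ≤ ∫ _, C * N ^ α ∂μ :=
      integral_mono (integrable_finsetSum _ fun j _ => hint j) (integrable_const _)
        fun x => h N hN s hs x
    rw [integral_finsetSum _ fun j _ => hint j] at h1
    have h2 : ∀ j, ∫ x, φ j x ^ 2 ∂μ = 1 := fun j => by
      have := H.phi_orthonormal j j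
      simpa [sq] using this
    simpa [h2] using h1
  · have h1 := h N hN {j} (by simpa using hj) x
    rw [Finset.sum_singleton] at h1
    have h2 : 1 ≤ C * N ^ α :=
      one_le_mul_of_one_le_of_one_le hC (Real.one_le_rpow hN H.alpha_pos.le)
    refine abs_le_of_sq_le_sq (h1.trans ?_) (by linarith)
    nlinarith

/-- The heat kernel spreads no mass to a fixed distance as its scale shrinks. -/
theorem IsHeatSystem.tendsto_heat_off_diag (H : IsHeatSystem μ α φ ℓ) {δ : ℝ} (hδ : 0 < δ) :
    ∃ e : ℕ → ℝ, Tendsto e atTop (𝓝 0) ∧ ∀ n : ℕ, ∀ x y : X, δ ≤ dist x y →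
      ‖kern φ (fun j => (heatSym ℓ (((n + 1 : ℕ) : ℝ) ^ 2)⁻¹ j : ℂ)) x y‖ ≤ e n := by
  obtain ⟨c₁, hc₁, c, hc, hb⟩ := H.heat_bound
  refine ⟨fun n => c₁ * ((((n + 1 : ℕ) : ℝ) ^ 2) ^ (α / 2) *
    Real.exp (-(c * δ ^ 2) * ((n + 1 : ℕ) : ℝ) ^ 2)), ?_, fun n x y hxy => ?_⟩
  · have h1 := tendsto_rpow_mul_exp_neg_mul_atTop_nhds_zero (α / 2) (c * δ ^ 2) (by positivity)
    have h2 : Tendsto (fun n : ℕ => ((n + 1 : ℕ) : ℝ) ^ 2) atTop atTop :=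
      (tendsto_pow_atTop two_ne_zero).comp
        (tendsto_natCast_atTop_atTop.comp (tendsto_add_atTop_nat 1))
    simpa using (h1.comp h2).const_mul c₁
  · have hN : (1 : ℝ) ≤ ((n + 1 : ℕ) : ℝ) := by push_cast; linarith [Nat.cast_nonneg (α := ℝ) n]
    have hN0 : (0 : ℝ) < ((n + 1 : ℕ) : ℝ) := by linarith
    have h1 := hb ((((n + 1 : ℕ) : ℝ) ^ 2)⁻¹) (by positivity)
      (inv_le_one_of_one_le₀ (one_le_pow₀ hN)) x y
    rw [kern_heatSym, Complex.norm_real, Real.norm_eq_abs]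
    refine h1.trans ?_
    rw [mul_assoc]
    have h2 : ((((n + 1 : ℕ) : ℝ) ^ 2)⁻¹) ^ (-α / 2) = (((n + 1 : ℕ) : ℝ) ^ 2) ^ (α / 2) := by
      rw [Real.inv_rpow (by positivity), neg_div, Real.rpow_neg (by positivity), inv_inv]
    rw [h2, div_inv_eq_mul]
    dsimp only
    gcongr
    have : c * δ ^ 2 ≤ c * dist x y ^ 2 := by gcongr
    linarith

theorem IsHeatSystem.integral_heat (H : IsHeatSystem μ α φ ℓ) {t : ℝ} (ht : 0 < t) (ht1 : t ≤ 1)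
    (x : X) : ∫ y, kern φ (fun j => (heatSym ℓ t j : ℂ)) x y ∂μ = 1 := by
  simp_rw [kern_heatSym]
  rw [integral_complex_ofReal, H.heat_integral t ht ht1 x, Complex.ofReal_one]

theorem inv_sq_pos_le_one (n : ℕ) :
    0 < (((n + 1 : ℕ) : ℝ) ^ 2)⁻¹ ∧ (((n + 1 : ℕ) : ℝ) ^ 2)⁻¹ ≤ 1 := by
  have hN : (1 : ℝ) ≤ ((n + 1 : ℕ) : ℝ) := by push_cast; linarith [Nat.cast_nonneg (α := ℝ) n]
  exact ⟨by positivity, inv_le_one_of_one_le₀ (one_le_pow₀ hN)⟩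

/-- The measure charges every nonempty open set: otherwise the heat kernel at the centre of a
null ball could not have integral one. -/
theorem IsHeatSystem.isOpenPosMeasure (H : IsHeatSystem μ α φ ℓ) : μ.IsOpenPosMeasure := by
  refine ⟨fun U hU ⟨x, hx⟩ h0 => ?_⟩
  obtain ⟨δ, hδ, hsub⟩ := Metric.isOpen_iff.1 hU x hx
  obtain ⟨e, he, hb⟩ := H.tendsto_heat_off_diag hδ
  have h1 : ∀ n, 1 ≤ e n := by
    intro n
    obtain ⟨ht0, ht1⟩ := inv_sq_pos_le_one n
    have h2 : ∀ᵐ y ∂μ,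
        ‖kern φ (fun j => (heatSym ℓ (((n + 1 : ℕ) : ℝ) ^ 2)⁻¹ j : ℂ)) x y‖ ≤ e n := by
      have h3 : ∀ᵐ y ∂μ, y ∉ U := measure_eq_zero_iff_ae_notMem.1 h0
      filter_upwards [h3] with y hy
      refine hb n x y ?_
      by_contra hlt
      exact hy (hsub (by rw [Metric.mem_ball, dist_comm]; exact not_le.1 hlt))
    have h4 := norm_integral_le_of_norm_le_const h2
    rw [H.integral_heat ht0 ht1] at h4
    simpa using h4
  have := ge_of_tendsto' he h1
  linarith

/-- Heat means of a bounded continuous function converge to it. -/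
theorem IsHeatSystem.tendsto_integral_heat_mul (H : IsHeatSystem μ α φ ℓ) {g : X → ℂ}
    (hg : Continuous g) (x : X) :
    Tendsto (fun n : ℕ => ∫ y, kern φ (fun j => (heatSym ℓ (((n + 1 : ℕ) : ℝ) ^ 2)⁻¹ j : ℂ)) x y *
      g y ∂μ) atTop (𝓝 (g x)) := by
  obtain ⟨M, hM1, hM⟩ := H.lintegral_heat_weighted_le'
  obtain ⟨B, hB⟩ := (isCompact_univ (X := X)).exists_bound_of_continuousOn hg.continuousOn
  have hB0 : 0 ≤ B := (norm_nonneg _).trans (hB x trivial)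
  rw [Metric.tendsto_atTop]
  intro ε hε
  obtain ⟨δ, hδ, hcont⟩ := Metric.continuous_iff.1 hg x (ε / (2 * M)) (by positivity)
  obtain ⟨e, he, hb⟩ := H.tendsto_heat_off_diag hδ
  have he2 : Tendsto (fun n => e n * (2 * B)) atTop (𝓝 0) := by simpa using he.mul_const (2 * B)
  obtain ⟨n₀, hn₀⟩ := (Metric.tendsto_atTop.1 he2) (ε / 2) (by positivity)
  refine ⟨n₀, fun n hn => ?_⟩
  obtain ⟨ht0, ht1⟩ := inv_sq_pos_le_one n
  set m : ℕ → ℂ := fun j => (heatSym ℓ (((n + 1 : ℕ) : ℝ) ^ 2)⁻¹ j : ℂ) with hm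
  have hadm : Adm ℓ m := adm_heatSym ht0 ht1
  have hki := integrable_kern_left H hadm x
  have hgi : Integrable (fun y => kern φ m x y * g y) μ :=
    hki.mul_bdd (c := B) hg.aestronglyMeasurable (Eventually.of_forall fun y => hB y trivial)
  have hn1 : ∫ y, ‖kern φ m x y‖ ∂μ ≤ M := by
    have h1 : ∫⁻ y, ‖kern φ m x y‖ₑ ∂μ ≤ ENNReal.ofReal M := by
      refine le_trans (lintegral_mono fun y => ?_) (hM ((n + 1 : ℕ) : ℝ)
        (by push_cast; linarith [Nat.cast_nonneg (α := ℝ) n]) x)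
      refine le_mul_of_one_le_right zero_le ?_
      rw [ENNReal.one_le_ofReal]
      exact Real.one_le_exp (by positivity)
    rw [integral_norm_eq_lintegral_enorm hki.aestronglyMeasurable]
    exact ENNReal.toReal_le_of_le_ofReal (by linarith) h1
  have hgx : g x = ∫ y, kern φ m x y * g x ∂μ := by
    rw [integral_mul_const, H.integral_heat ht0 ht1, one_mul]
  rw [dist_eq_norm]
  have hdiff : ∫ y, kern φ m x y * g y ∂μ - g x =
      ∫ y, (kern φ m x y * g y - kern φ m x y * g x) ∂μ := by
    rw [integral_sub hgi (hki.mul_const _), ← hgx]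
  rw [hdiff]
  have hen : 0 ≤ |e n| := abs_nonneg _
  calc ‖∫ y, (kern φ m x y * g y - kern φ m x y * g x) ∂μ‖
      ≤ ∫ y, (‖kern φ m x y‖ * (ε / (2 * M)) + |e n * (2 * B)|) ∂μ := by
        refine norm_integral_le_of_norm_le ((hki.norm.mul_const _).add (integrable_const _))
          (Eventually.of_forall fun y => ?_)
        rw [← mul_sub, norm_mul]
        by_cases hy : dist y x < δ
        · have := hcont y hy
          rw [dist_eq_norm] at this
          have h3 := abs_nonneg (e n * (2 * B))
          have h4 := mul_le_mul_of_nonneg_left this.le (norm_nonneg (kern φ m x y))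
          linarith
        · have h3 : ‖kern φ m x y‖ ≤ e n := hb n x y (by rw [dist_comm]; exact not_lt.1 hy)
          have h4 : ‖g y - g x‖ ≤ 2 * B := by
            have := norm_sub_le (g y) (g x)
            linarith [hB y trivial, hB x trivial]
          have h5 : ‖kern φ m x y‖ * ‖g y - g x‖ ≤ e n * (2 * B) :=
            mul_le_mul h3 h4 (norm_nonneg _) ((norm_nonneg _).trans h3)
          have h6 := le_abs_self (e n * (2 * B))
          have h7 : 0 ≤ ‖kern φ m x y‖ * (ε / (2 * M)) := by positivity
          linarith
    _ = (∫ y, ‖kern φ m x y‖ ∂μ) * (ε / (2 * M)) + |e n * (2 * B)| := by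
        rw [integral_add (hki.norm.mul_const _) (integrable_const _), integral_mul_const]
        simp
    _ < ε := by
        have h8 := hn₀ n hn
        rw [Real.dist_eq, sub_zero] at h8
        have h9 : (∫ y, ‖kern φ m x y‖ ∂μ) * (ε / (2 * M)) ≤ M * (ε / (2 * M)) := by gcongr
        have h10 : M * (ε / (2 * M)) = ε / 2 := by field_simp
        linarith

/-- Heat means are bounded in the uniform norm, uniformly in time. -/
theorem IsHeatSystem.norm_integral_heat_mul_le (H : IsHeatSystem μ α φ ℓ) :
    ∃ M : ℝ, ∀ (g : X → ℂ) (B : ℝ), (∀ y, ‖g y‖ ≤ B) → ∀ (n : ℕ) (x : X),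
      ‖∫ y, kern φ (fun j => (heatSym ℓ (((n + 1 : ℕ) : ℝ) ^ 2)⁻¹ j : ℂ)) x y * g y ∂μ‖ ≤
        M * B := by
  obtain ⟨M, hM1, hM⟩ := H.lintegral_heat_weighted_le'
  refine ⟨M, fun g B hB n x => ?_⟩
  have hB0 : 0 ≤ B := (norm_nonneg _).trans (hB x)
  obtain ⟨ht0, ht1⟩ := inv_sq_pos_le_one n
  set m : ℕ → ℂ := fun j => (heatSym ℓ (((n + 1 : ℕ) : ℝ) ^ 2)⁻¹ j : ℂ) with hm
  have hki := integrable_kern_left H (adm_heatSym (ℓ := ℓ) ht0 ht1) x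
  have hn1 : ∫ y, ‖kern φ m x y‖ ∂μ ≤ M := by
    have h1 : ∫⁻ y, ‖kern φ m x y‖ₑ ∂μ ≤ ENNReal.ofReal M := by
      refine le_trans (lintegral_mono fun y => ?_) (hM ((n + 1 : ℕ) : ℝ)
        (by push_cast; linarith [Nat.cast_nonneg (α := ℝ) n]) x)
      refine le_mul_of_one_le_right zero_le ?_
      rw [ENNReal.one_le_ofReal]
      exact Real.one_le_exp (by positivity)
    rw [integral_norm_eq_lintegral_enorm hki.aestronglyMeasurable]
    exact ENNReal.toReal_le_of_le_ofReal (by linarith) h1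
  calc _ ≤ ∫ y, ‖kern φ m x y‖ * B ∂μ := by
        refine norm_integral_le_of_norm_le (hki.norm.mul_const _)
          (Eventually.of_forall fun y => ?_)
        rw [norm_mul]
        exact mul_le_mul_of_nonneg_left (hB y) (norm_nonneg _)
    _ = (∫ y, ‖kern φ m x y‖ ∂μ) * B := integral_mul_const _ _
    _ ≤ M * B := by gcongr

/-- An integrable function with vanishing coefficients is annihilated by every admissible
kernel, by termwise integration. -/
theorem integral_mul_kern_eq_zero (H : IsHeatSystem μ α φ ℓ) {m : ℕ → ℂ} (hm : Adm ℓ m)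
    {f : X → ℂ} (hf : Integrable f μ) (h0 : ∀ k, coeff μ φ f k = 0) (y : X) :
    ∫ x, f x * kern φ m x y ∂μ = 0 := by
  obtain ⟨B, hB0, hB⟩ := hm.abs_sum H
  have hc := H.phi_continuous
  have hphi : ∀ j, ∃ C, ∀ x : X, |φ j x| ≤ C := fun j =>
    let ⟨C, _, h⟩ := exists_phi_bound H j
    ⟨C, h⟩
  have hint : ∀ j, Integrable (fun x => f x * (φ j x : ℂ)) μ := fun j => by
    obtain ⟨C, hC⟩ := hphi j
    refine hf.mul_bdd (c := C) ?_ (Eventually.of_forall fun x => by simpa using hC x)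
    refine Continuous.aestronglyMeasurable ?_
    fun_prop
  have hint2 : ∀ j, Integrable (fun x => f x * (φ j x : ℂ) * (m j * (φ j y : ℂ))) μ :=
    fun j => (hint j).mul_const _
  have hnorm : ∀ j x, ‖f x * (φ j x : ℂ) * (m j * (φ j y : ℂ))‖ =
      ‖f x‖ * (‖m j‖ * (|φ j x| * |φ j y|)) := fun j x => by
    simp only [norm_mul, Complex.norm_real, Real.norm_eq_abs]
    ring
  have key := hasSum_integral_of_summable_integral_norm
    (F := fun j x => f x * (φ j x : ℂ) * (m j * (φ j y : ℂ))) hint2 (by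
      refine summable_of_sum_le (c := ∫ x, ‖f x‖ * B ∂μ)
        (fun j => integral_nonneg fun _ => norm_nonneg _) fun u => ?_
      rw [← integral_finsetSum _ fun j _ => (hint2 j).norm]
      refine integral_mono (integrable_finsetSum _ fun j _ => (hint2 j).norm)
        (hf.norm.mul_const _) fun x => ?_
      simp_rw [hnorm]
      rw [← Finset.mul_sum]
      refine mul_le_mul_of_nonneg_left ?_ (norm_nonneg _)
      exact ((hB x y).1.sum_le_tsum u (fun _ _ => by positivity)).trans (hB x y).2)
  have h1 : ∀ x, ∑' j, f x * (φ j x : ℂ) * (m j * (φ j y : ℂ)) = f x * kern φ m x y := fun x => by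
    rw [kern, ← tsum_mul_left]
    exact tsum_congr fun j => by ring
  simp_rw [h1] at key
  rw [← key.tsum_eq]
  have h2 : ∀ j, ∫ x, f x * (φ j x : ℂ) * (m j * (φ j y : ℂ)) ∂μ = 0 := fun j => by
    rw [integral_mul_const]
    have := h0 j
    rw [coeff] at this
    rw [this, zero_mul]
  simp [h2]

/-- The system `φ` is complete in `L¹`: a function all of whose coefficients vanish is zero. -/
theorem IsHeatSystem.ae_eq_zero_of_coeff (H : IsHeatSystem μ α φ ℓ) {f : X → ℂ}
    (hf : Integrable f μ) (h0 : ∀ k, coeff μ φ f k = 0) : f =ᵐ[μ] 0 := by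
  obtain ⟨M, hM⟩ := H.norm_integral_heat_mul_le
  -- a continuous `g` is the bounded limit of its heat means, which `f` annihilates
  have hcont : ∀ g : X → ℂ, Continuous g → ∫ x, f x * g x ∂μ = 0 := by
    intro g hg
    obtain ⟨B, hB⟩ := (isCompact_univ (X := X)).exists_bound_of_continuousOn hg.continuousOn
    have hlim := tendsto_integral_of_dominated_convergence (μ := μ)
      (F := fun (n : ℕ) x => f x *
        ∫ y, kern φ (fun j => (heatSym ℓ (((n + 1 : ℕ) : ℝ) ^ 2)⁻¹ j : ℂ)) x y * g y ∂μ)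
      (f := fun x => f x * g x) (fun x => ‖f x‖ * (M * B)) (fun n => by
        obtain ⟨ht0, ht1⟩ := inv_sq_pos_le_one n
        refine hf.aestronglyMeasurable.mul ?_
        have h1 := measurable_kern H (adm_heatSym (ℓ := ℓ) ht0 ht1)
        have h2 : Measurable fun z : X × X =>
          kern φ (fun j => (heatSym ℓ (((n + 1 : ℕ) : ℝ) ^ 2)⁻¹ j : ℂ)) z.1 z.2 * g z.2 :=
          h1.mul (hg.measurable.comp measurable_snd)
        exact (h2.stronglyMeasurable.integral_prod_right' (ν := μ)).aestronglyMeasurable)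
      (hf.norm.mul_const _)
      (fun n => Eventually.of_forall fun x => by
        rw [norm_mul]
        exact mul_le_mul_of_nonneg_left (hM g B (fun y => hB y trivial) n x) (norm_nonneg _))
      (Eventually.of_forall fun x => (H.tendsto_integral_heat_mul hg x).const_mul _)
    have hz : ∀ n : ℕ, ∫ x, f x *
        ∫ y, kern φ (fun j => (heatSym ℓ (((n + 1 : ℕ) : ℝ) ^ 2)⁻¹ j : ℂ)) x y * g y ∂μ ∂μ = 0 := by
      intro n
      obtain ⟨ht0, ht1⟩ := inv_sq_pos_le_one n
      have hadm := adm_heatSym (ℓ := ℓ) ht0 ht1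
      obtain ⟨K, hK0, hK⟩ := hadm.norm_kern_le H
      simp_rw [← integral_const_mul]
      rw [integral_integral_swap]
      · have h3 : ∀ y, ∫ x, f x * (kern φ (fun j =>
            (heatSym ℓ (((n + 1 : ℕ) : ℝ) ^ 2)⁻¹ j : ℂ)) x y * g y) ∂μ = 0 := by
          intro y
          simp_rw [← mul_assoc]
          rw [integral_mul_const, integral_mul_kern_eq_zero H hadm hf h0, zero_mul]
        simp only [h3, integral_zero]
      · have h4 : Integrable (fun z : X × X => f z.1) (μ.prod μ) := hf.comp_fst μ
        refine h4.mul_bdd (c := K * B) ?_ (Eventually.of_forall fun z => ?_)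
        · exact ((measurable_kern H hadm).mul
            (hg.measurable.comp measurable_snd)).aestronglyMeasurable
        · rw [norm_mul]
          exact mul_le_mul (hK _ _) (hB _ trivial) (norm_nonneg _) hK0
    simp_rw [hz] at hlim
    exact (tendsto_nhds_unique hlim tendsto_const_nhds)
  -- indicators of closed sets are bounded limits of continuous functions
  refine ae_eq_zero_of_forall_setIntegral_isClosed_eq_zero hf fun F hF => ?_
  rw [← integral_indicator hF.measurableSet]
  set δ : ℕ → ℝ := fun n => 1 / ((n : ℝ) + 1) with hδ
  have hδ0 : ∀ n, 0 < δ n := fun n => by positivity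
  have hδl : Tendsto δ atTop (𝓝 0) := tendsto_one_div_add_atTop_nhds_zero_nat
  have hlim := tendsto_integral_of_dominated_convergence (μ := μ)
      (F := fun (n : ℕ) x => f x * (((thickenedIndicator (hδ0 n) F x : NNReal) : ℝ) : ℂ))
      (f := F.indicator f) (fun x => ‖f x‖) (fun n => by
        refine hf.aestronglyMeasurable.mul (Continuous.aestronglyMeasurable ?_)
        have := (thickenedIndicator (hδ0 n) F).continuous
        fun_prop)
      hf.norm
      (fun n => Eventually.of_forall fun x => by
        rw [norm_mul]
        refine mul_le_of_le_one_right (norm_nonneg _) ?_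
        simpa using thickenedIndicator_le_one (hδ0 n) F x)
      (Eventually.of_forall fun x => by
        have h5 := thickenedIndicator_tendsto_indicator_closure hδ0 hδl F
        rw [tendsto_pi_nhds] at h5
        have h6 := h5 x
        have h7 : Tendsto (fun n => (((thickenedIndicator (hδ0 n) F x : NNReal) : ℝ) : ℂ)) atTop
            (𝓝 ((((closure F).indicator (fun _ => (1 : NNReal)) x : NNReal) : ℝ) : ℂ)) :=
          (Complex.continuous_ofReal.comp NNReal.continuous_coe).continuousAt.tendsto.comp h6
        have h8 := h7.const_mul (f x)
        rw [hF.closure_eq] at h8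
        convert h8 using 2
        by_cases hx : x ∈ F <;> simp [hx])
  have hz : ∀ n : ℕ, ∫ x, f x * (((thickenedIndicator (hδ0 n) F x : NNReal) : ℝ) : ℂ) ∂μ = 0 :=
    fun n => hcont _ (by
      have := (thickenedIndicator (hδ0 n) F).continuous
      fun_prop)
  simp_rw [hz] at hlim
  exact tendsto_nhds_unique hlim tendsto_const_nhds

/-! ### The oscillatory multipliers `exp(iθτ)τ` -/

/-- The norm `sup_x ∫ |K(x,y)| dμ(y)` of the kernel of a multiplier; by symmetry of the kernel it
bounds the associated operator on every `L^p(μ)`. -/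
noncomputable def knorm {X : Type*} [MeasurableSpace X] (μ : Measure X) (φ : ℕ → X → ℝ)
    (m : ℕ → ℂ) : ℝ≥0∞ :=
  ⨆ x, ∫⁻ y, ‖kern φ m x y‖ₑ ∂μ

theorem lintegral_kern_le_knorm (m : ℕ → ℂ) (x : X) :
    ∫⁻ y, ‖kern φ m x y‖ₑ ∂μ ≤ knorm μ φ m :=
  le_iSup (fun x => ∫⁻ y, ‖kern φ m x y‖ₑ ∂μ) x

theorem adm_heatSym_pow {t : ℝ} (ht : 0 < t) (ht1 : t ≤ 1) (k : ℕ) :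
    Adm ℓ (fun j => (heatSym ℓ t j : ℂ) ^ (k + 1)) := by
  refine ⟨t, ht, ht1, 1, fun j => ?_⟩
  rw [norm_pow, Complex.norm_real, Real.norm_of_nonneg (heatSym_pos ℓ t j).le, one_mul]
  exact pow_le_of_le_one (heatSym_pos ℓ t j).le (heatSym_le_one ℓ ht.le j) k.succ_ne_zero

/-- Powers of the heat operator in the `L¹` sense with the weight `exp(N ρ)`. By the triangle
inequality the weight is submultiplicative, so the norms of powers are at most the powers of the
norm. -/
theorem lintegral_heat_pow_weighted_le (H : IsHeatSystem μ α φ ℓ) {N : ℝ} (hN : 1 ≤ N) {M : ℝ≥0∞}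
    (hM : ∀ x : X, ∫⁻ y, ‖kern φ (fun j => (heatSym ℓ (N ^ 2)⁻¹ j : ℂ)) x y‖ₑ *
        ENNReal.ofReal (Real.exp (N * dist x y)) ∂μ ≤ M) (k : ℕ) (x : X) :
    ∫⁻ y, ‖kern φ (fun j => (heatSym ℓ (N ^ 2)⁻¹ j : ℂ) ^ (k + 1)) x y‖ₑ *
        ENNReal.ofReal (Real.exp (N * dist x y)) ∂μ ≤ M ^ (k + 1) := by
  have hN0 : 0 < N := by linarith
  have ht0 : 0 < (N ^ 2)⁻¹ := by positivity
  have ht1 : (N ^ 2)⁻¹ ≤ 1 := inv_le_one_of_one_le₀ (one_le_pow₀ hN)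
  induction k with
  | zero => simpa using hM x
  | succ k ih =>
    set m : ℕ → ℂ := fun j => (heatSym ℓ (N ^ 2)⁻¹ j : ℂ) with hm
    have hadm : Adm ℓ m := adm_heatSym ht0 ht1
    have hadk : Adm ℓ (fun j => m j ^ (k + 1)) := adm_heatSym_pow ht0 ht1 k
    set w : X → X → ℝ≥0∞ := fun x y => ENNReal.ofReal (Real.exp (N * dist x y)) with hw
    have hwtri : ∀ x z y, w x y ≤ w x z * w z y := fun x z y => by
      simp only [hw]
      rw [← ENNReal.ofReal_mul (Real.exp_pos _).le, ← Real.exp_add, ← mul_add]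
      refine ENNReal.ofReal_le_ofReal (Real.exp_le_exp.2 ?_)
      exact mul_le_mul_of_nonneg_left (dist_triangle x z y) hN0.le
    have hwm : Measurable fun z : X × X => w z.1 z.2 := by
      have : Continuous fun z : X × X => Real.exp (N * dist z.1 z.2) := by fun_prop
      exact this.measurable.ennreal_ofReal
    have hk1 := (measurable_kern H hadk).enorm
    have hk2 := (measurable_kern H hadm).enorm
    calc ∫⁻ y, ‖kern φ (fun j => m j ^ (k + 1 + 1)) x y‖ₑ * w x y ∂μ
        ≤ ∫⁻ y, ∫⁻ z, (‖kern φ (fun j => m j ^ (k + 1)) x z‖ₑ * w x z) *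
            (‖kern φ m z y‖ₑ * w z y) ∂μ ∂μ := by
          refine lintegral_mono fun y => ?_
          have h1 : kern φ (fun j => m j ^ (k + 1 + 1)) x y =
              ∫ z, kern φ (fun j => m j ^ (k + 1)) x z * kern φ m z y ∂μ := by
            rw [integral_kern_mul_kern H hadk hadm]
            simp_rw [← pow_succ]
          rw [h1]
          calc _ ≤ (∫⁻ z, ‖kern φ (fun j => m j ^ (k + 1)) x z * kern φ m z y‖ₑ ∂μ) * w x y := by
                gcongr
                exact enorm_integral_le_lintegral_enorm _
            _ = ∫⁻ z, ‖kern φ (fun j => m j ^ (k + 1)) x z * kern φ m z y‖ₑ * w x y ∂μ :=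
                (lintegral_mul_const' _ _ ENNReal.ofReal_ne_top).symm
            _ ≤ _ := by
                refine lintegral_mono fun z => ?_
                rw [enorm_mul]
                calc _ ≤ ‖kern φ (fun j => m j ^ (k + 1)) x z‖ₑ * ‖kern φ m z y‖ₑ *
                      (w x z * w z y) := by gcongr; exact hwtri x z y
                  _ = _ := by ring
      _ = ∫⁻ z, ∫⁻ y, (‖kern φ (fun j => m j ^ (k + 1)) x z‖ₑ * w x z) *
            (‖kern φ m z y‖ₑ * w z y) ∂μ ∂μ := by
          refine lintegral_lintegral_swap ?_
          have e1 : Measurable fun p : X × X => (x, p.2) := by fun_prop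
          have e2 : Measurable fun p : X × X => (p.2, p.1) := by fun_prop
          exact (((hk1.comp e1).mul (hwm.comp e1)).mul
            ((hk2.comp e2).mul (hwm.comp e2))).aemeasurable
      _ = ∫⁻ z, (‖kern φ (fun j => m j ^ (k + 1)) x z‖ₑ * w x z) *
            ∫⁻ y, (‖kern φ m z y‖ₑ * w z y) ∂μ ∂μ := by
          refine lintegral_congr fun z => ?_
          have e3 : Measurable fun y : X => (z, y) := by fun_prop
          exact lintegral_const_mul _ ((hk2.comp e3).mul (hwm.comp e3))
      _ ≤ ∫⁻ z, (‖kern φ (fun j => m j ^ (k + 1)) x z‖ₑ * w x z) * M ∂μ := by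
          gcongr with z
          exact hM z
      _ = (∫⁻ z, (‖kern φ (fun j => m j ^ (k + 1)) x z‖ₑ * w x z) ∂μ) * M := by
          have e4 : Measurable fun z : X => (x, z) := by fun_prop
          exact lintegral_mul_const _ ((hk1.comp e4).mul (hwm.comp e4))
      _ ≤ M ^ (k + 1) * M := by gcongr
      _ = M ^ (k + 1 + 1) := (pow_succ _ _).symm

/-- The symbol `exp(iθτ)τ` with `τ = exp(-ℓ_j² t)`. -/
noncomputable def oscSym (ℓ : ℕ → ℝ) (t θ : ℝ) (j : ℕ) : ℂ :=
  Complex.exp (θ * Complex.I * (heatSym ℓ t j : ℂ)) * (heatSym ℓ t j : ℂ)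

theorem norm_oscSym (t θ : ℝ) (j : ℕ) : ‖oscSym ℓ t θ j‖ = heatSym ℓ t j := by
  rw [oscSym, norm_mul, Complex.norm_real, Real.norm_of_nonneg (heatSym_pos ℓ t j).le]
  have : (θ : ℂ) * Complex.I * (heatSym ℓ t j : ℂ) = ((θ * heatSym ℓ t j : ℝ) : ℂ) * Complex.I := by
    push_cast; ring
  rw [this, Complex.norm_exp_ofReal_mul_I, one_mul]

theorem adm_oscSym {t : ℝ} (ht : 0 < t) (ht1 : t ≤ 1) (θ : ℝ) : Adm ℓ (oscSym ℓ t θ) :=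
  ⟨t, ht, ht1, 1, fun j => by rw [norm_oscSym, one_mul, heatSym]⟩

/-- The exponential series, at the level of kernels. -/
theorem kern_oscSym (H : IsHeatSystem μ α φ ℓ) {t : ℝ} (ht : 0 < t) (ht1 : t ≤ 1) (θ : ℝ)
    (x y : X) : kern φ (oscSym ℓ t θ) x y =
      ∑' k : ℕ, (θ * Complex.I) ^ k / (k.factorial : ℂ) *
        kern φ (fun j => (heatSym ℓ t j : ℂ) ^ (k + 1)) x y := by
  obtain ⟨K, hK, hs⟩ := H.abs_sum
  have hexp : Summable fun k : ℕ => |θ| ^ k / (k.factorial : ℝ) := Real.summable_pow_div_factorial _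
  have hF : Summable (Function.uncurry fun (j k : ℕ) => (θ * Complex.I) ^ k / (k.factorial : ℂ) *
      ((heatSym ℓ t j : ℂ) ^ (k + 1) * (φ j x : ℂ) * (φ j y : ℂ))) := by
    refine Summable.of_norm_bounded ((hs t ht ht1 x y).1.mul_of_nonneg hexp
      (fun j => by have := heatSym_pos ℓ t j; positivity) (fun k => by positivity)) ?_
    rintro ⟨j, k⟩
    have hτ := heatSym_pos ℓ t j
    simp only [Function.uncurry_apply_pair, norm_mul, norm_div, norm_pow, Complex.norm_real,
      Complex.norm_I, mul_one, Real.norm_eq_abs, Complex.norm_natCast, abs_of_pos hτ]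
    have h1 : heatSym ℓ t j ^ (k + 1) ≤ heatSym ℓ t j :=
      pow_le_of_le_one hτ.le (heatSym_le_one ℓ ht.le j) k.succ_ne_zero
    calc _ ≤ |θ| ^ k / (k.factorial : ℝ) * (heatSym ℓ t j * |φ j x| * |φ j y|) := by gcongr
      _ = _ := by ring
  have hswap := hF.tsum_comm
  unfold kern
  simp_rw [← tsum_mul_left]
  rw [hswap]
  refine tsum_congr fun j => ?_
  have h2 : ∀ k : ℕ, (θ * Complex.I) ^ k / (k.factorial : ℂ) *
      ((heatSym ℓ t j : ℂ) ^ (k + 1) * (φ j x : ℂ) * (φ j y : ℂ)) =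
      (θ * Complex.I * (heatSym ℓ t j : ℂ)) ^ k / (k.factorial : ℂ) *
        ((heatSym ℓ t j : ℂ) * (φ j x : ℂ) * (φ j y : ℂ)) := fun k => by
    rw [mul_pow _ (heatSym ℓ t j : ℂ), pow_succ]; ring
  simp_rw [h2]
  rw [tsum_mul_right, oscSym, Complex.exp_eq_exp_ℂ, NormedSpace.exp_eq_tsum_div]
  ring

/-- The exponential series bounds `exp(iθT)T` in the weighted `L¹` sense, at an exponential price
in `θ`. -/
theorem lintegral_oscSym_weighted_le (H : IsHeatSystem μ α φ ℓ) {N : ℝ} (hN : 1 ≤ N) {M : ℝ}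
    (hM0 : 0 ≤ M)
    (hM : ∀ x : X, ∫⁻ y, ‖kern φ (fun j => (heatSym ℓ (N ^ 2)⁻¹ j : ℂ)) x y‖ₑ *
        ENNReal.ofReal (Real.exp (N * dist x y)) ∂μ ≤ ENNReal.ofReal M) (θ : ℝ) (x : X) :
    ∫⁻ y, ‖kern φ (oscSym ℓ (N ^ 2)⁻¹ θ) x y‖ₑ * ENNReal.ofReal (Real.exp (N * dist x y)) ∂μ ≤
      ENNReal.ofReal (M * Real.exp (M * |θ|)) := by
  have ht0 : 0 < (N ^ 2)⁻¹ := by positivity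
  have ht1 : (N ^ 2)⁻¹ ≤ 1 := inv_le_one_of_one_le₀ (one_le_pow₀ hN)
  have hwm : Measurable fun y : X => ENNReal.ofReal (Real.exp (N * dist x y)) := by
    have : Continuous fun y : X => Real.exp (N * dist x y) := by fun_prop
    exact this.measurable.ennreal_ofReal
  have hcoef : ∀ k : ℕ, ‖((θ : ℂ) * Complex.I) ^ k / (k.factorial : ℂ)‖ₑ =
      ENNReal.ofReal (|θ| ^ k / (k.factorial : ℝ)) := fun k => by
    rw [← ofReal_norm]
    simp
  calc _ ≤ ∫⁻ y, ∑' k : ℕ, ENNReal.ofReal (|θ| ^ k / (k.factorial : ℝ)) *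
        (‖kern φ (fun j => (heatSym ℓ (N ^ 2)⁻¹ j : ℂ) ^ (k + 1)) x y‖ₑ *
          ENNReal.ofReal (Real.exp (N * dist x y))) ∂μ := by
        refine lintegral_mono fun y => ?_
        rw [kern_oscSym H ht0 ht1]
        calc _ ≤ (∑' k : ℕ, ‖((θ : ℂ) * Complex.I) ^ k / (k.factorial : ℂ) *
              kern φ (fun j => (heatSym ℓ (N ^ 2)⁻¹ j : ℂ) ^ (k + 1)) x y‖ₑ) *
              ENNReal.ofReal (Real.exp (N * dist x y)) := by
              gcongr
              exact enorm_tsum_le_tsum_enorm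
          _ = _ := by
              rw [← ENNReal.tsum_mul_right]
              refine tsum_congr fun k => ?_
              rw [enorm_mul, hcoef, mul_assoc]
    _ = ∑' k : ℕ, ENNReal.ofReal (|θ| ^ k / (k.factorial : ℝ)) *
        ∫⁻ y, (‖kern φ (fun j => (heatSym ℓ (N ^ 2)⁻¹ j : ℂ) ^ (k + 1)) x y‖ₑ *
          ENNReal.ofReal (Real.exp (N * dist x y))) ∂μ := by
        have hmeas : ∀ k : ℕ, Measurable fun y =>
            (‖kern φ (fun j => (heatSym ℓ (N ^ 2)⁻¹ j : ℂ) ^ (k + 1)) x y‖ₑ *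
              ENNReal.ofReal (Real.exp (N * dist x y))) := fun k =>
          (measurable_kern_left H (adm_heatSym_pow ht0 ht1 k) x).enorm.mul hwm
        rw [lintegral_tsum fun k => ((hmeas k).const_mul _).aemeasurable]
        exact tsum_congr fun k => lintegral_const_mul _ (hmeas k)
    _ ≤ ∑' k : ℕ, ENNReal.ofReal (M * ((M * |θ|) ^ k / (k.factorial : ℝ))) := by
        refine ENNReal.tsum_le_tsum fun k => ?_
        refine (mul_le_mul_right (lintegral_heat_pow_weighted_le H hN hM k x) _).trans ?_
        rw [← ENNReal.ofReal_pow hM0, ← ENNReal.ofReal_mul (by positivity)]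
        refine ENNReal.ofReal_le_ofReal (le_of_eq ?_)
        rw [mul_pow, pow_succ]
        ring
    _ = _ := by
        rw [← ENNReal.ofReal_tsum_of_nonneg (fun k => by positivity)
          ((Real.summable_pow_div_factorial _).mul_left _), tsum_mul_left,
          Real.exp_eq_exp_ℝ, NormedSpace.exp_eq_tsum_div]

/-- The kernel of `exp(iθT)T`, `T` a heat operator at scale `N`, grows only like `|θ|^{α/2}` in the
`L¹` sense. The exponential weight, which costs a factor `exp(M|θ|)`, makes everything outside the
ball of radius `M(1+|θ|)/N` negligible; inside that ball the `L²` bound, which does not see the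
unitary factor `exp(iθT)`, and the Cauchy-Schwarz inequality suffice. -/
theorem IsHeatSystem.knorm_oscSym_le (H : IsHeatSystem μ α φ ℓ) :
    ∃ C > 0, ∀ N : ℝ, 1 ≤ N → ∀ θ : ℝ,
      knorm μ φ (oscSym ℓ (N ^ 2)⁻¹ θ) ≤ ENNReal.ofReal (C * (1 + |θ|) ^ (α / 2)) := by
  obtain ⟨M, hM1, hM⟩ := H.lintegral_heat_weighted_le'
  obtain ⟨D, hD, hD'⟩ := H.measure_closedBall_le
  obtain ⟨K, hK, hs⟩ := H.abs_sum
  have hα := H.alpha_pos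
  have hM0 : 0 < M := by linarith
  refine ⟨√(K * D) * M ^ (α / 2) + M, by positivity, fun N hN θ => iSup_le fun x => ?_⟩
  have hN0 : 0 < N := by linarith
  have ht0 : 0 < (N ^ 2)⁻¹ := by positivity
  have ht1 : (N ^ 2)⁻¹ ≤ 1 := inv_le_one_of_one_le₀ (one_le_pow₀ hN)
  have hpow : ((N ^ 2)⁻¹) ^ (-α / 2) = N ^ α := by
    rw [← Real.rpow_natCast, ← Real.rpow_neg hN0.le, ← Real.rpow_mul hN0.le]
    congr 1
    push_cast
    ring
  set R : ℝ := M * (1 + |θ|) with hR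
  have hR0 : 0 < R := by positivity
  set B := Metric.closedBall x (R / N) with hB
  have hBm : MeasurableSet B := Metric.isClosed_closedBall.measurableSet
  have hadm : Adm ℓ (oscSym ℓ (N ^ 2)⁻¹ θ) := adm_oscSym ht0 ht1 θ
  have hmeas := measurable_kern_left H hadm x
  rw [← lintegral_add_compl _ hBm]
  -- near the diagonal: the Cauchy-Schwarz inequality and `|exp(iθτ)τ|² ≤ τ`
  have hnear : ∫⁻ y in B, ‖kern φ (oscSym ℓ (N ^ 2)⁻¹ θ) x y‖ₑ ∂μ ≤
      ENNReal.ofReal (√(K * D) * R ^ (α / 2)) := by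
    have h1 := ENNReal.lintegral_mul_le_Lp_mul_Lq (μ.restrict B) (p := 2) (q := 2)
      ⟨by norm_num, by norm_num, by norm_num⟩ hmeas.enorm.aemeasurable
      (aemeasurable_const (b := (1 : ℝ≥0∞)))
    simp only [Pi.mul_apply, mul_one, ENNReal.one_rpow, lintegral_const, one_mul,
      Measure.restrict_apply_univ] at h1
    have h2 : ∫⁻ y in B, ‖kern φ (oscSym ℓ (N ^ 2)⁻¹ θ) x y‖ₑ ^ (2 : ℝ) ∂μ ≤
        ENNReal.ofReal (K * N ^ α) := by
      refine (setLIntegral_le_lintegral _ _).trans ?_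
      simp_rw [ENNReal.rpow_two]
      rw [lintegral_kern_sq H hadm]
      refine ENNReal.ofReal_le_ofReal ?_
      rw [← hpow]
      obtain ⟨h3, h4⟩ := hs _ ht0 ht1 x x
      have h5 : ∀ j, ‖oscSym ℓ (N ^ 2)⁻¹ θ j‖ ^ 2 * (|φ j x| * |φ j x|) ≤
          heatSym ℓ (N ^ 2)⁻¹ j * (|φ j x| * |φ j x|) := fun j => by
        rw [norm_oscSym]
        gcongr
        exact pow_le_of_le_one (heatSym_pos ℓ _ j).le (heatSym_le_one ℓ ht0.le j) two_ne_zero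
      exact ((Summable.of_nonneg_of_le (fun j => by positivity) h5 h3).tsum_le_tsum h5 h3).trans h4
    have h3 : μ B ≤ ENNReal.ofReal (D * (R / N) ^ α) := by
      have := hD' x (R / N) (by positivity)
      rwa [Real.zero_rpow hα.ne', add_zero] at this
    refine h1.trans ?_
    calc _ ≤ ENNReal.ofReal (K * N ^ α) ^ (1 / 2 : ℝ) *
          ENNReal.ofReal (D * (R / N) ^ α) ^ (1 / 2 : ℝ) := by gcongr
      _ = _ := by
        rw [← ENNReal.mul_rpow_of_nonneg _ _ (by norm_num), ← ENNReal.ofReal_mul (by positivity),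
          ENNReal.ofReal_rpow_of_nonneg (by positivity) (by norm_num)]
        congr 1
        rw [Real.div_rpow hR0.le hN0.le]
        have h6 : K * N ^ α * (D * (R ^ α / N ^ α)) = (K * D) * R ^ α := by
          have : N ^ α ≠ 0 := by positivity
          field_simp
        rw [h6, Real.mul_rpow (by positivity) (by positivity), Real.sqrt_eq_rpow,
          ← Real.rpow_mul hR0.le]
        congr 2
        ring
  -- off the diagonal: the weight is at least `exp(M(1+|θ|))`, which cancels `exp(M|θ|)`
  have hfar : ∫⁻ y in Bᶜ, ‖kern φ (oscSym ℓ (N ^ 2)⁻¹ θ) x y‖ₑ ∂μ ≤ ENNReal.ofReal M := by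
    have h1 := lintegral_oscSym_weighted_le H hN hM0.le (hM N hN) θ x
    calc _ ≤ ∫⁻ y in Bᶜ, ENNReal.ofReal (Real.exp (-R)) *
          (‖kern φ (oscSym ℓ (N ^ 2)⁻¹ θ) x y‖ₑ *
            ENNReal.ofReal (Real.exp (N * dist x y))) ∂μ := by
          refine setLIntegral_mono' hBm.compl fun y hy => ?_
          rw [← mul_assoc, mul_comm (ENNReal.ofReal _), mul_assoc,
            ← ENNReal.ofReal_mul (Real.exp_pos _).le, ← Real.exp_add]
          refine le_mul_of_one_le_right zero_le ?_
          rw [ENNReal.one_le_ofReal]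
          refine Real.one_le_exp ?_
          have h2 : R / N < dist x y := by
            rw [dist_comm]
            simpa [hB] using hy
          rw [div_lt_iff₀ hN0] at h2
          linarith
      _ ≤ ∫⁻ y, ENNReal.ofReal (Real.exp (-R)) *
          (‖kern φ (oscSym ℓ (N ^ 2)⁻¹ θ) x y‖ₑ *
            ENNReal.ofReal (Real.exp (N * dist x y))) ∂μ := setLIntegral_le_lintegral _ _
      _ = ENNReal.ofReal (Real.exp (-R)) * ∫⁻ y, (‖kern φ (oscSym ℓ (N ^ 2)⁻¹ θ) x y‖ₑ *
            ENNReal.ofReal (Real.exp (N * dist x y))) ∂μ :=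
          lintegral_const_mul' _ _ ENNReal.ofReal_ne_top
      _ ≤ ENNReal.ofReal (Real.exp (-R)) * ENNReal.ofReal (M * Real.exp (M * |θ|)) := by gcongr
      _ ≤ ENNReal.ofReal M := by
          rw [← ENNReal.ofReal_mul (Real.exp_pos _).le]
          refine ENNReal.ofReal_le_ofReal ?_
          rw [mul_comm, mul_assoc, ← Real.exp_add]
          refine mul_le_of_le_one_right hM0.le ?_
          rw [Real.exp_le_one_iff, hR]
          linarith
  refine (add_le_add hnear hfar).trans ?_
  rw [← ENNReal.ofReal_add (by positivity) hM0.le]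
  refine ENNReal.ofReal_le_ofReal ?_
  rw [hR, Real.mul_rpow hM0.le (by positivity), add_mul, ← mul_assoc]
  gcongr
  exact le_mul_of_one_le_right hM0.le
    (Real.one_le_rpow (by linarith [abs_nonneg θ]) (by positivity))

/-! ### The multiplier theorem -/

/-- The functions `f i` have derivatives up to order `k` at the points of `s`, and these are
bounded on `s` uniformly in `i`. -/
def UnifC {ι : Type*} : ℕ → Set ℝ → (ι → ℝ → ℝ) → Prop
  | 0, s, f => ∃ C, ∀ i, ∀ x ∈ s, |f i x| ≤ C
  | k + 1, s, f => (∃ C, ∀ i, ∀ x ∈ s, |f i x| ≤ C) ∧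
      ∃ f' : ι → ℝ → ℝ, (∀ i, ∀ x ∈ s, HasDerivAt (f i) (f' i x) x) ∧ UnifC k s f'

theorem UnifC.bdd {ι : Type*} {k : ℕ} {s : Set ℝ} {f : ι → ℝ → ℝ} (hf : UnifC k s f) :
    ∃ C, ∀ i, ∀ x ∈ s, |f i x| ≤ C := by
  cases k with
  | zero => exact hf
  | succ k => exact hf.1

theorem hasDerivAt_eq_zero_of_notMem {f : ℝ → ℝ} {f' x a b : ℝ} (hf : HasDerivAt f f' x)
    (h0 : ∀ x, x ∉ Set.Icc a b → f x = 0) (hx : x ∉ Set.Icc a b) : f' = 0 := by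
  have h1 : f =ᶠ[𝓝 x] fun _ => 0 := by
    filter_upwards [isClosed_Icc.isOpen_compl.mem_nhds hx] with y hy using h0 y hy
  exact (hf.congr_of_eventuallyEq h1.symm).unique (hasDerivAt_const x 0)

/-- Uniform weighted `ℓ²` decay of Fourier coefficients: integration by parts and Parseval. -/
theorem exists_fourierCoeffOn_sq_le {ι : Type*} {a b : ℝ} (ha : 0 < a) (hb : b < 4) (k : ℕ)
    (f : ι → ℝ → ℝ) (hf : UnifC k Set.univ f) (hm : ∀ i, Measurable (f i))
    (h0 : ∀ i x, x ∉ Set.Icc a b → f i x = 0) :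
    ∃ C, ∀ i, (Summable fun n : ℤ => (|(n : ℝ)| ^ k *
        ‖fourierCoeffOn (by norm_num : (0 : ℝ) < 4) (fun x => (f i x : ℂ)) n‖) ^ 2) ∧
      ∑' n : ℤ, (|(n : ℝ)| ^ k *
        ‖fourierCoeffOn (by norm_num : (0 : ℝ) < 4) (fun x => (f i x : ℂ)) n‖) ^ 2 ≤ C := by
  induction k generalizing f with
  | zero =>
    obtain ⟨C, hC⟩ := hf
    refine ⟨C ^ 2, fun i => ?_⟩
    have hL2 : MemLp (fun x => (f i x : ℂ)) 2 (volume.restrict (Set.Ioc (0 : ℝ) 4)) :=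
      MemLp.of_bound (Complex.measurable_ofReal.comp (hm i)).aestronglyMeasurable C
        (Eventually.of_forall fun x => by simpa using hC i x trivial)
    have h1 := hasSum_sq_fourierCoeffOn (by norm_num : (0 : ℝ) < 4) hL2
    simp only [pow_zero, one_mul]
    refine ⟨h1.summable, ?_⟩
    rw [h1.tsum_eq]
    have h2 : ∫ x in (0 : ℝ)..4, ‖(f i x : ℂ)‖ ^ 2 ≤ ∫ x in (0 : ℝ)..4, C ^ 2 := by
      refine intervalIntegral.integral_mono_on (by norm_num) ?_ (by simp) fun x _ => ?_
      · rw [intervalIntegrable_iff_integrableOn_Ioc_of_le (by norm_num)]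
        exact hL2.integrable_norm_pow (by norm_num)
      · have := hC i x trivial
        rw [Complex.norm_real, Real.norm_eq_abs]
        gcongr
    rw [intervalIntegral.integral_const] at h2
    simp only [sub_zero, smul_eq_mul] at h2 ⊢
    linarith
  | succ k ih =>
    obtain ⟨-, f', hf', hk⟩ := hf
    have hm' : ∀ i, Measurable (f' i) := fun i => by
      have : f' i = deriv (f i) := funext fun x => (hf' i x trivial).deriv.symm
      rw [this]
      exact measurable_deriv _
    have h0' : ∀ i x, x ∉ Set.Icc a b → f' i x = 0 := fun i x hx =>
      hasDerivAt_eq_zero_of_notMem (hf' i x trivial) (h0 i) hx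
    obtain ⟨C, hC⟩ := ih f' hk hm' h0'
    refine ⟨C, fun i => ?_⟩
    obtain ⟨D, hD⟩ := hk.bdd
    have hle : ∀ n : ℤ, (|(n : ℝ)| ^ (k + 1) *
        ‖fourierCoeffOn (by norm_num : (0 : ℝ) < 4) (fun x => (f i x : ℂ)) n‖) ^ 2 ≤
        (|(n : ℝ)| ^ k *
        ‖fourierCoeffOn (by norm_num : (0 : ℝ) < 4) (fun x => (f' i x : ℂ)) n‖) ^ 2 := by
      intro n
      rcases eq_or_ne n 0 with rfl | hn
      · rw [Int.cast_zero, abs_zero, zero_pow (Nat.succ_ne_zero k), zero_mul, zero_pow two_ne_zero]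
        positivity
      · have hint : IntervalIntegrable (fun x => (f' i x : ℂ)) volume 0 4 := by
          rw [intervalIntegrable_iff_integrableOn_Ioc_of_le (by norm_num)]
          exact Integrable.of_bound (Complex.measurable_ofReal.comp (hm' i)).aestronglyMeasurable D
            (Eventually.of_forall fun x => by simpa using hD i x trivial)
        have h1 := fourierCoeffOn_of_hasDerivAt (by norm_num : (0 : ℝ) < 4) hn
          (f := fun x => (f i x : ℂ)) (f' := fun x => (f' i x : ℂ))
          (fun x _ => (hf' i x trivial).ofReal_comp) hint
        have e0 : f i 0 = 0 := h0 i 0 (fun h => by linarith [h.1])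
        have e4 : f i 4 = 0 := h0 i 4 (fun h => by linarith [h.2])
        rw [e0, e4] at h1
        simp only [sub_self, mul_zero, zero_sub] at h1
        have hn' : 0 < |(n : ℝ)| := abs_pos.2 (Int.cast_ne_zero.2 hn)
        have h2 : ‖fourierCoeffOn (by norm_num : (0 : ℝ) < 4) (fun x => (f i x : ℂ)) n‖ =
            1 / (2 * Real.pi * |(n : ℝ)|) * (4 *
            ‖fourierCoeffOn (by norm_num : (0 : ℝ) < 4) (fun x => (f' i x : ℂ)) n‖) := by
          rw [h1]
          simp only [norm_mul, norm_div, norm_neg, norm_one, Complex.norm_I, mul_one,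
            Complex.norm_intCast, Complex.norm_real, Real.norm_eq_abs, abs_of_pos Real.pi_pos,
            Complex.ofReal_zero, sub_zero]
          norm_num
        rw [h2]
        refine pow_le_pow_left₀ (by positivity) ?_ 2
        rw [pow_succ]
        have hpi : (4 : ℝ) / (2 * Real.pi) ≤ 1 := by
          rw [div_le_one (by positivity)]
          linarith [Real.pi_gt_three]
        have hp0 := Real.pi_pos
        calc _ = |(n : ℝ)| ^ k * ((4 / (2 * Real.pi)) *
              ‖fourierCoeffOn (by norm_num : (0 : ℝ) < 4) (fun x => (f' i x : ℂ)) n‖) := by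
              field_simp
          _ ≤ _ := by
              gcongr
              exact mul_le_of_le_one_left (norm_nonneg _) hpi
    have hs := Summable.of_nonneg_of_le (fun n => sq_nonneg _) hle (hC i).1
    exact ⟨hs, (hs.tsum_le_tsum hle (hC i).1).trans (hC i).2⟩

theorem summable_one_add_abs_int_rpow {s : ℝ} (hs : s < -1) :
    Summable fun n : ℤ => (1 + |(n : ℝ)|) ^ s := by
  have h1 : Summable fun n : ℤ => |(n : ℝ)| ^ s := by
    have := Real.summable_abs_int_rpow (b := -s) (by linarith)
    simpa using this
  refine Summable.of_norm_bounded_eventually h1 ?_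
  have : ({0} : Set ℤ).Finite := Set.finite_singleton 0
  filter_upwards [this.compl_mem_cofinite] with n hn
  have hn' : 0 < |(n : ℝ)| := abs_pos.2 (Int.cast_ne_zero.2 hn)
  rw [Real.norm_of_nonneg (by positivity)]
  exact Real.rpow_le_rpow_of_nonpos hn' (by linarith) (by linarith)

/-- Since `S > α`, and `S ≥ 1`, the series `∑ (1+|n|)^{α-2S}` converges, and the weighted `ℓ²` bounds
of orders `0` and `S` give a weighted `ℓ¹` bound for the Fourier coefficients. The period `4` leaves
room around the range `(0,1]` of the heat symbol. -/
theorem exists_fourierCoeffOn_weighted_le {ι : Type*} {a b : ℝ} (ha : 0 < a) (hb : b < 4) {S : ℕ}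
    {α : ℝ} (hα : 0 < α) (hS : α < S) (f : ι → ℝ → ℝ) (hf : UnifC S Set.univ f)
    (hc : ∀ i, Continuous (f i)) (h0 : ∀ i x, x ∉ Set.Icc a b → f i x = 0) :
    ∃ C, 0 ≤ C ∧ ∀ i, (Summable fun n : ℤ =>
        ‖fourierCoeffOn (by norm_num : (0 : ℝ) < 4) (fun x => (f i x : ℂ)) n‖ *
          (1 + |(n : ℝ)|) ^ (α / 2)) ∧
      ∑' n : ℤ, ‖fourierCoeffOn (by norm_num : (0 : ℝ) < 4) (fun x => (f i x : ℂ)) n‖ *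
          (1 + |(n : ℝ)|) ^ (α / 2) ≤ C := by
  have hS1 : (1 : ℝ) ≤ S := by
    have : 0 < S := by
      rcases Nat.eq_zero_or_pos S with rfl | h
      · simp at hS; linarith
      · exact h
    exact_mod_cast this
  obtain ⟨C0, hC0⟩ := exists_fourierCoeffOn_sq_le ha hb 0 f hf.bdd (fun i => (hc i).measurable) h0
  obtain ⟨C1, hC1⟩ := exists_fourierCoeffOn_sq_le ha hb S f hf (fun i => (hc i).measurable) h0
  have hsum := summable_one_add_abs_int_rpow (s := α - 2 * S) (by linarith)
  refine ⟨|4 ^ S * (C0 + C1) + ∑' n : ℤ, (1 + |(n : ℝ)|) ^ (α - 2 * S)|, abs_nonneg _,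
    fun i => ?_⟩
  set c : ℤ → ℝ := fun n =>
    ‖fourierCoeffOn (by norm_num : (0 : ℝ) < 4) (fun x => (f i x : ℂ)) n‖ with hcdef
  have hs0 : Summable fun n => c n ^ 2 := by simpa [hcdef] using (hC0 i).1
  have hs0' : ∑' n, c n ^ 2 ≤ C0 := by simpa [hcdef] using (hC0 i).2
  have hs1 := (hC1 i).1
  have hs1' := (hC1 i).2
  have hle : ∀ n : ℤ, c n * (1 + |(n : ℝ)|) ^ (α / 2) ≤
      4 ^ S * (c n ^ 2 + (|(n : ℝ)| ^ S * c n) ^ 2) + (1 + |(n : ℝ)|) ^ (α - 2 * S) := by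
    intro n
    have hc0 : 0 ≤ c n := norm_nonneg _
    have hx : 0 < 1 + |(n : ℝ)| := by positivity
    set x := |(n : ℝ)| with hxdef
    have hx0 : 0 ≤ x := abs_nonneg _
    -- the weight is split as `(1+|n|)^S (1+|n|)^{α/2-S}`, followed by `uv ≤ u² + v²`
    have e1 : (1 + x) ^ (α / 2) = (1 + x) ^ S * (1 + x) ^ (α / 2 - S) := by
      rw [← Real.rpow_natCast, ← Real.rpow_add hx]
      congr 1; ring
    have e2 : (1 + x) ^ (α - 2 * S) = ((1 + x) ^ (α / 2 - S)) ^ 2 := by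
      rw [← Real.rpow_natCast, ← Real.rpow_mul hx.le]
      congr 1; push_cast; ring
    have e3 : ((1 + x) ^ S) ^ 2 ≤ 4 ^ S * (1 + (x ^ S) ^ 2) := by
      have h1 : (1 + x) ^ 2 ≤ 4 * max 1 (x ^ 2) := by
        rcases le_total x 1 with h | h
        · have : (1 : ℝ) ≤ max 1 (x ^ 2) := le_max_left _ _
          nlinarith
        · have : x ^ 2 ≤ max 1 (x ^ 2) := le_max_right _ _
          nlinarith
      have h2 : (max 1 (x ^ 2)) ^ S ≤ 1 + (x ^ S) ^ 2 := by
        rcases le_total 1 (x ^ 2) with h | h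
        · rw [max_eq_right h, ← pow_mul, mul_comm 2 S, pow_mul]; linarith
        · rw [max_eq_left h, one_pow]; nlinarith [sq_nonneg (x ^ S)]
      calc ((1 + x) ^ S) ^ 2 = ((1 + x) ^ 2) ^ S := by rw [← pow_mul, ← pow_mul, mul_comm]
        _ ≤ (4 * max 1 (x ^ 2)) ^ S := by gcongr
        _ = 4 ^ S * (max 1 (x ^ 2)) ^ S := mul_pow _ _ _
        _ ≤ _ := by gcongr
    rw [e1, e2]
    have e4 : c n ^ 2 * ((1 + x) ^ S) ^ 2 ≤ c n ^ 2 * (4 ^ S * (1 + (x ^ S) ^ 2)) := by gcongr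
    nlinarith [sq_nonneg (c n * (1 + x) ^ S - (1 + x) ^ (α / 2 - S)),
      sq_nonneg (c n * (1 + x) ^ S), sq_nonneg ((1 + x) ^ (α / 2 - S))]
  have hsR := ((hs0.add hs1).mul_left (4 ^ S)).add hsum
  have hs := Summable.of_nonneg_of_le (fun n => by positivity) hle hsR
  refine ⟨hs, (hs.tsum_le_tsum hle hsR).trans (le_trans ?_ (le_abs_self _))⟩
  rw [((hs0.add hs1).mul_left (4 ^ S)).tsum_add hsum, tsum_mul_left, hs0.tsum_add hs1]
  gcongr

/-- Fourier inversion on `[0,4]` for functions supported inside. -/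
theorem hasSum_fourierCoeffOn {a b : ℝ} (ha : 0 < a) (hb : b < 4) {f : ℝ → ℝ} (hc : Continuous f)
    (h0 : ∀ x, x ∉ Set.Icc a b → f x = 0)
    (hs : Summable fun n : ℤ =>
      ‖fourierCoeffOn (by norm_num : (0 : ℝ) < 4) (fun x => (f x : ℂ)) n‖)
    {x : ℝ} (hx0 : 0 ≤ x) (hx4 : x < 4) :
    HasSum (fun n : ℤ => fourierCoeffOn (by norm_num : (0 : ℝ) < 4) (fun x => (f x : ℂ)) n *
      Complex.exp ((Real.pi / 2 * n : ℝ) * Complex.I * x)) (f x) := by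
  have : Fact ((0 : ℝ) < 4) := ⟨by norm_num⟩
  set g : ℝ → ℂ := fun x => (f x : ℂ) with hg
  have e0 : f 0 = 0 := h0 0 (fun h => by linarith [h.1])
  have e4 : f 4 = 0 := h0 4 (fun h => by linarith [h.2])
  have hcont : Continuous (AddCircle.liftIco 4 0 g) :=
    AddCircle.liftIco_continuous (by simp [hg, e0, e4])
      (Complex.continuous_ofReal.comp hc).continuousOn
  have hcoef : ∀ n, fourierCoeff (AddCircle.liftIco 4 0 g) n =
      fourierCoeffOn (by norm_num : (0 : ℝ) < 4) g n := by
    intro n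
    rw [fourierCoeff_liftIco_eq]
    congr 1
    norm_num
  have h1 := has_pointwise_sum_fourier_series_of_summable
    (f := (⟨AddCircle.liftIco 4 0 g, hcont⟩ : C(AddCircle (4 : ℝ), ℂ)))
    (by
      refine Summable.of_norm ?_
      simp only [ContinuousMap.coe_mk, hcoef]
      exact hs) (x : AddCircle (4 : ℝ))
  simp only [ContinuousMap.coe_mk, hcoef, smul_eq_mul] at h1
  rw [AddCircle.liftIco_coe_apply (by constructor <;> linarith)] at h1
  convert h1 using 3 with n
  rw [fourier_coe_apply]
  congr 1
  push_cast
  ring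

/-- **Multiplier theorem.** Functions `G(τ)τ` of the heat operator `τ = exp(-ℓ²/N²)`, with `G`
running through a family with uniformly bounded derivatives up to order `S > α`, have kernels that
are uniformly bounded in the `L¹` sense. -/
theorem IsHeatSystem.exists_knorm_le_of_unifC (H : IsHeatSystem μ α φ ℓ) {ι : Type*} {a b : ℝ}
    (ha : 0 < a) (hb : b < 4) {S : ℕ} (hS : α < S) (G : ι → ℝ → ℝ) (hG : UnifC S Set.univ G)
    (hc : ∀ i, Continuous (G i)) (h0 : ∀ i x, x ∉ Set.Icc a b → G i x = 0) :
    ∃ C : ℝ, ∀ i, ∀ N : ℝ, 1 ≤ N →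
      knorm μ φ (fun j => (G i (heatSym ℓ (N ^ 2)⁻¹ j) : ℂ) * (heatSym ℓ (N ^ 2)⁻¹ j : ℂ)) ≤
        ENNReal.ofReal C := by
  have hα := H.alpha_pos
  obtain ⟨C, hC0, hC⟩ := exists_fourierCoeffOn_weighted_le ha hb hα hS G hG hc h0
  obtain ⟨K, hK, hosc⟩ := H.knorm_oscSym_le
  obtain ⟨A, hA, habs⟩ := H.abs_sum
  refine ⟨K * 2 ^ (α / 2) * C, fun i N hN => iSup_le fun x => ?_⟩
  have hN0 : 0 < N := by linarith
  have ht0 : 0 < (N ^ 2)⁻¹ := by positivity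
  have ht1 : (N ^ 2)⁻¹ ≤ 1 := inv_le_one_of_one_le₀ (one_le_pow₀ hN)
  set t := (N ^ 2)⁻¹ with ht
  set c : ℤ → ℂ := fourierCoeffOn (by norm_num : (0 : ℝ) < 4) (fun x => (G i x : ℂ)) with hcdef
  obtain ⟨hs, hs'⟩ := hC i
  have hsc : Summable fun n => ‖c n‖ := by
    refine Summable.of_nonneg_of_le (fun n => norm_nonneg _) (fun n => ?_) hs
    exact le_mul_of_one_le_right (norm_nonneg _)
      (Real.one_le_rpow (by linarith [abs_nonneg (n : ℝ)]) (by positivity))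
  have hrep : ∀ y, kern φ (fun j => (G i (heatSym ℓ t j) : ℂ) * (heatSym ℓ t j : ℂ)) x y =
      ∑' n : ℤ, c n * kern φ (oscSym ℓ t (Real.pi / 2 * n)) x y := by
    intro y
    have hF : Summable (Function.uncurry fun (j : ℕ) (n : ℤ) => c n *
        (oscSym ℓ t (Real.pi / 2 * n) j * (φ j x : ℂ) * (φ j y : ℂ))) := by
      refine Summable.of_norm_bounded ((habs t ht0 ht1 x y).1.mul_of_nonneg hsc
        (fun j => by have := heatSym_pos ℓ t j; positivity) (fun n => norm_nonneg _)) ?_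
      rintro ⟨j, n⟩
      simp only [Function.uncurry_apply_pair, norm_mul, norm_oscSym, Complex.norm_real,
        Real.norm_eq_abs]
      exact le_of_eq (by ring)
    have hswap := hF.tsum_comm
    unfold kern
    simp_rw [← tsum_mul_left]
    rw [hswap]
    refine tsum_congr fun j => ?_
    have h1 := hasSum_fourierCoeffOn ha hb (hc i) (h0 i) hsc (heatSym_pos ℓ t j).le
      (lt_of_le_of_lt (heatSym_le_one ℓ ht0.le j) (by norm_num))
    rw [← h1.tsum_eq, ← tsum_mul_right, ← tsum_mul_right, ← tsum_mul_right]
    refine tsum_congr fun n => ?_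
    rw [oscSym]
    ring
  simp_rw [hrep]
  calc _ ≤ ∫⁻ y, ∑' n : ℤ, ‖c n‖ₑ * ‖kern φ (oscSym ℓ t (Real.pi / 2 * n)) x y‖ₑ ∂μ := by
        refine lintegral_mono fun y => ?_
        refine enorm_tsum_le_tsum_enorm.trans (le_of_eq ?_)
        exact tsum_congr fun n => enorm_mul _ _
    _ = ∑' n : ℤ, ‖c n‖ₑ * ∫⁻ y, ‖kern φ (oscSym ℓ t (Real.pi / 2 * n)) x y‖ₑ ∂μ := by
        have hmeas : ∀ n : ℤ, Measurable fun y =>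
            ‖kern φ (oscSym ℓ t (Real.pi / 2 * n)) x y‖ₑ := fun n =>
          (measurable_kern_left H (adm_oscSym ht0 ht1 _) x).enorm
        rw [lintegral_tsum fun n => ((hmeas n).const_mul _).aemeasurable]
        exact tsum_congr fun n => lintegral_const_mul _ (hmeas n)
    _ ≤ ∑' n : ℤ, ENNReal.ofReal (K * 2 ^ (α / 2) * (‖c n‖ * (1 + |(n : ℝ)|) ^ (α / 2))) := by
        refine ENNReal.tsum_le_tsum fun n => ?_
        refine (mul_le_mul_right ((lintegral_kern_le_knorm _ x).trans (hosc N hN _)) _).trans ?_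
        rw [← ofReal_norm, ← ENNReal.ofReal_mul (norm_nonneg _)]
        refine ENNReal.ofReal_le_ofReal ?_
        have h2 : 1 + |Real.pi / 2 * n| ≤ 2 * (1 + |(n : ℝ)|) := by
          rw [abs_mul, abs_of_pos (by positivity : 0 < Real.pi / 2)]
          nlinarith [Real.pi_lt_four, abs_nonneg (n : ℝ)]
        calc ‖c n‖ * (K * (1 + |Real.pi / 2 * n|) ^ (α / 2))
            ≤ ‖c n‖ * (K * (2 * (1 + |(n : ℝ)|)) ^ (α / 2)) := by gcongr
          _ = _ := by
            rw [Real.mul_rpow (by norm_num) (by positivity)]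
            ring
    _ = ENNReal.ofReal (∑' n : ℤ, K * 2 ^ (α / 2) * (‖c n‖ * (1 + |(n : ℝ)|) ^ (α / 2))) := by
        rw [ENNReal.ofReal_tsum_of_nonneg (fun n => by positivity) (hs.mul_left _)]
    _ ≤ _ := by
        refine ENNReal.ofReal_le_ofReal ?_
        rw [tsum_mul_left]
        gcongr

/-! ### Families of functions with uniformly bounded derivatives -/

section UnifC

variable {ι : Type*} {k : ℕ} {s : Set ℝ} {f g : ι → ℝ → ℝ}

theorem UnifC.of_succ (hf : UnifC (k + 1) s f) : UnifC k s f := by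
  induction k generalizing f with
  | zero => exact hf.1
  | succ k ih => exact ⟨hf.1, hf.2.choose, hf.2.choose_spec.1, ih hf.2.choose_spec.2⟩

theorem UnifC.add (hf : UnifC k s f) (hg : UnifC k s g) :
    UnifC k s (fun i x => f i x + g i x) := by
  have hb : ∀ {f g : ι → ℝ → ℝ}, (∃ C, ∀ i, ∀ x ∈ s, |f i x| ≤ C) →
      (∃ C, ∀ i, ∀ x ∈ s, |g i x| ≤ C) → ∃ C, ∀ i, ∀ x ∈ s, |f i x + g i x| ≤ C := by
    rintro f g ⟨C, hC⟩ ⟨D, hD⟩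
    exact ⟨C + D, fun i x hx => (abs_add_le _ _).trans (add_le_add (hC i x hx) (hD i x hx))⟩
  induction k generalizing f g with
  | zero => exact hb hf hg
  | succ k ih =>
    obtain ⟨hf0, f', hf', hfk⟩ := hf
    obtain ⟨hg0, g', hg', hgk⟩ := hg
    exact ⟨hb hf0 hg0, fun i x => f' i x + g' i x,
      fun i x hx => (hf' i x hx).add (hg' i x hx), ih hfk hgk⟩

theorem UnifC.mul (hf : UnifC k s f) (hg : UnifC k s g) :
    UnifC k s (fun i x => f i x * g i x) := by
  have hb : ∀ {f g : ι → ℝ → ℝ}, (∃ C, ∀ i, ∀ x ∈ s, |f i x| ≤ C) →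
      (∃ C, ∀ i, ∀ x ∈ s, |g i x| ≤ C) → ∃ C, ∀ i, ∀ x ∈ s, |f i x * g i x| ≤ C := by
    rintro f g ⟨C, hC⟩ ⟨D, hD⟩
    refine ⟨C * D, fun i x hx => ?_⟩
    rw [abs_mul]
    exact mul_le_mul (hC i x hx) (hD i x hx) (abs_nonneg _) ((abs_nonneg _).trans (hC i x hx))
  induction k generalizing f g with
  | zero => exact hb hf hg
  | succ k ih =>
    have hf1 := hf.of_succ
    have hg1 := hg.of_succ
    obtain ⟨hf0, f', hf', hfk⟩ := hf
    obtain ⟨hg0, g', hg', hgk⟩ := hg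
    exact ⟨hb hf0 hg0, fun i x => f' i x * g i x + f i x * g' i x,
      fun i x hx => (hf' i x hx).mul (hg' i x hx), (ih hfk hg1).add (ih hf1 hgk)⟩

theorem UnifC.comp {t : Set ℝ} (hf : UnifC k t f) (hg : UnifC k s g)
    (hst : ∀ i, ∀ x ∈ s, g i x ∈ t) : UnifC k s (fun i x => f i (g i x)) := by
  induction k generalizing f with
  | zero =>
    obtain ⟨C, hC⟩ := hf
    exact ⟨C, fun i x hx => hC i _ (hst i x hx)⟩
  | succ k ih =>
    have hg1 := hg.of_succ
    obtain ⟨⟨C, hC⟩, f', hf', hfk⟩ := hf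
    obtain ⟨hg0, g', hg', hgk⟩ := hg
    exact ⟨⟨C, fun i x hx => hC i _ (hst i x hx)⟩, fun i x => f' i (g i x) * g' i x,
      fun i x hx => (hf' i _ (hst i x hx)).comp x (hg' i x hx), (ih hfk hg1).mul hgk⟩

/-- Translations by arbitrary amounts, unbounded in the index, keep derivative bounds on the
line. -/
theorem UnifC.translate (hf : UnifC k Set.univ f) (c : ι → ℝ) :
    UnifC k Set.univ (fun i x => f i (c i + x)) := by
  induction k generalizing f with
  | zero => exact ⟨hf.choose, fun i x _ => hf.choose_spec i _ trivial⟩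
  | succ k ih =>
    obtain ⟨⟨C, hC⟩, f', hf', hfk⟩ := hf
    refine ⟨⟨C, fun i x _ => hC i _ trivial⟩, fun i x => f' i (c i + x), fun i x _ => ?_, ih hfk⟩
    have h1 := (hf' i (c i + x) trivial).comp x ((hasDerivAt_id x).const_add (c i))
    simpa [Function.comp_def] using h1

theorem unifC_const (c : ι → ℝ) {C : ℝ} (hc : ∀ i, |c i| ≤ C) : UnifC k s (fun i _ => c i) := by
  induction k generalizing c C with
  | zero => exact ⟨C, fun i _ _ => hc i⟩
  | succ k ih =>
    exact ⟨⟨C, fun i _ _ => hc i⟩, fun _ _ => 0, fun i x _ => hasDerivAt_const x (c i),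
      ih (fun _ => 0) (C := 0) (by simp)⟩

/-- A single function, smooth near a compact set, has bounded derivatives there. -/
theorem unifC_of_contDiffOn {u : ℝ → ℝ} {U K : Set ℝ} (hU : IsOpen U) (hK : IsCompact K)
    (hKU : K ⊆ U) (hsK : s ⊆ K) (hu : ContDiffOn ℝ ((⊤ : ℕ∞) : WithTop ℕ∞) u U) :
    UnifC k s (fun _ : ι => u) := by
  have hb : ∀ {u : ℝ → ℝ}, ContDiffOn ℝ ((⊤ : ℕ∞) : WithTop ℕ∞) u U →
      ∃ C, ∀ _ : ι, ∀ x ∈ s, |u x| ≤ C := by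
    intro u hu
    obtain ⟨C, hC⟩ := hK.exists_bound_of_continuousOn (hu.continuousOn.mono hKU)
    exact ⟨C, fun _ x hx => hC x (hsK hx)⟩
  induction k generalizing u with
  | zero => exact hb hu
  | succ k ih =>
    refine ⟨hb hu, fun _ => deriv u, fun _ x hx => ?_, ih ?_⟩
    · exact ((hu.contDiffAt (hU.mem_nhds (hKU (hsK hx)))).differentiableAt (by simp)).hasDerivAt
    · exact hu.deriv_of_isOpen hU (by simp)

theorem unifC_of_iteratedDeriv {F : ℝ → ℝ} (hF : ContDiff ℝ k F)
    (hb : ∃ c, ∀ j ≤ k, ∀ t, |iteratedDeriv j F t| ≤ c) :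
    UnifC k Set.univ (fun _ : ι => F) := by
  obtain ⟨c, hc⟩ := hb
  induction k generalizing F with
  | zero => exact ⟨c, fun _ x _ => by simpa using hc 0 le_rfl x⟩
  | succ k ih =>
    have h1 : ContDiff ℝ k (deriv F) := by
      have : ContDiff ℝ ((k : WithTop ℕ∞) + 1) F := by exact_mod_cast hF
      exact (contDiff_succ_iff_deriv.1 this).2.2
    refine ⟨⟨c, fun _ x _ => by simpa using hc 0 (Nat.zero_le _) x⟩, fun _ => deriv F,
      fun _ x _ => ?_, ih h1 fun j hj t => ?_⟩
    · exact ((hF.differentiable (by simp)) x).hasDerivAt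
    · have := hc (j + 1) (by omega) t
      rwa [iteratedDeriv_succ'] at this

/-- Multiplication by a smooth cutoff extends a family with bounded derivatives from an open set to
the line. -/
theorem UnifC.cutoff {A : ℝ → ℝ} {a b : ℝ} (hA : ContDiff ℝ ((⊤ : ℕ∞) : WithTop ℕ∞) A)
    (h0 : ∀ x, x ∉ Set.Icc a b → A x = 0) (hs : Set.Icc a b ⊆ s) (hf : UnifC k s f) :
    UnifC k Set.univ (fun i x => A x * f i x) := by
  have hb : ∀ {f : ι → ℝ → ℝ} {A : ℝ → ℝ}, ContDiff ℝ ((⊤ : ℕ∞) : WithTop ℕ∞) A →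
      (∀ x, x ∉ Set.Icc a b → A x = 0) → (∃ C, ∀ i, ∀ x ∈ s, |f i x| ≤ C) →
      ∃ C, ∀ i, ∀ x ∈ Set.univ, |A x * f i x| ≤ C := by
    rintro f A hA h0 ⟨C, hC⟩
    obtain ⟨D, hD⟩ := (isCompact_Icc (a := a) (b := b)).exists_bound_of_continuousOn
      hA.continuous.continuousOn
    refine ⟨|D * C|, fun i x _ => ?_⟩
    by_cases hx : x ∈ Set.Icc a b
    · rw [abs_mul]
      refine (mul_le_mul (hD x hx) (hC i x (hs hx)) (abs_nonneg _) ?_).trans (le_abs_self _)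
      exact (norm_nonneg _).trans (hD x hx)
    · rw [h0 x hx, zero_mul, abs_zero]
      positivity
  induction k generalizing f A with
  | zero => exact hb hA h0 hf
  | succ k ih =>
    have hf1 := hf.of_succ
    obtain ⟨hf0, f', hf', hfk⟩ := hf
    have hdA : ∀ x, HasDerivAt A (deriv A x) x := fun x =>
      (hA.differentiable (by simp) x).hasDerivAt
    have hA' : ContDiff ℝ ((⊤ : ℕ∞) : WithTop ℕ∞) (deriv A) := by
      have : ContDiff ℝ (((⊤ : ℕ∞) : WithTop ℕ∞) + 1) A := by simpa using hA
      exact (contDiff_succ_iff_deriv.1 this).2.2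
    have h0' : ∀ x, x ∉ Set.Icc a b → deriv A x = 0 := fun x hx =>
      hasDerivAt_eq_zero_of_notMem (hdA x) h0 hx
    refine ⟨hb hA h0 hf0, fun i x => deriv A x * f i x + A x * f' i x, fun i x _ => ?_,
      (ih hA' h0' hf1).add (ih hA h0 hfk)⟩
    by_cases hx : x ∈ Set.Icc a b
    · exact (hdA x).mul (hf' i x (hs hx))
    · change HasDerivAt (fun x => A x * f i x) (deriv A x * f i x + A x * f' i x) x
      rw [h0' x hx, h0 x hx, zero_mul, zero_mul, add_zero]
      refine (hasDerivAt_const x (0 : ℝ)).congr_of_eventuallyEq ?_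
      filter_upwards [isClosed_Icc.isOpen_compl.mem_nhds hx] with y hy
      rw [h0 y hy, zero_mul]

end UnifC

/-! ### Algebra of kernel norms -/

theorem support_mul_finite {m m' : ℕ → ℂ} (hm : m.support.Finite) :
    (fun j => m j * m' j).support.Finite :=
  hm.subset fun j hj => by
    simp only [Function.mem_support, ne_eq, mul_eq_zero, not_or] at hj
    exact hj.1

theorem kern_add (H : IsHeatSystem μ α φ ℓ) {m m' : ℕ → ℂ} (hm : Adm ℓ m) (hm' : Adm ℓ m')
    (x y : X) : kern φ (fun j => m j + m' j) x y = kern φ m x y + kern φ m' x y := by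
  unfold kern
  rw [← (hm.summable H x y).tsum_add (hm'.summable H x y)]
  exact tsum_congr fun j => by ring

theorem knorm_add_le (H : IsHeatSystem μ α φ ℓ) {m m' : ℕ → ℂ} (hm : Adm ℓ m) (hm' : Adm ℓ m') :
    knorm μ φ (fun j => m j + m' j) ≤ knorm μ φ m + knorm μ φ m' := by
  refine iSup_le fun x => ?_
  simp_rw [kern_add H hm hm']
  calc _ ≤ ∫⁻ y, (‖kern φ m x y‖ₑ + ‖kern φ m' x y‖ₑ) ∂μ :=
        lintegral_mono fun y => enorm_add_le _ _
    _ = _ := lintegral_add_left (measurable_kern_left H hm x).enorm _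
    _ ≤ _ := add_le_add (lintegral_kern_le_knorm _ x) (lintegral_kern_le_knorm _ x)

theorem knorm_const_mul (c : ℂ) (m : ℕ → ℂ) :
    knorm μ φ (fun j => c * m j) = ‖c‖ₑ * knorm μ φ m := by
  have h1 : ∀ x y, kern φ (fun j => c * m j) x y = c * kern φ m x y := fun x y => by
    unfold kern
    rw [← tsum_mul_left]
    exact tsum_congr fun j => by ring
  unfold knorm
  rw [ENNReal.mul_iSup]
  refine iSup_congr fun x => ?_
  simp_rw [h1, enorm_mul]
  rw [lintegral_const_mul' _ _ enorm_ne_top]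

theorem knorm_zero : knorm μ φ (fun _ => 0) = 0 := by
  simp [knorm, kern]

theorem knorm_sum_le (H : IsHeatSystem μ α φ ℓ) {ι : Type*} (s : Finset ι) {m : ι → ℕ → ℂ}
    (hm : ∀ i ∈ s, (m i).support.Finite) :
    knorm μ φ (fun j => ∑ i ∈ s, m i j) ≤ ∑ i ∈ s, knorm μ φ (m i) := by
  classical
  induction s using Finset.induction_on with
  | empty => simp [knorm_zero]
  | insert i s hi ih =>
    have h1 : (fun j => ∑ i ∈ s, m i j).support.Finite := by
      refine (s.finite_toSet.biUnion fun i hi' =>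
        hm i (Finset.mem_insert_of_mem hi')).subset fun j hj => ?_
      obtain ⟨i, hi, h⟩ := Finset.exists_ne_zero_of_sum_ne_zero hj
      exact Set.mem_biUnion hi h
    simp_rw [Finset.sum_insert hi]
    exact (knorm_add_le H (adm_of_finite (hm i (Finset.mem_insert_self _ _)))
      (adm_of_finite h1)).trans (add_le_add le_rfl (ih fun i hi' =>
        hm i (Finset.mem_insert_of_mem hi')))

/-- A composite kernel integrated against an arbitrary measure in the second variable. -/
theorem lintegral_kern_mul_le (H : IsHeatSystem μ α φ ℓ) {m m' : ℕ → ℂ} (hm : Adm ℓ m)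
    (hm' : Adm ℓ m') (ν : Measure X) [SFinite ν] {B : ℝ≥0∞}
    (hB : ∀ z, ∫⁻ y, ‖kern φ m' z y‖ₑ ∂ν ≤ B) (x : X) :
    ∫⁻ y, ‖kern φ (fun j => m j * m' j) x y‖ₑ ∂ν ≤ knorm μ φ m * B := by
  have hk1 := (measurable_kern H hm).enorm
  have hk2 := (measurable_kern H hm').enorm
  calc _ ≤ ∫⁻ y, ∫⁻ z, ‖kern φ m x z‖ₑ * ‖kern φ m' z y‖ₑ ∂μ ∂ν := by
        refine lintegral_mono fun y => ?_
        rw [← integral_kern_mul_kern H hm hm']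
        refine (enorm_integral_le_lintegral_enorm _).trans (le_of_eq ?_)
        exact lintegral_congr fun z => enorm_mul _ _
    _ = ∫⁻ z, ∫⁻ y, ‖kern φ m x z‖ₑ * ‖kern φ m' z y‖ₑ ∂ν ∂μ := by
        refine lintegral_lintegral_swap ?_
        have e1 : Measurable fun p : X × X => (x, p.2) := by fun_prop
        have e2 : Measurable fun p : X × X => (p.2, p.1) := by fun_prop
        exact ((hk1.comp e1).mul (hk2.comp e2)).aemeasurable
    _ ≤ ∫⁻ z, ‖kern φ m x z‖ₑ * B ∂μ := by
        refine lintegral_mono fun z => ?_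
        rw [lintegral_const_mul _ (measurable_kern_left H hm' z).enorm]
        gcongr
        exact hB z
    _ = (∫⁻ z, ‖kern φ m x z‖ₑ ∂μ) * B :=
        lintegral_mul_const _ (measurable_kern_left H hm x).enorm
    _ ≤ _ := by
        gcongr
        exact lintegral_kern_le_knorm _ x

theorem knorm_mul_le (H : IsHeatSystem μ α φ ℓ) {m m' : ℕ → ℂ} (hm : Adm ℓ m) (hm' : Adm ℓ m') :
    knorm μ φ (fun j => m j * m' j) ≤ knorm μ φ m * knorm μ φ m' :=
  iSup_le fun x => lintegral_kern_mul_le H hm hm' μ (fun z => lintegral_kern_le_knorm _ z) x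

theorem kern_eq_sum {m : ℕ → ℂ} {s : Finset ℕ} (hs : ∀ j ∉ s, m j = 0) (x y : X) :
    kern φ m x y = ∑ j ∈ s, m j * (φ j x : ℂ) * (φ j y : ℂ) :=
  tsum_eq_sum fun j hj => by rw [hs j hj, zero_mul, zero_mul]

/-- Multipliers living on a fixed bounded range of frequencies. -/
theorem IsHeatSystem.exists_knorm_le_of_bdd (H : IsHeatSystem μ α φ ℓ) (R : ℝ) :
    ∃ C : ℝ, 0 ≤ C ∧ ∀ (m : ℕ → ℂ) (B : ℝ), 0 ≤ B → (∀ j, R < ℓ j → m j = 0) →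
      (∀ j, ‖m j‖ ≤ B) → knorm μ φ m ≤ ENNReal.ofReal (C * B) := by
  choose D hD0 hD using exists_phi_bound H
  set s := (H.finite_freq R).toFinset with hs
  refine ⟨∑ j ∈ s, D j * D j, Finset.sum_nonneg fun j _ => mul_nonneg (hD0 j) (hD0 j),
    fun m B hB hm0 hmB => iSup_le fun x => ?_⟩
  have hms : ∀ j ∉ s, m j = 0 := fun j hj => hm0 j (by simpa [hs] using hj)
  have hpt : ∀ y, ‖kern φ m x y‖ₑ ≤ ENNReal.ofReal ((∑ j ∈ s, D j * D j) * B) := by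
    intro y
    rw [← ofReal_norm, kern_eq_sum hms]
    refine ENNReal.ofReal_le_ofReal ((norm_sum_le _ _).trans ?_)
    rw [Finset.sum_mul]
    refine Finset.sum_le_sum fun j _ => ?_
    rw [norm_term, mul_comm (D j * D j)]
    exact mul_le_mul (hmB j) (mul_le_mul (hD j x) (hD j y) (abs_nonneg _) (hD0 j))
      (by positivity) hB
  calc _ ≤ ∫⁻ _, ENNReal.ofReal ((∑ j ∈ s, D j * D j) * B) ∂μ := lintegral_mono hpt
    _ = _ := by simp

variable {h : ℝ → ℝ}

/-! ### Filters and dyadic pieces -/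

theorem IsFilter.nonneg_le_one (hh : IsFilter h) (t : ℝ) : 0 ≤ h t ∧ h t ≤ 1 := by
  have key : ∀ t, 0 ≤ t → 0 ≤ h t ∧ h t ≤ 1 := by
    intro t ht
    have h0 : h 0 = 1 := hh.eq_one 0 (by norm_num)
    refine ⟨?_, h0 ▸ hh.antitone (Set.mem_Ici.2 le_rfl) ht ht⟩
    rcases le_or_gt 1 t with h1 | h1
    · rw [hh.eq_zero t (by rwa [abs_of_nonneg ht])]
    · have := hh.antitone ht (Set.mem_Ici.2 zero_le_one) h1.le
      rwa [hh.eq_zero 1 (by simp)] at this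
  rcases le_total 0 t with ht | ht
  · exact key t ht
  · rw [← hh.even t]
    exact key (-t) (by linarith)

theorem IsFilter.abs_le_one (hh : IsFilter h) (t : ℝ) : |h t| ≤ 1 := by
  rw [abs_of_nonneg (hh.nonneg_le_one t).1]
  exact (hh.nonneg_le_one t).2

theorem IsFilter.eq_one_of_le (hh : IsFilter h) {t : ℝ} (h0 : 0 ≤ t) (ht : t ≤ 1 / 2) : h t = 1 :=
  hh.eq_one t (by rwa [abs_of_nonneg h0])

theorem IsFilter.eq_zero_of_le (hh : IsFilter h) {t : ℝ} (ht : 1 ≤ t) : h t = 0 :=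
  hh.eq_zero t (by rwa [abs_of_nonneg (by linarith)])

/-- The function `η(u/N) exp(q u²/N²)` of the frequency, written as a function of the heat symbol
`τ = exp(-u²/N²)`. The factor `h(τ/2)`, equal to one on the range `(0,1]` of `τ`, makes the support
compact. -/
noncomputable def heatCut (η h : ℝ → ℝ) (q : ℕ) (τ : ℝ) : ℝ :=
  if 0 < τ then η (√(-Real.log τ)) * τ⁻¹ ^ q * h (τ / 2) else 0

theorem heatCut_eq_zero {η : ℝ → ℝ} (hh : IsFilter h) (hη : ∀ x, 1 ≤ |x| → η x = 0) (q : ℕ) (τ : ℝ)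
    (hτ : τ ∉ Set.Icc (Real.exp (-1)) 2) : heatCut η h q τ = 0 := by
  unfold heatCut
  split_ifs with h0
  · by_cases h1 : τ < Real.exp (-1)
    · have h2 : Real.log τ ≤ -1 := by
        rw [Real.log_le_iff_le_exp h0]
        exact h1.le
      have h3 : 1 ≤ √(-Real.log τ) := by
        rw [Real.one_le_sqrt]
        linarith
      rw [hη _ (h3.trans (le_abs_self _)), zero_mul, zero_mul]
    · have h4 : 2 < τ := by
        by_contra h5
        exact hτ ⟨not_lt.1 h1, not_lt.1 h5⟩
      rw [hh.eq_zero_of_le (by linarith : 1 ≤ τ / 2), mul_zero]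
  · rfl

theorem contDiff_heatCut {η : ℝ → ℝ} {c : ℝ} (hh : IsFilter h)
    (hηs : ContDiff ℝ ((⊤ : ℕ∞) : WithTop ℕ∞) η) (hη : ∀ x, 1 ≤ |x| → η x = 0)
    (hηc : ∀ x, |x| ≤ 1 / 4 → η x = c) (q : ℕ) :
    ContDiff ℝ ((⊤ : ℕ∞) : WithTop ℕ∞) (heatCut η h q) := by
  rw [contDiff_iff_contDiffAt]
  intro τ
  have hhs : ContDiffAt ℝ ((⊤ : ℕ∞) : WithTop ℕ∞) (fun τ => h (τ / 2)) τ :=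
    (hh.contDiff.comp (contDiff_id.div_const 2)).contDiffAt
  have hinv : 0 < τ → ContDiffAt ℝ ((⊤ : ℕ∞) : WithTop ℕ∞) (fun τ : ℝ => τ⁻¹ ^ q) τ := fun h0 =>
    (contDiffAt_inv ℝ h0.ne').pow q
  rcases lt_or_ge τ (Real.exp (-1)) with h1 | h1
  · refine (contDiffAt_const (c := (0 : ℝ))).congr_of_eventuallyEq ?_
    filter_upwards [isOpen_Iio.mem_nhds h1] with x hx
    exact heatCut_eq_zero hh hη q x fun hx' => absurd hx'.1 (not_le.2 hx)
  · have h0 : 0 < τ := (Real.exp_pos _).trans_le h1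
    rcases lt_or_ge τ 1 with h2 | h2
    · have h3 : 0 < -Real.log τ := by linarith [Real.log_neg h0 h2]
      have h4 : ContDiffAt ℝ ((⊤ : ℕ∞) : WithTop ℕ∞) (fun τ => η (√(-Real.log τ))) τ :=
        hηs.contDiffAt.comp τ ((Real.contDiffAt_log.2 h0.ne').neg.sqrt h3.ne')
      refine ((h4.mul (hinv h0)).mul hhs).congr_of_eventuallyEq ?_
      filter_upwards [isOpen_Ioi.mem_nhds h0] with x hx
      rw [heatCut, if_pos (show 0 < x from hx)]
    · refine (((contDiffAt_const (c := c)).mul (hinv h0)).mul hhs).congr_of_eventuallyEq ?_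
      have h5 : Real.exp (-(1 / 16)) < τ := by
        refine lt_of_lt_of_le ?_ h2
        rw [Real.exp_lt_one_iff]
        norm_num
      filter_upwards [isOpen_Ioi.mem_nhds h0, isOpen_Ioi.mem_nhds h5] with x hx hx5
      rw [heatCut, if_pos (show 0 < x from hx), hηc]
      rw [abs_of_nonneg (Real.sqrt_nonneg _), Real.sqrt_le_left (by norm_num)]
      have := (Real.lt_log_iff_exp_lt hx).2 hx5
      linarith

theorem sqrt_neg_log_heatSym {N : ℝ} (hN : 0 < N) {j : ℕ} (hj : 0 ≤ ℓ j) :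
    √(-Real.log (heatSym ℓ (N ^ 2)⁻¹ j)) = ℓ j / N := by
  rw [heatSym, Real.log_exp, neg_mul, neg_neg, ← div_eq_mul_inv, ← div_pow,
    Real.sqrt_sq (by positivity)]

theorem heatCut_heatSym (hh : IsFilter h) (η : ℝ → ℝ) (q : ℕ) {N : ℝ} (hN : 0 < N) {j : ℕ}
    (hj : 0 ≤ ℓ j) : heatCut η h q (heatSym ℓ (N ^ 2)⁻¹ j) =
      η (ℓ j / N) * (heatSym ℓ (N ^ 2)⁻¹ j)⁻¹ ^ q := by
  have h0 := heatSym_pos ℓ (N ^ 2)⁻¹ j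
  have h1 := heatSym_le_one ℓ (t := (N ^ 2)⁻¹) (by positivity) j
  rw [heatCut, if_pos h0, sqrt_neg_log_heatSym hN hj,
    hh.eq_one_of_le (t := heatSym ℓ (N ^ 2)⁻¹ j / 2) (by positivity) (by linarith), mul_one]

theorem support_filter_finite (H : IsHeatSystem μ α φ ℓ) (hh : IsFilter h) {L : ℝ} (hL : 0 < L)
    (m : ℕ → ℂ) : (fun j => (h (ℓ j / L) : ℂ) * m j).support.Finite := by
  refine (H.finite_freq L).subset fun j hj => ?_
  by_contra hlt
  refine hj ?_
  have : 1 ≤ ℓ j / L := by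
    rw [le_div_iff₀ hL]
    simp only [Set.mem_ofPred_eq, not_le] at hlt
    linarith
  simp [hh.eq_zero_of_le this]

theorem support_filter_finite' (H : IsHeatSystem μ α φ ℓ) (hh : IsFilter h) {L : ℝ} (hL : 0 < L) :
    (fun j => (h (ℓ j / L) : ℂ)).support.Finite := by
  simpa using support_filter_finite H hh hL (fun _ => 1)

/-- Low-pass filters composed with powers of the inverse heat operator of the same scale. The
additional power `τ^{-(q+1)}` compensates for the factor `τ` in the multiplier theorem. -/
theorem IsHeatSystem.exists_knorm_filter_heat_le (H : IsHeatSystem μ α φ ℓ) (hh : IsFilter h)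
    (q : ℕ) : ∃ C : ℝ, ∀ N : ℝ, 1 ≤ N →
      knorm μ φ (fun j => (h (ℓ j / N) : ℂ) * ((heatSym ℓ (N ^ 2)⁻¹ j)⁻¹ ^ q : ℝ)) ≤
        ENNReal.ofReal C := by
  obtain ⟨S, hS⟩ := exists_nat_gt α
  have hs := contDiff_heatCut hh hh.contDiff hh.eq_zero
    (fun x hx => hh.eq_one x (hx.trans (by norm_num))) (q + 1)
  have h0 := heatCut_eq_zero hh hh.eq_zero (q + 1)
  have hU : UnifC S Set.univ (fun _ : Unit => heatCut h h (q + 1)) := by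
    have := UnifC.cutoff (ι := Unit) (k := S) (s := Set.univ) hs h0 (Set.subset_univ _)
      (unifC_const (fun _ => 1) (C := 1) (by simp))
    simpa using this
  obtain ⟨C, hC⟩ := H.exists_knorm_le_of_unifC (Real.exp_pos (-1)) (by norm_num : (2 : ℝ) < 4)
    hS _ hU (fun _ => hs.continuous) (fun _ => h0)
  refine ⟨C, fun N hN => ?_⟩
  convert hC () N hN using 3 with j
  rw [heatCut_heatSym hh h (q + 1) (by linarith) (H.ell_nonneg j)]
  have h1 := (heatSym_pos ℓ (N ^ 2)⁻¹ j).ne'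
  push_cast
  have h2 : (heatSym ℓ (N ^ 2)⁻¹ j : ℂ) ≠ 0 := by exact_mod_cast h1
  rw [mul_assoc, pow_succ _ q, mul_assoc, inv_mul_cancel₀ h2, mul_one]

/-- The operators `σ_L` are uniformly bounded. -/
theorem IsHeatSystem.exists_knorm_filter_le (H : IsHeatSystem μ α φ ℓ) (hh : IsFilter h) :
    ∃ C : ℝ, 1 ≤ C ∧ ∀ L : ℝ, 0 < L →
      knorm μ φ (fun j => (h (ℓ j / L) : ℂ)) ≤ ENNReal.ofReal C := by
  obtain ⟨C, hC⟩ := H.exists_knorm_filter_heat_le hh 0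
  obtain ⟨D, hD0, hD⟩ := H.exists_knorm_le_of_bdd 1
  refine ⟨max 1 (max C D), le_max_left _ _, fun L hL => ?_⟩
  rcases le_total 1 L with h1 | h1
  · have := hC L h1
    simp only [pow_zero, Complex.ofReal_one, mul_one] at this
    exact this.trans (ENNReal.ofReal_le_ofReal ((le_max_left _ _).trans (le_max_right _ _)))
  · refine (hD _ 1 zero_le_one (fun j hj => ?_) fun j => ?_).trans
      (ENNReal.ofReal_le_ofReal ?_)
    · rw [hh.eq_zero_of_le, Complex.ofReal_zero]
      rw [le_div_iff₀ hL]
      linarith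
    · simpa using hh.abs_le_one (ℓ j / L)
    · rw [mul_one]
      exact (le_max_right _ _).trans (le_max_right _ _)

/-- The dyadic pieces of the frequency axis: `h(u)` and `h(u/2^{n+1}) - h(u/2^n)`. -/
noncomputable def piece (h : ℝ → ℝ) : ℕ → ℝ → ℝ
  | 0, u => h u
  | n + 1, u => h (u / 2 ^ (n + 1)) - h (u / 2 ^ n)

theorem sum_piece (h : ℝ → ℝ) (M : ℕ) (u : ℝ) :
    ∑ n ∈ Finset.range (M + 1), piece h n u = h (u / 2 ^ M) := by
  induction M with
  | zero => simp [piece]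
  | succ M ih => rw [Finset.sum_range_succ, ih, piece]; ring

theorem piece_eq_zero (hh : IsFilter h) {n : ℕ} {u : ℝ} (hu : 2 ^ n ≤ u) : piece h n u = 0 := by
  cases n with
  | zero => exact hh.eq_zero_of_le (by simpa using hu)
  | succ n =>
    have h1 : 1 ≤ u / 2 ^ (n + 1) := by rwa [le_div_iff₀ (by positivity), one_mul]
    have h2 : 1 ≤ u / 2 ^ n := by
      rw [le_div_iff₀ (by positivity), one_mul]
      have : (0 : ℝ) < 2 ^ n := by positivity
      rw [pow_succ] at hu
      linarith
    rw [piece, hh.eq_zero_of_le h1, hh.eq_zero_of_le h2, sub_zero]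

theorem support_piece_finite (H : IsHeatSystem μ α φ ℓ) (hh : IsFilter h) (n : ℕ) (m : ℕ → ℂ) :
    (fun j => (piece h n (ℓ j) : ℂ) * m j).support.Finite := by
  refine (H.finite_freq (2 ^ n)).subset fun j hj => ?_
  by_contra hlt
  refine hj ?_
  simp only [Set.mem_ofPred_eq, not_le] at hlt
  simp [piece_eq_zero hh hlt.le]

/-- A symbol `a(u) = (1+u)^s Θ(log u)`, where `Θ` has bounded derivatives up to order `S > α`,
behaves on the `n`-th dyadic piece like the constant `2^{ns}`. -/
theorem IsHeatSystem.exists_knorm_piece_le (H : IsHeatSystem μ α φ ℓ) (hh : IsFilter h) {S : ℕ}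
    (hS : α < S) {a Θ : ℝ → ℝ} {s : ℝ} (ha : ∀ u, 0 < u → a u = (1 + u) ^ s * Θ (Real.log u))
    (hΘ : UnifC S Set.univ (fun _ : ℕ => Θ)) :
    ∃ C : ℝ, 0 ≤ C ∧ ∀ n : ℕ, knorm μ φ (fun j => (piece h n (ℓ j) : ℂ) * (a (ℓ j) : ℂ)) ≤
      ENNReal.ofReal (C * ((2 : ℝ) ^ n) ^ s) := by
  have hS1 : 1 ≤ S := by
    rcases Nat.eq_zero_or_pos S with rfl | h1
    · have := H.alpha_pos
      simp at hS
      linarith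
    · exact h1
  -- the piece of index `n + 1` is `g(u/N)` with `N = 2^{n+1}`
  set g : ℝ → ℝ := fun x => h x - h (2 * x) with hg
  have hgs : ContDiff ℝ ((⊤ : ℕ∞) : WithTop ℕ∞) g :=
    hh.contDiff.sub (hh.contDiff.comp (contDiff_const.mul contDiff_id))
  have hg1 : ∀ x, 1 ≤ |x| → g x = 0 := fun x hx => by
    simp only [hg]
    rw [hh.eq_zero x hx, hh.eq_zero (2 * x) (by rw [abs_mul]; norm_num; linarith), sub_zero]
  have hg0 : ∀ x, |x| ≤ 1 / 4 → g x = 0 := fun x hx => by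
    simp only [hg]
    rw [hh.eq_one x (by linarith), hh.eq_one (2 * x) (by rw [abs_mul]; norm_num; linarith),
      sub_self]
  -- `B(τ)τ = g(ξ)`, where `ξ = u/N` and `τ = exp(-ξ²)`
  set B := heatCut g h 1 with hB
  have hBs : ContDiff ℝ ((⊤ : ℕ∞) : WithTop ℕ∞) B := contDiff_heatCut hh hgs hg1 hg0 1
  have hB0 : ∀ τ, τ ∉ Set.Icc (Real.exp (-1)) (Real.exp (-(1 / 16))) → B τ = 0 := by
    intro τ hτ
    by_cases h1 : τ ∈ Set.Icc (Real.exp (-1)) 2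
    · have h2 : Real.exp (-(1 / 16)) < τ := by
        by_contra h3
        exact hτ ⟨h1.1, not_lt.1 h3⟩
      have h0 : 0 < τ := (Real.exp_pos _).trans h2
      rw [hB, heatCut, if_pos h0, hg0, zero_mul, zero_mul]
      rw [abs_of_nonneg (Real.sqrt_nonneg _), Real.sqrt_le_left (by norm_num)]
      have := (Real.lt_log_iff_exp_lt h0).2 h2
      linarith
    · exact heatCut_eq_zero hh hg1 1 τ h1
  -- on this interval the frequency variable `√(-log τ)` stays between `1/8` and `2`
  set I := Set.Ioo (Real.exp (-2)) (Real.exp (-(1 / 32))) with hI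
  have hIB : Set.Icc (Real.exp (-1)) (Real.exp (-(1 / 16))) ⊆ I := fun τ hτ =>
    ⟨(Real.exp_lt_exp.2 (by norm_num)).trans_le hτ.1,
      hτ.2.trans_lt (Real.exp_lt_exp.2 (by norm_num))⟩
  set ξ : ℝ → ℝ := fun τ => √(-Real.log τ) with hξ
  have hξI : ∀ τ ∈ I, 1 / 8 < ξ τ ∧ ξ τ < 2 := by
    intro τ hτ
    have h0 : 0 < τ := (Real.exp_pos _).trans hτ.1
    have h1 := (Real.lt_log_iff_exp_lt h0).2 hτ.1
    have h2 := (Real.log_lt_iff_lt_exp h0).2 hτ.2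
    refine ⟨Real.lt_sqrt_of_sq_lt (by linarith), ?_⟩
    rw [hξ, Real.sqrt_lt' (by norm_num)]
    linarith
  have hξU : UnifC S I (fun _ : ℕ => ξ) := by
    refine unifC_of_contDiffOn (U := Set.Ioo 0 1) isOpen_Ioo isCompact_Icc ?_
      (Set.Ioo_subset_Icc_self) ?_
    · intro τ hτ
      refine ⟨(Real.exp_pos _).trans_le hτ.1, hτ.2.trans_lt ?_⟩
      rw [Real.exp_lt_one_iff]
      norm_num
    · intro τ hτ
      have h3 : 0 < -Real.log τ := by linarith [Real.log_neg hτ.1 hτ.2]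
      exact ((Real.contDiffAt_log.2 hτ.1.ne').neg.sqrt h3.ne').contDiffWithinAt
  set N : ℕ → ℝ := fun n => 2 ^ (n + 1) with hN
  have hN1 : ∀ n, 1 ≤ N n := fun n => one_le_pow₀ (by norm_num)
  have hN0 : ∀ n, 0 < N n := fun n => by linarith [hN1 n]
  have hNi : ∀ n, (N n)⁻¹ ≤ 1 := fun n => inv_le_one_of_one_le₀ (hN1 n)
  have hNp : ∀ n, 0 < (N n)⁻¹ := fun n => inv_pos.2 (hN0 n)
  have hpowU : UnifC S (Set.Ioo (1 / 8 : ℝ) 3) (fun _ : ℕ => fun y : ℝ => y ^ s) := by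
    refine unifC_of_contDiffOn (U := Set.Ioi 0) isOpen_Ioi isCompact_Icc ?_
      (Set.Ioo_subset_Icc_self) ?_
    · exact fun y hy => lt_of_lt_of_le (by norm_num : (0 : ℝ) < 1 / 8) hy.1
    · exact fun y hy => (Real.contDiffAt_rpow_const_of_ne (ne_of_gt hy)).contDiffWithinAt
  have hlogU : UnifC S (Set.Ioo (1 / 8 : ℝ) 2) (fun _ : ℕ => Real.log) := by
    refine unifC_of_contDiffOn (U := Set.Ioi 0) isOpen_Ioi isCompact_Icc ?_
      (Set.Ioo_subset_Icc_self) ?_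
    · exact fun y hy => lt_of_lt_of_le (by norm_num : (0 : ℝ) < 1 / 8) hy.1
    · exact fun y hy => (Real.contDiffAt_log.2 (ne_of_gt hy)).contDiffWithinAt
  -- after division by `N^s`, the symbol at `u = Nξ` is `(1/N + ξ)^s Θ(log N + log ξ)`; the bounds
  -- for `Θ` hold on the whole line, so the translation by `log N` does no harm
  have hM : UnifC S I (fun (n : ℕ) τ =>
      ((N n)⁻¹ + ξ τ) ^ s * Θ (Real.log (N n) + Real.log (ξ τ))) := by
    refine UnifC.mul ?_ ?_
    · refine hpowU.comp ((unifC_const (fun n => (N n)⁻¹) (C := 1) fun n => ?_).add hξU) ?_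
      · rw [abs_of_pos (hNp n)]
        exact hNi n
      · intro n τ hτ
        have := hξI τ hτ
        exact ⟨by linarith [hNp n], by linarith [hNi n]⟩
    · exact (hΘ.translate fun n => Real.log (N n)).comp
        (hlogU.comp hξU fun _ τ hτ => hξI τ hτ) fun _ _ _ => trivial
  have hG := UnifC.cutoff hBs hB0 hIB hM
  have hGc : ∀ n, Continuous fun τ =>
      B τ * (((N n)⁻¹ + ξ τ) ^ s * Θ (Real.log (N n) + Real.log (ξ τ))) := by
    intro n
    obtain ⟨k, rfl⟩ : ∃ k, S = k + 1 := ⟨S - 1, by omega⟩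
    obtain ⟨-, f', hf', -⟩ := hG
    exact continuous_iff_continuousAt.2 fun τ => (hf' n τ trivial).continuousAt
  obtain ⟨C, hC⟩ := H.exists_knorm_le_of_unifC (Real.exp_pos (-1))
    (show Real.exp (-(1 / 16)) < 4 by
      refine lt_trans (Real.exp_lt_one_iff.2 (by norm_num)) (by norm_num)) hS _ hG hGc
    (fun n τ hτ => by rw [hB0 τ hτ, zero_mul])
  obtain ⟨D, hD0, hD⟩ := H.exists_knorm_le_of_bdd 1
  set E := ∑ j ∈ (H.finite_freq 1).toFinset, ‖(piece h 0 (ℓ j) : ℂ) * (a (ℓ j) : ℂ)‖ with hE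
  have hE0 : 0 ≤ E := Finset.sum_nonneg fun _ _ => norm_nonneg _
  refine ⟨max (D * E) C, le_max_of_le_left (by positivity), fun n => ?_⟩
  cases n with
  | zero =>
    -- the first piece contains the frequency `0`, where the form of the symbol is not available, but
    -- it involves only finitely many frequencies
    rw [pow_zero, Real.one_rpow, mul_one]
    have hz : ∀ j, 1 < ℓ j → (piece h 0 (ℓ j) : ℂ) * (a (ℓ j) : ℂ) = 0 := fun j hj => by
      rw [piece_eq_zero hh (by simpa using hj.le)]
      simp
    refine (hD _ E hE0 hz fun j => ?_).trans (ENNReal.ofReal_le_ofReal (le_max_left _ _))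
    by_cases hj : ℓ j ≤ 1
    · exact Finset.single_le_sum (f := fun j => ‖(piece h 0 (ℓ j) : ℂ) * (a (ℓ j) : ℂ)‖)
        (fun _ _ => norm_nonneg _) (by simpa using hj)
    · rw [hz j (not_le.1 hj), norm_zero]
      exact hE0
  | succ n =>
    have h1 : ∀ j, (piece h (n + 1) (ℓ j) : ℂ) * (a (ℓ j) : ℂ) = (((N n) ^ s : ℝ) : ℂ) *
        (((B (heatSym ℓ ((N n) ^ 2)⁻¹ j) * (((N n)⁻¹ + ξ (heatSym ℓ ((N n) ^ 2)⁻¹ j)) ^ s *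
          Θ (Real.log (N n) + Real.log (ξ (heatSym ℓ ((N n) ^ 2)⁻¹ j)))) : ℝ) : ℂ) *
        (heatSym ℓ ((N n) ^ 2)⁻¹ j : ℂ)) := by
      intro j
      have hj := H.ell_nonneg j
      have hτ := heatSym_pos ℓ ((N n) ^ 2)⁻¹ j
      rw [hB, heatCut_heatSym hh g 1 (hN0 n) hj,
        show ξ (heatSym ℓ ((N n) ^ 2)⁻¹ j) = ℓ j / N n from sqrt_neg_log_heatSym (hN0 n) hj]
      have h2 : piece h (n + 1) (ℓ j) = g (ℓ j / N n) := by
        simp only [piece, hg, hN]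
        congr 2
        rw [pow_succ]
        field_simp
      rw [h2]
      norm_cast
      rcases hj.eq_or_lt with h3 | h3
      · rw [← h3, zero_div, hg0 0 (by norm_num)]
        simp
      · rw [ha _ h3, Real.log_div h3.ne' (hN0 n).ne']
        have h4 : (N n)⁻¹ + ℓ j / N n = (1 + ℓ j) / N n := by
          field_simp
        rw [h4, Real.div_rpow (by positivity) (hN0 n).le]
        have h5 : (N n) ^ s ≠ 0 := (Real.rpow_pos_of_pos (hN0 n) s).ne'
        have h6 : Real.log (N n) + (Real.log (ℓ j) - Real.log (N n)) = Real.log (ℓ j) := by ring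
        rw [h6]
        generalize heatSym ℓ ((N n) ^ 2)⁻¹ j = τ at hτ ⊢
        field_simp
    simp_rw [h1]
    rw [knorm_const_mul, ← ofReal_norm, Complex.norm_real,
      Real.norm_of_nonneg (Real.rpow_nonneg (hN0 n).le s)]
    refine (mul_le_mul_right (hC n (N n) (hN1 n)) _).trans ?_
    rw [← ENNReal.ofReal_mul (Real.rpow_nonneg (hN0 n).le s), mul_comm]
    refine ENNReal.ofReal_le_ofReal (mul_le_mul_of_nonneg_right (le_max_right _ _)
      (Real.rpow_nonneg (hN0 n).le s))

/-! ### Summation over dyadic pieces -/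

/-- The symbol `a` has order `s`: on the `n`-th dyadic piece its kernel norm is `O(2^{ns})`. -/
def HasOrder {X : Type*} [MeasurableSpace X] (μ : Measure X) (φ : ℕ → X → ℝ) (ℓ : ℕ → ℝ)
    (h a : ℝ → ℝ) (s : ℝ) : Prop :=
  ∃ C : ℝ, 0 ≤ C ∧ ∀ n : ℕ, knorm μ φ (fun j => (piece h n (ℓ j) : ℂ) * (a (ℓ j) : ℂ)) ≤
      ENNReal.ofReal (C * ((2 : ℝ) ^ n) ^ s)

theorem exists_two_pow_near (x : ℝ) : ∃ n : ℕ, x ≤ 2 ^ n ∧ (2 : ℝ) ^ n ≤ max 1 (2 * x) := by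
  rcases le_total x 1 with hx | hx
  · exact ⟨0, by simpa using hx, by simp⟩
  · obtain ⟨n, h1, h2⟩ := exists_nat_pow_near hx (by norm_num : (1 : ℝ) < 2)
    refine ⟨n + 1, h2.le, le_max_of_le_right ?_⟩
    rw [pow_succ]
    linarith

theorem two_pow_rpow (n : ℕ) (s : ℝ) : ((2 : ℝ) ^ n) ^ s = ((2 : ℝ) ^ s) ^ n := by
  rw [← Real.rpow_natCast, ← Real.rpow_natCast, ← Real.rpow_mul (by norm_num),
    ← Real.rpow_mul (by norm_num), mul_comm]

/-- A geometric series of negative exponent is dominated by its first term. -/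
theorem exists_tsum_two_pow_le {s : ℝ} (hs : s < 0) :
    ∃ C : ℝ, 0 ≤ C ∧ ∀ x : ℝ, 0 < x →
      ∑' n : ℕ, (if x < 2 ^ n then ENNReal.ofReal (((2 : ℝ) ^ n) ^ s) else 0) ≤
        ENNReal.ofReal (C * x ^ s) := by
  set q : ℝ := 2 ^ s with hq
  have hq0 : 0 < q := by positivity
  have hq1 : q < 1 := Real.rpow_lt_one_of_one_lt_of_neg (by norm_num) hs
  have hex : ∀ x : ℝ, ∃ n : ℕ, x < 2 ^ n := fun x => pow_unbounded_of_one_lt x (by norm_num)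
  refine ⟨(1 - q)⁻¹, inv_nonneg.2 (by linarith), fun x hx => ?_⟩
  classical
  set n₁ := Nat.find (hex x) with hn₁
  have hn₁x : x < 2 ^ n₁ := Nat.find_spec (hex x)
  rw [← (ENNReal.summable).sum_add_tsum_nat_add' (k := n₁)]
  rw [Finset.sum_eq_zero, zero_add]
  · calc _ ≤ ∑' k : ℕ, ENNReal.ofReal (x ^ s * q ^ k) := by
          refine ENNReal.tsum_le_tsum fun k => ?_
          split_ifs
          · refine ENNReal.ofReal_le_ofReal ?_
            rw [pow_add, Real.mul_rpow (by positivity) (by positivity), mul_comm, two_pow_rpow k]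
            gcongr ?_ * _
            exact Real.rpow_le_rpow_of_nonpos hx hn₁x.le hs.le
          · exact zero_le
      _ = _ := by
          rw [← ENNReal.ofReal_tsum_of_nonneg (fun k => by positivity)
            ((summable_geometric_of_lt_one hq0.le hq1).mul_left _), tsum_mul_left,
            tsum_geometric_of_lt_one hq0.le hq1, mul_comm]
  · intro n hn
    rw [if_neg (Nat.find_min (hex x) (Finset.mem_range.1 hn))]

/-- A geometric sum of positive exponent is dominated by its last term. -/
theorem exists_sum_two_pow_le {s : ℝ} (hs : 0 < s) :
    ∃ C : ℝ, 0 ≤ C ∧ ∀ n : ℕ, ∑ k ∈ Finset.range (n + 1), ((2 : ℝ) ^ k) ^ s ≤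
      C * ((2 : ℝ) ^ n) ^ s := by
  set q : ℝ := 2 ^ s with hq
  have hq1 : 1 < q := Real.one_lt_rpow (by norm_num) hs
  refine ⟨q / (q - 1), div_nonneg (by linarith) (by linarith), fun n => ?_⟩
  simp_rw [two_pow_rpow]
  rw [geom_sum_eq hq1.ne', pow_succ, div_mul_eq_mul_div]
  have : 0 < q - 1 := by linarith
  gcongr
  linarith

/-- A symbol of positive order `s`, cut off at frequency `L`, has kernel norm `O(L^s)`. A lower bound
for `L` is needed because the piece of index `0` does not become small with `L`. -/
theorem HasOrder.exists_low (H : IsHeatSystem μ α φ ℓ) (hh : IsFilter h) {a : ℝ → ℝ} {s : ℝ}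
    (ha : HasOrder μ φ ℓ h a s) (hs : 0 < s) {L₀ : ℝ} (hL₀ : 0 < L₀) :
    ∃ C : ℝ, 0 ≤ C ∧ ∀ L : ℝ, L₀ ≤ L →
      knorm μ φ (fun j => (h (ℓ j / L) : ℂ) * (a (ℓ j) : ℂ)) ≤ ENNReal.ofReal (C * L ^ s) := by
  obtain ⟨C, hC0, hC⟩ := ha
  obtain ⟨D, hD1, hD⟩ := H.exists_knorm_filter_le hh
  obtain ⟨K, hK0, hK⟩ := exists_sum_two_pow_le hs
  refine ⟨C * D * K * (max L₀⁻¹ 4) ^ s, by positivity, fun L hL => ?_⟩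
  have hL0 : 0 < L := hL₀.trans_le hL
  obtain ⟨n, hn1, hn2⟩ := exists_two_pow_near (2 * L)
  have h1 : ∀ j, (h (ℓ j / L) : ℂ) * (a (ℓ j) : ℂ) = ∑ k ∈ Finset.range (n + 1),
      ((piece h k (ℓ j) : ℂ) * (a (ℓ j) : ℂ)) * (h (ℓ j / L) : ℂ) := by
    intro j
    have hj := H.ell_nonneg j
    rw [← Finset.sum_mul, ← Finset.sum_mul, ← Complex.ofReal_sum, sum_piece]
    by_cases hjL : ℓ j ≤ L
    · rw [hh.eq_one_of_le (t := ℓ j / 2 ^ n) (by positivity), Complex.ofReal_one]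
      · ring
      · rw [div_le_iff₀ (by positivity)]
        linarith
    · rw [hh.eq_zero_of_le (t := ℓ j / L), Complex.ofReal_zero]
      · ring
      · rw [le_div_iff₀ hL0]
        linarith
  simp_rw [h1]
  have hfin : ∀ k, (fun j => (piece h k (ℓ j) : ℂ) * (a (ℓ j) : ℂ)).support.Finite := fun k =>
    support_piece_finite H hh k _
  calc _ ≤ ∑ k ∈ Finset.range (n + 1), knorm μ φ (fun j =>
        ((piece h k (ℓ j) : ℂ) * (a (ℓ j) : ℂ)) * (h (ℓ j / L) : ℂ)) :=
        knorm_sum_le H _ fun k _ => support_mul_finite (hfin k)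
    _ ≤ ∑ k ∈ Finset.range (n + 1), ENNReal.ofReal (C * D * ((2 : ℝ) ^ k) ^ s) := by
        refine Finset.sum_le_sum fun k _ => ?_
        refine (knorm_mul_le H (adm_of_finite (hfin k))
          (adm_of_finite (support_filter_finite' H hh hL0))).trans ?_
        refine (mul_le_mul' (hC k) (hD L hL0)).trans ?_
        rw [← ENNReal.ofReal_mul (by positivity)]
        exact ENNReal.ofReal_le_ofReal (le_of_eq (by ring))
    _ = ENNReal.ofReal (C * D * ∑ k ∈ Finset.range (n + 1), ((2 : ℝ) ^ k) ^ s) := by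
        rw [← ENNReal.ofReal_sum_of_nonneg fun k _ => by positivity, Finset.mul_sum]
    _ ≤ _ := by
        refine ENNReal.ofReal_le_ofReal ?_
        have h2 : (2 : ℝ) ^ n ≤ max L₀⁻¹ 4 * L := by
          refine hn2.trans (max_le ?_ ?_)
          · calc (1 : ℝ) = L₀⁻¹ * L₀ := (inv_mul_cancel₀ hL₀.ne').symm
              _ ≤ max L₀⁻¹ 4 * L := by
                gcongr
                exact le_max_left _ _
          · have : 4 * L ≤ max L₀⁻¹ 4 * L := by
              gcongr
              exact le_max_right _ _
            linarith
        calc _ ≤ C * D * (K * ((2 : ℝ) ^ n) ^ s) := by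
              gcongr
              exact hK n
          _ ≤ C * D * (K * (max L₀⁻¹ 4 * L) ^ s) := by gcongr
          _ = _ := by
              rw [Real.mul_rpow (by positivity) hL0.le]
              ring

/-- A dyadic piece of a symbol with the frequencies below `L/2` removed. -/
theorem HasOrder.exists_piece_high (H : IsHeatSystem μ α φ ℓ) (hh : IsFilter h) {a : ℝ → ℝ} {s : ℝ}
    (ha : HasOrder μ φ ℓ h a s) :
    ∃ C : ℝ, 0 ≤ C ∧ ∀ (L : ℝ) (n : ℕ), 0 < L →
      knorm μ φ (fun j => (piece h n (ℓ j) : ℂ) * ((a (ℓ j) : ℂ) * (1 - (h (ℓ j / L) : ℂ)))) ≤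
        if L / 2 < 2 ^ n then ENNReal.ofReal (C * ((2 : ℝ) ^ n) ^ s) else 0 := by
  obtain ⟨C, hC0, hC⟩ := ha
  obtain ⟨D, hD1, hD⟩ := H.exists_knorm_filter_le hh
  refine ⟨C * (1 + D), by positivity, fun L n hL => ?_⟩
  split_ifs with hn
  · have hfin := support_piece_finite H hh n (fun j => (a (ℓ j) : ℂ))
    have h1 : ∀ j, (piece h n (ℓ j) : ℂ) * ((a (ℓ j) : ℂ) * (1 - (h (ℓ j / L) : ℂ))) =
        (piece h n (ℓ j) : ℂ) * (a (ℓ j) : ℂ) +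
          (-1) * (((piece h n (ℓ j) : ℂ) * (a (ℓ j) : ℂ)) * (h (ℓ j / L) : ℂ)) := fun j => by ring
    simp_rw [h1]
    have hfin2 := support_mul_finite (m' := fun j => (h (ℓ j / L) : ℂ)) hfin
    have hfin3 : (fun j => (-1 : ℂ) * (((piece h n (ℓ j) : ℂ) * (a (ℓ j) : ℂ)) *
        (h (ℓ j / L) : ℂ))).support.Finite := by
      refine hfin2.subset fun j hj => ?_
      simp only [Function.mem_support] at hj ⊢
      exact right_ne_zero_of_mul hj
    refine (knorm_add_le H (adm_of_finite hfin) (adm_of_finite hfin3)).trans ?_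
    rw [knorm_const_mul, enorm_neg, enorm_one, one_mul]
    refine (add_le_add (hC n) ((knorm_mul_le H (adm_of_finite hfin)
      (adm_of_finite (support_filter_finite' H hh hL))).trans
        (mul_le_mul' (hC n) (hD L hL)))).trans ?_
    rw [← ENNReal.ofReal_mul (by positivity), ← ENNReal.ofReal_add (by positivity) (by positivity)]
    exact ENNReal.ofReal_le_ofReal (le_of_eq (by ring))
  · have h1 : ∀ j, (piece h n (ℓ j) : ℂ) * ((a (ℓ j) : ℂ) * (1 - (h (ℓ j / L) : ℂ))) = 0 := by
      intro j
      have hj := H.ell_nonneg j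
      by_cases hjn : ℓ j ≤ 2 ^ n
      · rw [hh.eq_one_of_le (t := ℓ j / L) (by positivity)]
        · simp
        · rw [div_le_iff₀ hL]
          linarith
      · rw [piece_eq_zero hh (not_le.1 hjn).le]
        simp
    simp_rw [h1]
    rw [knorm_zero]

/-- A symbol of negative order `s`, restricted to frequencies between `L/2` and `2^M`, has kernel norm
`O(L^s)`, uniformly in `M`. -/
theorem HasOrder.exists_high (H : IsHeatSystem μ α φ ℓ) (hh : IsFilter h) {a : ℝ → ℝ} {s : ℝ}
    (ha : HasOrder μ φ ℓ h a s) (hs : s < 0) :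
    ∃ C : ℝ, 0 ≤ C ∧ ∀ (L : ℝ) (M : ℕ), 0 < L → 2 * L ≤ 2 ^ M →
      knorm μ φ (fun j => ((h (ℓ j / 2 ^ M) : ℂ) - (h (ℓ j / L) : ℂ)) * (a (ℓ j) : ℂ)) ≤
        ENNReal.ofReal (C * L ^ s) := by
  obtain ⟨C, hC0, hC⟩ := ha.exists_piece_high H hh
  obtain ⟨K, hK0, hK⟩ := exists_tsum_two_pow_le hs
  refine ⟨C * K * (1 / 2) ^ s, by positivity, fun L M hL hM => ?_⟩
  have h1 : ∀ j, ((h (ℓ j / 2 ^ M) : ℂ) - (h (ℓ j / L) : ℂ)) * (a (ℓ j) : ℂ) =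
      ∑ n ∈ Finset.range (M + 1),
        (piece h n (ℓ j) : ℂ) * ((a (ℓ j) : ℂ) * (1 - (h (ℓ j / L) : ℂ))) := by
    intro j
    have hj := H.ell_nonneg j
    rw [← Finset.sum_mul, ← Complex.ofReal_sum, sum_piece]
    by_cases hjL : ℓ j ≤ L
    · rw [hh.eq_one_of_le (t := ℓ j / 2 ^ M) (by positivity), Complex.ofReal_one]
      · ring
      · rw [div_le_iff₀ (by positivity)]
        linarith
    · rw [hh.eq_zero_of_le (t := ℓ j / L), Complex.ofReal_zero]
      · ring
      · rw [le_div_iff₀ hL]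
        linarith
  simp_rw [h1]
  calc _ ≤ ∑ n ∈ Finset.range (M + 1), knorm μ φ (fun j =>
        (piece h n (ℓ j) : ℂ) * ((a (ℓ j) : ℂ) * (1 - (h (ℓ j / L) : ℂ)))) :=
        knorm_sum_le H _ fun n _ => support_piece_finite H hh n _
    _ ≤ ∑ n ∈ Finset.range (M + 1),
        ENNReal.ofReal C * (if L / 2 < 2 ^ n then ENNReal.ofReal (((2 : ℝ) ^ n) ^ s) else 0) := by
        refine Finset.sum_le_sum fun n _ => (hC L n hL).trans ?_
        split_ifs
        · rw [← ENNReal.ofReal_mul hC0]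
        · exact zero_le
    _ ≤ ENNReal.ofReal C *
        ∑' n : ℕ, (if L / 2 < 2 ^ n then ENNReal.ofReal (((2 : ℝ) ^ n) ^ s) else 0) := by
        rw [← Finset.mul_sum]
        gcongr
        exact ENNReal.sum_le_tsum _
    _ ≤ ENNReal.ofReal C * ENNReal.ofReal (K * (L / 2) ^ s) := by
        gcongr
        exact hK _ (by positivity)
    _ = _ := by
        rw [← ENNReal.ofReal_mul hC0, div_eq_mul_one_div, Real.mul_rpow hL.le (by norm_num)]
        congr 1
        ring

/-! ### Masks -/

theorem IsMask.pos {S : ℕ} {β : ℝ} {b : ℝ → ℝ} (hb : IsMask S β b) {u : ℝ} (hu : 0 ≤ u) :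
    0 < b u := by
  obtain ⟨F, hF, hform, -, c₁, hc₁, hFc⟩ := hb.exists_log_form
  rcases hu.eq_or_lt with rfl | hu
  · -- at the origin the logarithmic form is not available, and continuity is used instead
    have h1 : Tendsto b (𝓝[>] 0) (𝓝 (b 0)) :=
      hb.contDiff.continuous.continuousAt.tendsto.mono_left nhdsWithin_le_nhds
    have h2 : Tendsto (fun t : ℝ => (1 + t) ^ (-β) * c₁) (𝓝[>] 0) (𝓝 ((1 + 0) ^ (-β) * c₁)) := by
      have : ContinuousAt (fun t : ℝ => (1 + t) ^ (-β) * c₁) 0 :=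
        ((continuousAt_const.add continuousAt_id).rpow_const (Or.inl (by norm_num))).mul_const _
      exact this.tendsto.mono_left nhdsWithin_le_nhds
    have h3 := le_of_tendsto_of_tendsto h2 h1 (by
      filter_upwards [self_mem_nhdsWithin] with t ht
      rw [hform t ht]
      have : (0 : ℝ) < 1 + t := by linarith [show (0 : ℝ) < t from ht]
      gcongr
      exact hFc _)
    simp only [add_zero, Real.one_rpow, one_mul] at h3
    linarith
  · rw [hform u hu]
    have := hFc (Real.log u)
    have : 0 < F (Real.log u) := by linarith
    positivity

/-- Two-sided bounds for a mask. At the origin, where the logarithmic form is not available, the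
value `b 0` enters the constant. -/
theorem IsMask.exists_le {S : ℕ} {β : ℝ} {b : ℝ → ℝ} (hb : IsMask S β b) :
    ∃ C : ℝ, 0 ≤ C ∧ ∀ u, 0 ≤ u → b u ≤ C * (1 + u) ^ (-β) ∧ (b u)⁻¹ ≤ C * (1 + u) ^ β := by
  obtain ⟨F, hF, hform, ⟨c, hc⟩, c₁, hc₁, hFc⟩ := hb.exists_log_form
  have hb0 := hb.pos le_rfl
  refine ⟨max (max c c₁⁻¹) (max (b 0) (b 0)⁻¹), le_max_of_le_right (le_max_of_le_left hb0.le),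
    fun u hu => ?_⟩
  rcases hu.eq_or_lt with rfl | hu
  · simp
  · have h1 : 0 < F (Real.log u) := hc₁.trans_le (hFc _)
    have h2 : F (Real.log u) ≤ c := by
      have := hc 0 (Nat.zero_le _) (Real.log u)
      rw [iteratedDeriv_zero] at this
      exact (le_abs_self _).trans this
    rw [hform u hu, mul_inv, Real.rpow_neg (by linarith), inv_inv, mul_comm, mul_comm _ (F _)⁻¹]
    constructor
    · gcongr
      exact h2.trans ((le_max_left _ _).trans (le_max_left _ _))
    · gcongr
      exact (inv_anti₀ hc₁ (hFc _)).trans ((le_max_right _ _).trans (le_max_left _ _))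

theorem hasOrder_of_log_form (H : IsHeatSystem μ α φ ℓ) (hh : IsFilter h) {S : ℕ} (hS : α < S)
    (a Θ : ℝ → ℝ) (s : ℝ) (ha : ∀ u, 0 < u → a u = (1 + u) ^ s * Θ (Real.log u))
    (hΘ : UnifC S Set.univ (fun _ : ℕ => Θ)) : HasOrder μ φ ℓ h a s :=
  H.exists_knorm_piece_le hh hS ha hΘ

theorem hasOrder_rpow (H : IsHeatSystem μ α φ ℓ) (hh : IsFilter h) (s : ℝ) :
    HasOrder μ φ ℓ h (fun u => (1 + u) ^ s) s := by
  obtain ⟨S, hS⟩ := exists_nat_gt α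
  exact hasOrder_of_log_form H hh hS _ (fun _ => 1) s (fun u _ => (mul_one _).symm)
    (unifC_const (fun _ => 1) (C := 1) (by simp))

/-- A mask of type `β` has order `-β`; the power `(1+u)^s` shifts the order by `s`. -/
theorem hasOrder_mask (H : IsHeatSystem μ α φ ℓ) (hh : IsFilter h) {S : ℕ} (hS : α < S) {β : ℝ}
    {b : ℝ → ℝ} (hb : IsMask S β b) (s : ℝ) :
    HasOrder μ φ ℓ h (fun u => b u * (1 + u) ^ s) (s - β) := by
  obtain ⟨F, hF, hform, hc, -⟩ := hb.exists_log_form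
  refine hasOrder_of_log_form H hh hS _ F _ (fun u hu => ?_) (unifC_of_iteratedDeriv hF hc)
  rw [hform u hu, sub_eq_add_neg, Real.rpow_add (by linarith)]
  ring

/-- The reciprocal of a mask of type `β` has order `β`: the lower bound for `F` makes the
derivatives of `1/F` bounded. -/
theorem hasOrder_inv_mask (H : IsHeatSystem μ α φ ℓ) (hh : IsFilter h) {S : ℕ} (hS : α < S)
    {β : ℝ} {b : ℝ → ℝ} (hb : IsMask S β b) (s : ℝ) :
    HasOrder μ φ ℓ h (fun u => (1 + u) ^ s / b u) (s + β) := by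
  obtain ⟨F, hF, hform, hc, c₁, hc₁, hFc⟩ := hb.exists_log_form
  refine hasOrder_of_log_form H hh hS _ (fun v => (F v)⁻¹) _ (fun u hu => ?_) ?_
  · rw [hform u hu, Real.rpow_add (by linarith), Real.rpow_neg (by linarith)]
    have h1 : 0 < F (Real.log u) := hc₁.trans_le (hFc _)
    have h2 : 0 < (1 + u) ^ β := by positivity
    field_simp
  · have hFU : UnifC S Set.univ (fun _ : ℕ => F) := unifC_of_iteratedDeriv hF hc
    obtain ⟨c, hc⟩ := hc
    have hinv : UnifC S (Set.Icc c₁ c) (fun _ : ℕ => fun y : ℝ => y⁻¹) := by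
      refine unifC_of_contDiffOn (U := Set.Ioi 0) isOpen_Ioi isCompact_Icc ?_ subset_rfl ?_
      · exact fun y hy => hc₁.trans_le hy.1
      · exact fun y hy => (contDiffAt_inv ℝ (ne_of_gt hy)).contDiffWithinAt
    refine hinv.comp hFU fun _ v _ => ⟨hFc v, ?_⟩
    have := hc 0 (Nat.zero_le _) v
    rw [iteratedDeriv_zero] at this
    exact (le_abs_self _).trans this

/-! ### Schur's test -/

/-- **Schur's test** between two measures, with the dependence on `p` made explicit. -/
theorem eLpNorm_le_of_kernel {μ' ν : Measure X} [SFinite μ'] [SFinite ν] {k : X → X → ℂ}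
    (hk : Measurable fun z : X × X => k z.1 z.2) {A B : ℝ≥0∞}
    (hA : ∀ x, ∫⁻ y, ‖k x y‖ₑ ∂ν ≤ A) (hB : ∀ y, ∫⁻ x, ‖k x y‖ₑ ∂μ' ≤ B) {f F : X → ℂ}
    (hf : AEMeasurable f ν) (hF : ∀ x, ‖F x‖ₑ ≤ ∫⁻ y, ‖k x y‖ₑ * ‖f y‖ₑ ∂ν) {p : ℝ≥0∞}
    (hp : 1 ≤ p) :
    eLpNorm F p μ' ≤ A ^ (1 - (p⁻¹).toReal) * B ^ (p⁻¹).toReal * eLpNorm f p ν := by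
  have hkx : ∀ x, Measurable fun y => k x y := fun x => hk.comp measurable_prodMk_left
  rcases eq_or_ne p ⊤ with rfl | hpt
  · simp only [ENNReal.inv_top, ENNReal.toReal_zero, sub_zero, ENNReal.rpow_one, ENNReal.rpow_zero,
      mul_one]
    rw [eLpNorm_exponent_top, eLpNorm_exponent_top]
    refine eLpNormEssSup_le_of_ae_enorm_bound (Eventually.of_forall fun x => (hF x).trans ?_)
    calc _ ≤ ∫⁻ y, ‖k x y‖ₑ * eLpNormEssSup f ν ∂ν := by
          refine lintegral_mono_ae ?_
          filter_upwards [enorm_ae_le_eLpNormEssSup f ν] with y hy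
          gcongr
      _ = (∫⁻ y, ‖k x y‖ₑ ∂ν) * eLpNormEssSup f ν := lintegral_mul_const _ (hkx x).enorm
      _ ≤ _ := by gcongr; exact hA x
  · have hp0 : p ≠ 0 := (zero_lt_one.trans_le hp).ne'
    set t := p.toReal with ht
    have ht1 : 1 ≤ t := by
      rw [ht, ← ENNReal.toReal_one]
      exact ENNReal.toReal_mono hpt hp
    have ht0 : 0 < t := by linarith
    have hpinv : (p⁻¹).toReal = t⁻¹ := ENNReal.toReal_inv p
    rw [hpinv, eLpNorm_eq_lintegral_rpow_enorm_toReal hp0 hpt,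
      eLpNorm_eq_lintegral_rpow_enorm_toReal hp0 hpt, ← ht]
    have hpt : ∀ x, ‖F x‖ₑ ^ t ≤ A ^ (t - 1) * ∫⁻ y, ‖k x y‖ₑ * ‖f y‖ₑ ^ t ∂ν := by
      intro x
      refine (ENNReal.rpow_le_rpow (hF x) ht0.le).trans ?_
      rcases ht1.eq_or_lt with h1 | h1
      · rw [← h1]
        simp
      · have hconj : (t / (t - 1)).HolderConjugate t :=
          (Real.HolderConjugate.conjExponent h1).symm
        have ha0 : 0 < t / (t - 1) := hconj.pos
        have h2 := ENNReal.lintegral_mul_le_Lp_mul_Lq ν hconj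
          (f := fun y => ‖k x y‖ₑ ^ (1 / (t / (t - 1)))) (g := fun y => ‖k x y‖ₑ ^ (1 / t) * ‖f y‖ₑ)
          ((hkx x).enorm.pow_const _).aemeasurable
          (((hkx x).enorm.pow_const _).aemeasurable.mul hf.enorm)
        have h3 : ∀ y, ((fun y => ‖k x y‖ₑ ^ (1 / (t / (t - 1)))) *
            fun y => ‖k x y‖ₑ ^ (1 / t) * ‖f y‖ₑ) y = ‖k x y‖ₑ * ‖f y‖ₑ := fun y => by
          rw [Pi.mul_apply, ← mul_assoc, ← ENNReal.rpow_add_of_nonneg _ _ (by positivity)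
            (by positivity)]
          have : 1 / (t / (t - 1)) + 1 / t = 1 := by
            simpa using hconj.inv_add_inv_eq_one
          rw [this, ENNReal.rpow_one]
        simp_rw [h3, ENNReal.mul_rpow_of_nonneg _ _ ht0.le, ← ENNReal.rpow_mul] at h2
        rw [one_div_mul_cancel ha0.ne', one_div_mul_cancel ht0.ne'] at h2
        simp only [ENNReal.rpow_one] at h2
        calc _ ≤ ((∫⁻ y, ‖k x y‖ₑ ∂ν) ^ (1 / (t / (t - 1))) *
              (∫⁻ y, ‖k x y‖ₑ * ‖f y‖ₑ ^ t ∂ν) ^ (1 / t)) ^ t :=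
              ENNReal.rpow_le_rpow h2 ht0.le
          _ = (∫⁻ y, ‖k x y‖ₑ ∂ν) ^ (t - 1) * ∫⁻ y, ‖k x y‖ₑ * ‖f y‖ₑ ^ t ∂ν := by
              rw [ENNReal.mul_rpow_of_nonneg _ _ ht0.le, ← ENNReal.rpow_mul, ← ENNReal.rpow_mul,
                one_div_mul_cancel ht0.ne', ENNReal.rpow_one]
              congr 2
              have : t - 1 ≠ 0 := by linarith
              field_simp
          _ ≤ _ := by
              refine mul_le_mul' (ENNReal.rpow_le_rpow (hA x) (by linarith)) le_rfl
    calc _ ≤ (∫⁻ x, A ^ (t - 1) * ∫⁻ y, ‖k x y‖ₑ * ‖f y‖ₑ ^ t ∂ν ∂μ') ^ (1 / t) := by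
          gcongr with x
          exact hpt x
      _ ≤ (A ^ (t - 1) * (B * ∫⁻ y, ‖f y‖ₑ ^ t ∂ν)) ^ (1 / t) := by
          have hm : AEMeasurable (Function.uncurry fun x y => ‖k x y‖ₑ * ‖f y‖ₑ ^ t)
              (μ'.prod ν) :=
            hk.enorm.aemeasurable.mul ((hf.enorm.pow_const t).comp_snd)
          gcongr
          have hm' : AEMeasurable (fun x => ∫⁻ y, ‖k x y‖ₑ * ‖f y‖ₑ ^ t ∂ν) μ' :=
            hm.lintegral_prod_right'
          rw [lintegral_const_mul'' _ hm']
          gcongr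
          rw [lintegral_lintegral_swap hm]
          calc _ = ∫⁻ y, (∫⁻ x, ‖k x y‖ₑ ∂μ') * ‖f y‖ₑ ^ t ∂ν := by
                refine lintegral_congr fun y => ?_
                rw [lintegral_mul_const]
                exact (hk.comp measurable_prodMk_right).enorm
            _ ≤ ∫⁻ y, B * ‖f y‖ₑ ^ t ∂ν := by
                gcongr with y
                exact hB y
            _ = _ := lintegral_const_mul'' _ (hf.enorm.pow_const t)
      _ = _ := by
          have ht' : 0 ≤ 1 / t := by positivity
          rw [ENNReal.mul_rpow_of_nonneg _ _ ht', ENNReal.mul_rpow_of_nonneg _ _ ht',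
            ← ENNReal.rpow_mul, ← mul_assoc]
          congr 3
          · field_simp
          · rw [one_div]

/-! ### Finite expansions -/

/-- The expansion `∑_k m_k a_k φ_k` with multiplier `m` and coefficients `a`. It is used only for
multipliers of finite support. -/
noncomputable def series {X : Type*} (φ : ℕ → X → ℝ) (m a : ℕ → ℂ) (x : X) : ℂ :=
  ∑' k, m k * a k * (φ k x : ℂ)

/-- The discrete coefficients `∑_{y ∈ C} w_y f(y) φ_k(y)`. -/
noncomputable def dcoeff {X : Type*} (φ : ℕ → X → ℝ) (C : Finset X) (w : X → ℝ) (f : X → ℂ)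
    (k : ℕ) : ℂ :=
  ∑ y ∈ C, (w y : ℂ) * f y * (φ k y : ℂ)

theorem series_eq_sum {s : Finset ℕ} {m : ℕ → ℂ} (hs : ∀ j ∉ s, m j = 0) (a : ℕ → ℂ) (x : X) :
    series φ m a x = ∑ k ∈ s, m k * a k * (φ k x : ℂ) :=
  tsum_eq_sum fun j hj => by simp [hs j hj]

theorem eq_zero_of_notMem_toFinset {m : ℕ → ℂ} (hm : m.support.Finite) :
    ∀ j ∉ hm.toFinset, m j = 0 := by
  intro j hj
  simpa using hj

theorem series_congr {m m' a a' : ℕ → ℂ} (hma : ∀ k, m k * a k = m' k * a' k) (x : X) :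
    series φ m a x = series φ m' a' x :=
  tsum_congr fun k => by rw [hma]

theorem series_add_left {m m' : ℕ → ℂ} (hm : m.support.Finite) (hm' : m'.support.Finite)
    (a : ℕ → ℂ) (x : X) :
    series φ (fun k => m k + m' k) a x = series φ m a x + series φ m' a x := by
  classical
  have h1 := eq_zero_of_notMem_toFinset hm
  have h2 := eq_zero_of_notMem_toFinset hm'
  set s := hm.toFinset
  set s' := hm'.toFinset
  rw [series_eq_sum (s := s ∪ s') (fun j hj => h1 j fun hh => hj (Finset.mem_union_left _ hh)),
    series_eq_sum (s := s ∪ s') (fun j hj => h2 j fun hh => hj (Finset.mem_union_right _ hh)),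
    series_eq_sum (s := s ∪ s') (m := fun k => m k + m' k) fun j hj => ?_,
    ← Finset.sum_add_distrib]
  · exact Finset.sum_congr rfl fun k _ => by ring
  · rw [h1 j fun hh => hj (Finset.mem_union_left _ hh),
      h2 j fun hh => hj (Finset.mem_union_right _ hh), add_zero]

theorem series_neg_left (m a : ℕ → ℂ) (x : X) :
    series φ (fun k => -m k) a x = -series φ m a x := by
  unfold series
  rw [← tsum_neg]
  exact tsum_congr fun k => by ring

theorem series_add_right {m : ℕ → ℂ} (hm : m.support.Finite) (a a' : ℕ → ℂ) (x : X) :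
    series φ m (fun k => a k + a' k) x = series φ m a x + series φ m a' x := by
  have h1 := eq_zero_of_notMem_toFinset hm
  rw [series_eq_sum h1, series_eq_sum h1, series_eq_sum h1, ← Finset.sum_add_distrib]
  exact Finset.sum_congr rfl fun k _ => by ring

theorem series_sub_right {m : ℕ → ℂ} (hm : m.support.Finite) (a a' : ℕ → ℂ) (x : X) :
    series φ m (fun k => a k - a' k) x = series φ m a x - series φ m a' x := by
  have h1 := eq_zero_of_notMem_toFinset hm
  rw [series_eq_sum h1, series_eq_sum h1, series_eq_sum h1, ← Finset.sum_sub_distrib]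
  exact Finset.sum_congr rfl fun k _ => by ring

theorem IsHeatSystem.continuous_series (H : IsHeatSystem μ α φ ℓ) {m : ℕ → ℂ}
    (hm : m.support.Finite) (a : ℕ → ℂ) : Continuous (series φ m a) := by
  have : series φ m a = fun x => ∑ k ∈ hm.toFinset, m k * a k * (φ k x : ℂ) :=
    funext fun x => series_eq_sum (eq_zero_of_notMem_toFinset hm) a x
  rw [this]
  exact continuous_finsetSum _ fun k _ =>
    continuous_const.mul (Complex.continuous_ofReal.comp (H.phi_continuous k))

theorem series_mem_polySpace {N : ℝ} {m : ℕ → ℂ} (hm : m.support.Finite)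
    (hN : ∀ k, N < ℓ k → m k = 0) (a : ℕ → ℂ) : series φ m a ∈ polySpace φ ℓ N := by
  have : series φ m a = ∑ k ∈ hm.toFinset, (m k * a k) • fun x => (φ k x : ℂ) := by
    funext x
    rw [series_eq_sum (eq_zero_of_notMem_toFinset hm), Finset.sum_apply]
    rfl
  rw [this]
  refine Submodule.sum_mem _ fun k hk => Submodule.smul_mem _ _ (Submodule.subset_span ⟨k, ?_, rfl⟩)
  by_contra hlt
  exact (hm.mem_toFinset.1 hk) (hN k (not_le.1 hlt))

theorem polySpace_mono {N N' : ℝ} (hN : N ≤ N') : polySpace φ ℓ N ≤ polySpace φ ℓ N' :=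
  Submodule.span_mono (Set.image_mono fun _ hj => le_trans hj hN)

theorem integrable_of_continuous {f : X → ℂ} (hf : Continuous f) : Integrable f μ :=
  hf.integrable_of_hasCompactSupport (HasCompactSupport.of_compactSpace f)

theorem memLp_of_continuous {f : X → ℂ} (hf : Continuous f) (p : ℝ≥0∞) : MemLp f p μ :=
  hf.memLp_of_hasCompactSupport (HasCompactSupport.of_compactSpace f)

theorem IsHeatSystem.integrable_mul_phi (H : IsHeatSystem μ α φ ℓ) {f : X → ℂ}
    (hf : Integrable f μ) (k : ℕ) : Integrable (fun x => f x * (φ k x : ℂ)) μ := by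
  obtain ⟨B, -, hB⟩ := exists_phi_bound H k
  refine hf.mul_bdd (c := B)
    (Complex.continuous_ofReal.comp (H.phi_continuous k)).aestronglyMeasurable ?_
  exact Eventually.of_forall fun x => by simpa using hB x

theorem IsHeatSystem.continuous_of_mem_polySpace (H : IsHeatSystem μ α φ ℓ) {N : ℝ} {P : X → ℂ}
    (hP : P ∈ polySpace φ ℓ N) : Continuous P := by
  unfold polySpace at hP
  induction hP using Submodule.span_induction with
  | mem f hf =>
    obtain ⟨j, -, rfl⟩ := hf
    exact Complex.continuous_ofReal.comp (H.phi_continuous j)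
  | zero => exact continuous_const
  | add f g _ _ h1 h2 => exact h1.add h2
  | smul c f _ h1 => exact h1.const_smul c

theorem coeff_congr_ae {f g : X → ℂ} (hfg : f =ᵐ[μ] g) (k : ℕ) :
    coeff μ φ f k = coeff μ φ g k := by
  refine integral_congr_ae ?_
  filter_upwards [hfg] with x hx
  rw [hx]

theorem IsHeatSystem.coeff_sub (H : IsHeatSystem μ α φ ℓ) {f g : X → ℂ} (hf : Integrable f μ)
    (hg : Integrable g μ) (k : ℕ) :
    coeff μ φ (fun x => f x - g x) k = coeff μ φ f k - coeff μ φ g k := by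
  unfold coeff
  rw [← integral_sub (H.integrable_mul_phi hf k) (H.integrable_mul_phi hg k)]
  exact integral_congr_ae (Eventually.of_forall fun x => by simp only; ring)

theorem IsHeatSystem.coeff_add (H : IsHeatSystem μ α φ ℓ) {f g : X → ℂ} (hf : Integrable f μ)
    (hg : Integrable g μ) (k : ℕ) :
    coeff μ φ (fun x => f x + g x) k = coeff μ φ f k + coeff μ φ g k := by
  unfold coeff
  rw [← integral_add (H.integrable_mul_phi hf k) (H.integrable_mul_phi hg k)]
  exact integral_congr_ae (Eventually.of_forall fun x => by simp only; ring)

theorem IsHeatSystem.coeff_series (H : IsHeatSystem μ α φ ℓ) {m : ℕ → ℂ}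
    (hm : m.support.Finite) (a : ℕ → ℂ) (k : ℕ) : coeff μ φ (series φ m a) k = m k * a k := by
  unfold coeff
  have h0 := eq_zero_of_notMem_toFinset hm
  have : ∀ x, series φ m a x * (φ k x : ℂ) =
      ∑ j ∈ hm.toFinset, m j * a j * ((φ j x * φ k x : ℝ) : ℂ) := fun x => by
    rw [series_eq_sum h0, Finset.sum_mul]
    refine Finset.sum_congr rfl fun j _ => ?_
    push_cast
    ring
  simp_rw [this]
  rw [integral_finsetSum]
  · simp_rw [integral_const_mul, integral_complex_ofReal, H.phi_orthonormal]
    by_cases hk : k ∈ hm.toFinset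
    · rw [Finset.sum_eq_single_of_mem k hk fun j _ hj => by simp [hj]]
      simp
    · rw [Finset.sum_eq_zero fun j hj => ?_, h0 k hk, zero_mul]
      have : j ≠ k := fun e => hk (e ▸ hj)
      simp [this]
  · intro j _
    refine Integrable.const_mul (integrable_of_continuous ?_) _
    exact Complex.continuous_ofReal.comp ((H.phi_continuous j).mul (H.phi_continuous k))

theorem IsHeatSystem.series_coeff_series (H : IsHeatSystem μ α φ ℓ) (m : ℕ → ℂ) {m' : ℕ → ℂ}
    (hm' : m'.support.Finite) (a : ℕ → ℂ) (x : X) :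
    series φ m (coeff μ φ (series φ m' a)) x = series φ (fun k => m k * m' k) a x :=
  series_congr (fun k => by rw [H.coeff_series hm' a k, mul_assoc]) x

theorem IsHeatSystem.series_coeff_eq (H : IsHeatSystem μ α φ ℓ) {m : ℕ → ℂ}
    (hm : m.support.Finite) {f : X → ℂ} (hf : Integrable f μ) (x : X) :
    series φ m (coeff μ φ f) x = ∫ y, kern φ m x y * f y ∂μ := by
  have h0 := eq_zero_of_notMem_toFinset hm
  have : ∀ y, kern φ m x y * f y =
      ∑ j ∈ hm.toFinset, m j * (φ j x : ℂ) * (f y * (φ j y : ℂ)) := fun y => by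
    rw [kern_eq_sum h0, Finset.sum_mul]
    exact Finset.sum_congr rfl fun j _ => by ring
  simp_rw [this]
  rw [integral_finsetSum _ fun j _ => (H.integrable_mul_phi hf j).const_mul _, series_eq_sum h0]
  refine Finset.sum_congr rfl fun j _ => ?_
  rw [integral_const_mul, coeff]
  ring

theorem series_dcoeff_eq {m : ℕ → ℂ} (hm : m.support.Finite) (C : Finset X) (w : X → ℝ)
    (f : X → ℂ) (x : X) :
    series φ m (dcoeff φ C w f) x = ∑ y ∈ C, (w y : ℂ) * (kern φ m x y * f y) := by
  have h0 := eq_zero_of_notMem_toFinset hm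
  rw [series_eq_sum h0]
  simp_rw [kern_eq_sum h0, dcoeff, Finset.mul_sum, Finset.sum_mul, Finset.mul_sum]
  rw [Finset.sum_comm]
  exact Finset.sum_congr rfl fun y _ => Finset.sum_congr rfl fun j _ => by ring

/-! ### The spaces `X^p` -/

theorem MemX.congr {p : ℝ≥0∞} {f g : X → ℂ} (hf : MemX μ φ ℓ p f) (hfg : f =ᵐ[μ] g) :
    MemX μ φ ℓ p g := by
  refine ⟨hf.1.ae_eq hfg, fun ε hε => ?_⟩
  obtain ⟨L, P, hP, hle⟩ := hf.2 ε hε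
  refine ⟨L, P, hP, le_of_eq_of_le (eLpNorm_congr_ae ?_) hle⟩
  filter_upwards [hfg] with x hx
  rw [hx]

theorem MemX.of_polySpace (H : IsHeatSystem μ α φ ℓ) {p : ℝ≥0∞} {N : ℝ} {P : X → ℂ}
    (hP : P ∈ polySpace φ ℓ N) : MemX μ φ ℓ p P :=
  ⟨memLp_of_continuous (H.continuous_of_mem_polySpace hP) p, fun ε _ => ⟨N, P, hP, by simp⟩⟩

theorem MemX.series (H : IsHeatSystem μ α φ ℓ) {p : ℝ≥0∞} {m : ℕ → ℂ} (hm : m.support.Finite)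
    (a : ℕ → ℂ) : MemX μ φ ℓ p (series φ m a) := by
  obtain ⟨N, hN⟩ := (hm.image ℓ).bddAbove
  refine MemX.of_polySpace H (N := N) (series_mem_polySpace hm (fun k hk => ?_) a)
  by_contra hne
  exact absurd (hN ⟨k, hne, rfl⟩) (not_le.2 hk)

theorem MemX.integrable {p : ℝ≥0∞} {f : X → ℂ} (hf : MemX μ φ ℓ p f) (hp : 1 ≤ p) :
    Integrable f μ := hf.1.integrable hp

theorem MemX.add (H : IsHeatSystem μ α φ ℓ) {p : ℝ≥0∞} (hp : 1 ≤ p) {f g : X → ℂ}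
    (hf : MemX μ φ ℓ p f) (hg : MemX μ φ ℓ p g) : MemX μ φ ℓ p (fun x => f x + g x) := by
  refine ⟨hf.1.add hg.1, fun ε hε => ?_⟩
  obtain ⟨L, P, hP, hle⟩ := hf.2 (ε / 2) (ENNReal.half_pos hε.ne')
  obtain ⟨L', P', hP', hle'⟩ := hg.2 (ε / 2) (ENNReal.half_pos hε.ne')
  refine ⟨max L L', P + P', Submodule.add_mem _ (polySpace_mono (le_max_left _ _) hP)
    (polySpace_mono (le_max_right _ _) hP'), ?_⟩
  have e : (fun x => f x + g x - (P + P') x) = (fun x => f x - P x) + fun x => g x - P' x := by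
    funext x
    simp only [Pi.add_apply]
    ring
  rw [e]
  refine (eLpNorm_add_le ?_ ?_ hp).trans ?_
  · exact hf.1.1.sub (H.continuous_of_mem_polySpace hP).aestronglyMeasurable
  · exact hg.1.1.sub (H.continuous_of_mem_polySpace hP').aestronglyMeasurable
  · exact (add_le_add hle hle').trans (ENNReal.add_halves ε).le

/-- The space `X^p` is closed in `L^p`. -/
theorem MemX.of_approx (H : IsHeatSystem μ α φ ℓ) {p : ℝ≥0∞} (hp : 1 ≤ p) {f : X → ℂ}
    (hf : MemLp f p μ) (hg : ∀ ε : ℝ≥0∞, 0 < ε →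
      ∃ g, MemX μ φ ℓ p g ∧ eLpNorm (fun x => f x - g x) p μ ≤ ε) : MemX μ φ ℓ p f := by
  refine ⟨hf, fun ε hε => ?_⟩
  obtain ⟨g, hg, hle⟩ := hg (ε / 2) (ENNReal.half_pos hε.ne')
  obtain ⟨L, P, hP, hle'⟩ := hg.2 (ε / 2) (ENNReal.half_pos hε.ne')
  refine ⟨L, P, hP, ?_⟩
  have e : (fun x => f x - P x) = (fun x => f x - g x) + fun x => g x - P x := by
    funext x
    simp
  rw [e]
  refine (eLpNorm_add_le (hf.1.sub hg.1.1) ?_ hp).trans ?_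
  · exact hg.1.1.sub (H.continuous_of_mem_polySpace hP).aestronglyMeasurable
  · exact (add_le_add hle hle').trans (ENNReal.add_halves ε).le

theorem IsHeatSystem.exists_enorm_coeff_le (H : IsHeatSystem μ α φ ℓ) (k : ℕ) :
    ∃ B : ℝ, 0 ≤ B ∧ ∀ f : X → ℂ, ‖coeff μ φ f k‖ₑ ≤ ENNReal.ofReal B * eLpNorm f 1 μ := by
  obtain ⟨B, hB0, hB⟩ := exists_phi_bound H k
  refine ⟨B, hB0, fun f => (enorm_integral_le_lintegral_enorm _).trans ?_⟩
  rw [eLpNorm_one_eq_lintegral_enorm, ← lintegral_const_mul' _ _ ENNReal.ofReal_ne_top]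
  refine lintegral_mono fun x => ?_
  rw [enorm_mul, mul_comm]
  gcongr
  rw [← ofReal_norm, Complex.norm_real]
  exact ENNReal.ofReal_le_ofReal (hB x)

/-- A series of functions in `X^p` whose norms are summable converges to a function in `X^p`, and
the coefficients may be summed termwise. -/
theorem MemX.exists_tsum (H : IsHeatSystem μ α φ ℓ) {p : ℝ≥0∞} (hp : 1 ≤ p) {Q : ℕ → X → ℂ}
    (hQ : ∀ n, MemX μ φ ℓ p (Q n)) (hsum : ∑' n, eLpNorm (Q n) p μ ≠ ⊤) :
    ∃ F : X → ℂ, MemX μ φ ℓ p F ∧ eLpNorm F p μ ≤ ∑' n, eLpNorm (Q n) p μ ∧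
      ∀ k, HasSum (fun n => coeff μ φ (Q n) k) (coeff μ φ F k) := by
  have : Fact (1 ≤ p) := ⟨hp⟩
  set q : ℕ → Lp ℂ p μ := fun n => (hQ n).1.toLp with hq
  have hqe : ∀ n, ‖q n‖ₑ = eLpNorm (Q n) p μ := fun n => Lp.enorm_toLp _
  have hqs : Summable q := by
    refine Summable.of_norm ?_
    have : ∀ n, ‖q n‖ = (eLpNorm (Q n) p μ).toReal := fun n => by
      rw [← hqe, toReal_enorm]
    simp_rw [this]
    exact ENNReal.summable_toReal hsum
  have hmem : ∀ s : Finset ℕ, MemX μ φ ℓ p (∑ n ∈ s, q n : Lp ℂ p μ) := by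
    intro s
    induction s using Finset.cons_induction with
    | empty =>
      rw [Finset.sum_empty]
      exact (MemX.of_polySpace H (N := 0) (Submodule.zero_mem _)).congr (Lp.coeFn_zero ℂ p μ).symm
    | cons n s hn ih =>
      rw [Finset.sum_cons]
      exact (((hQ n).congr (hQ n).1.coeFn_toLp.symm).add H hp ih).congr
        (Lp.coeFn_add (q n) (∑ n ∈ s, q n)).symm
  refine ⟨(∑' n, q n : Lp ℂ p μ), ?_, ?_, fun k => ?_⟩
  · refine MemX.of_approx H hp (Lp.memLp _) fun ε hε => ?_
    have := hqs.hasSum.eventually (Metric.closedEBall_mem_nhds _ hε)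
    obtain ⟨s, hs⟩ := this.exists
    refine ⟨_, hmem s, ?_⟩
    rw [edist_comm, Lp.edist_def] at hs
    exact hs
  · rw [← Lp.enorm_def]
    refine (enorm_tsum_le_tsum_enorm).trans (le_of_eq ?_)
    exact tsum_congr hqe
  · obtain ⟨B, hB0, hB⟩ := H.exists_enorm_coeff_le k
    have hadd : ∀ f g : Lp ℂ p μ, coeff μ φ (f + g : Lp ℂ p μ) k =
        coeff μ φ f k + coeff μ φ g k := fun f g => by
      rw [← H.coeff_add (Lp.memLp f |>.integrable hp) (Lp.memLp g |>.integrable hp)]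
      exact coeff_congr_ae (Lp.coeFn_add f g) k
    let T : Lp ℂ p μ →+ ℂ := AddMonoidHom.mk' (fun f => coeff μ φ f k) hadd
    have hT : Continuous T := by
      refine AddMonoidHomClass.continuous_of_bound T B fun f => ?_
      have h1 : ‖coeff μ φ f k‖ₑ ≤ ENNReal.ofReal B * ‖f‖ₑ := by
        rw [Lp.enorm_def]
        refine (hB f).trans ?_
        gcongr
        exact eLpNorm_le_eLpNorm_of_exponent_le hp (Lp.memLp f).1
      rw [← ofReal_norm, ← ofReal_norm, ← ENNReal.ofReal_mul hB0] at h1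
      exact (ENNReal.ofReal_le_ofReal_iff (by positivity)).1 h1
    refine (hqs.hasSum.map T hT).congr_fun fun n => ?_
    exact coeff_congr_ae (hQ n).1.coeFn_toLp.symm k

/-! ### Weights as discrete measures -/

/-- The total variation measure `∑_{y ∈ C} |w_y| δ_y` of the weights. -/
noncomputable def wMeas {X : Type*} [MeasurableSpace X] (C : Finset X) (w : X → ℝ) : Measure X :=
  ∑ y ∈ C, ENNReal.ofReal |w y| • Measure.dirac y

instance {X : Type*} [MeasurableSpace X] (C : Finset X) (w : X → ℝ) :
    IsFiniteMeasure (wMeas C w) := by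
  refine ⟨?_⟩
  unfold wMeas
  rw [Measure.finsetSum_apply]
  exact ENNReal.sum_lt_top.2 fun y _ => by simp

theorem lintegral_wMeas (C : Finset X) (w : X → ℝ) (g : X → ℝ≥0∞) :
    ∫⁻ y, g y ∂(wMeas C w) = ∑ y ∈ C, ENNReal.ofReal |w y| * g y := by
  unfold wMeas
  rw [lintegral_finsetSum_measure]
  simp

theorem ae_wMeas (C : Finset X) (w : X → ℝ) (P : X → Prop) :
    (∀ᵐ y ∂(wMeas C w), P y) ↔ ∀ y ∈ C, w y ≠ 0 → P y := by
  unfold wMeas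
  rw [ae_finsetSum_measure_iff]
  refine forall₂_congr fun y _ => ?_
  by_cases hy : w y = 0
  · simp [hy]
  · rw [Measure.ae_ennreal_smul_measure_iff (by simpa using hy), ae_dirac_eq]
    simp [hy]

theorem aemeasurable_wMeas (C : Finset X) (w : X → ℝ) (f : X → ℂ) :
    AEMeasurable f (wMeas C w) := by
  unfold wMeas
  induction C using Finset.cons_induction with
  | empty => simp
  | cons y C hy ih =>
    rw [Finset.sum_cons]
    exact (aemeasurable_dirac.smul_measure _).add_measure ih

/-- The balls of radius `r` have `ν`-measure at most `K (r^α + d^α)`. -/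
def IsRegularMeas {X : Type*} [MetricSpace X] [MeasurableSpace X] (α K d : ℝ) (ν : Measure X) :
    Prop :=
  ∀ (x : X) (r : ℝ), 0 < r → ν (Metric.closedBall x r) ≤ ENNReal.ofReal (K * (r ^ α + d ^ α))

/-- Regularity of the weights in terms of powers of the radius only, through the upper
regularity of `μ`. -/
theorem exists_isRegularMeas_wMeas (H : IsHeatSystem μ α φ ℓ) (κ : ℝ) : ∃ K : ℝ, 0 ≤ K ∧
    ∀ (d : ℝ), 0 ≤ d → ∀ (C : Finset X) (w : X → ℝ), IsRegularWeights μ α κ d C w →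
      IsRegularMeas α K d (wMeas C w) := by
  obtain ⟨c, hc, hball⟩ := H.ball_le
  refine ⟨|κ| * max c 1, by positivity, fun d hd C w hw x r hr => ?_⟩
  classical
  have h1 : wMeas C w (Metric.closedBall x r) =
      ENNReal.ofReal (∑ y ∈ C with dist y x ≤ r, |w y|) := by
    rw [← lintegral_indicator_one Metric.isClosed_closedBall.measurableSet, lintegral_wMeas,
      ENNReal.ofReal_sum_of_nonneg fun _ _ => abs_nonneg _, Finset.sum_filter]
    refine Finset.sum_congr rfl fun y _ => ?_
    by_cases hy : dist y x ≤ r <;> simp [Set.indicator, hy]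
  rw [h1]
  refine ENNReal.ofReal_le_ofReal ((hw x r hr).trans ?_)
  have h2 := hball x r hr
  have h3 : 0 ≤ μ.real (Metric.closedBall x r) := measureReal_nonneg
  have h4 : 0 ≤ r ^ α := by positivity
  have h5 : 0 ≤ d ^ α := by positivity
  calc _ ≤ |κ| * (μ.real (Metric.closedBall x r) + d ^ α) := by
        gcongr
        exact le_abs_self κ
    _ ≤ |κ| * (max c 1 * (r ^ α + d ^ α)) := by
        gcongr
        have h6 : c * r ^ α ≤ max c 1 * r ^ α := by gcongr; exact le_max_left _ _
        have h7 : 1 * d ^ α ≤ max c 1 * d ^ α := by gcongr; exact le_max_right _ _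
        linarith
    _ = _ := by ring

/-- The norm of `L^p(wMeas C w)` is at most the discrete norm of the samples. -/
theorem eLpNorm_wMeas_le (C : Finset X) (w : X → ℝ) (f : X → ℂ) {p : ℝ≥0∞} (hp : 1 ≤ p) :
    eLpNorm f p (wMeas C w) ≤ discNorm p C w f := by
  unfold discNorm
  split_ifs with hpt
  · rw [hpt, eLpNorm_exponent_top]
    refine eLpNormEssSup_le_of_ae_enorm_bound ((ae_wMeas C w _).2 fun y hy hwy => ?_)
    exact le_iSup₂_of_le y hy (le_iSup_of_le hwy le_rfl)
  · rw [eLpNorm_eq_lintegral_rpow_enorm_toReal (zero_lt_one.trans_le hp).ne' hpt, lintegral_wMeas]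
    refine le_of_eq ?_
    congr 1
    refine Finset.sum_congr rfl fun y _ => ?_
    rw [← Real.norm_eq_abs, ofReal_norm]

theorem enorm_series_dcoeff_le {m : ℕ → ℂ} (hm : m.support.Finite) (C : Finset X) (w : X → ℝ)
    (f : X → ℂ) (x : X) :
    ‖series φ m (dcoeff φ C w f) x‖ₑ ≤ ∫⁻ y, ‖kern φ m x y‖ₑ * ‖f y‖ₑ ∂(wMeas C w) := by
  rw [series_dcoeff_eq hm, lintegral_wMeas]
  refine (enorm_sum_le _ _).trans (Finset.sum_le_sum fun y _ => ?_)
  rw [enorm_mul, enorm_mul, ← ofReal_norm (w y : ℂ), Complex.norm_real, Real.norm_eq_abs]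

theorem IsHeatSystem.enorm_series_coeff_le (H : IsHeatSystem μ α φ ℓ) {m : ℕ → ℂ}
    (hm : m.support.Finite) {f : X → ℂ} (hf : Integrable f μ) (x : X) :
    ‖series φ m (coeff μ φ f) x‖ₑ ≤ ∫⁻ y, ‖kern φ m x y‖ₑ * ‖f y‖ₑ ∂μ := by
  rw [H.series_coeff_eq hm hf]
  refine (enorm_integral_le_lintegral_enorm _).trans (le_of_eq ?_)
  simp_rw [enorm_mul]

/-- Kernel norms bound the `L^p` operator norms of multipliers. -/
theorem IsHeatSystem.eLpNorm_series_coeff_le (H : IsHeatSystem μ α φ ℓ) {m : ℕ → ℂ}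
    (hm : m.support.Finite) {f : X → ℂ} {p : ℝ≥0∞} (hp : 1 ≤ p) (hf : MemLp f p μ) :
    eLpNorm (series φ m (coeff μ φ f)) p μ ≤ knorm μ φ m * eLpNorm f p μ := by
  have hfi : Integrable f μ := hf.integrable hp
  have h1 := eLpNorm_le_of_kernel (μ' := μ) (ν := μ) (measurable_kern H (adm_of_finite hm))
    (A := knorm μ φ m) (B := knorm μ φ m) (fun x => lintegral_kern_le_knorm m x)
    (fun y => by simpa only [kern_comm m _ y] using lintegral_kern_le_knorm m y)
    hf.1.aemeasurable (H.enorm_series_coeff_le hm hfi) hp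
  refine h1.trans_eq ?_
  congr 1
  have h2 : (p⁻¹).toReal ≤ 1 := by
    rw [← ENNReal.toReal_one]
    exact ENNReal.toReal_mono ENNReal.one_ne_top (ENNReal.inv_le_one.2 hp)
  rw [← ENNReal.rpow_add_of_nonneg _ _ (by linarith) ENNReal.toReal_nonneg, sub_add_cancel,
    ENNReal.rpow_one]

/-- A multiplier carried by the frequencies below `2^n` is integrated against a measure that is
regular at scale `d` as if against `μ`, up to the factor `1 + (2^n d)^α`: it reproduces itself
under convolution with the heat kernel of that scale, up to a multiplier of bounded norm. -/
theorem IsHeatSystem.exists_lintegral_kern_le (H : IsHeatSystem μ α φ ℓ) (hh : IsFilter h) :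
    ∃ C : ℝ, 0 ≤ C ∧ ∀ (n : ℕ) (m : ℕ → ℂ), m.support.Finite → (∀ j, 2 ^ n < ℓ j → m j = 0) →
      ∀ (ν : Measure X) [SFinite ν] (K d : ℝ), 0 ≤ K → 0 ≤ d → IsRegularMeas α K d ν →
      ∀ x, ∫⁻ y, ‖kern φ m x y‖ₑ ∂ν ≤
        knorm μ φ m * ENNReal.ofReal (C * K * (1 + ((2 : ℝ) ^ n * d) ^ α)) := by
  obtain ⟨C₁, hC₁⟩ := H.exists_knorm_filter_heat_le hh 1
  obtain ⟨M, hM, hheat⟩ := H.lintegral_heat_weighted_le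
  have hα := H.alpha_pos
  refine ⟨max C₁ 0 * (M * 2 ^ α), by positivity, fun n m hm hm0 ν _ K d hK hd hν x => ?_⟩
  set N : ℝ := 2 ^ (n + 1) with hN
  have hN1 : 1 ≤ N := one_le_pow₀ (by norm_num)
  set e : ℕ → ℂ := fun j => (h (ℓ j / N) : ℂ) * ((heatSym ℓ (N ^ 2)⁻¹ j)⁻¹ ^ 1 : ℝ) with he
  set q : ℕ → ℂ := fun j => (heatSym ℓ (N ^ 2)⁻¹ j : ℂ) with hq
  have hN0 : 0 < N := by linarith
  have hefin : e.support.Finite := support_filter_finite H hh hN0 _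
  -- `e` inverts the heat symbol `q` at the frequencies that `m` involves, so `m = (m e) q`
  have hmeq : (fun j => m j * e j) = fun j => m j * (q j)⁻¹ := by
    funext j
    by_cases hj : 2 ^ n < ℓ j
    · simp [hm0 j hj]
    · have : h (ℓ j / N) = 1 := by
        refine hh.eq_one_of_le (div_nonneg (H.ell_nonneg j) hN0.le) ?_
        rw [div_le_iff₀ hN0, hN, pow_succ]
        linarith [not_lt.1 hj]
      simp [he, hq, this]
  have hqne : ∀ j, q j ≠ 0 := fun j => by
    simpa [hq] using (heatSym_pos ℓ (N ^ 2)⁻¹ j).ne'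
  have hmm : m = fun j => (m j * e j) * q j := by
    funext j
    rw [congrFun hmeq j, inv_mul_cancel_right₀ (hqne j)]
  have hme : (fun j => m j * e j).support.Finite := support_mul_finite hm
  have hqadm : Adm ℓ q := adm_heatSym (by positivity) (inv_le_one_of_one_le₀ (one_le_pow₀ hN1))
  have hB : ∀ z, ∫⁻ y, ‖kern φ q z y‖ₑ ∂ν ≤
      ENNReal.ofReal (M * K * (1 + (N * d) ^ α)) := fun z => by
    refine le_trans (lintegral_mono fun y => ?_) (hheat ν K d N hK hd hN1 z (hν z))
    refine le_mul_of_one_le_right zero_le ?_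
    rw [ENNReal.one_le_ofReal]
    exact Real.one_le_exp (by positivity)
  have h1 := lintegral_kern_mul_le H (adm_of_finite hme) hqadm ν hB x
  have h2 : knorm μ φ (fun j => m j * e j) ≤ knorm μ φ m * ENNReal.ofReal (max C₁ 0) :=
    (knorm_mul_le H (adm_of_finite hm) (adm_of_finite hefin)).trans (by
      gcongr
      exact (hC₁ N hN1).trans (ENNReal.ofReal_le_ofReal (le_max_left _ _)))
  have h3 : kern φ m x = kern φ (fun j => (m j * e j) * q j) x := by rw [← hmm]
  rw [h3]
  refine h1.trans ((mul_le_mul' h2 le_rfl).trans ?_)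
  rw [mul_assoc, ← ENNReal.ofReal_mul (by positivity)]
  refine mul_le_mul' le_rfl (ENNReal.ofReal_le_ofReal ?_)
  have h4 : (N * d) ^ α = 2 ^ α * ((2 : ℝ) ^ n * d) ^ α := by
    rw [← Real.mul_rpow (by norm_num) (by positivity), hN, pow_succ]
    congr 1
    ring
  have h5 : 1 ≤ (2 : ℝ) ^ α := Real.one_le_rpow (by norm_num) hα.le
  rw [h4]
  have h6 : 1 + 2 ^ α * ((2 : ℝ) ^ n * d) ^ α ≤ 2 ^ α * (1 + ((2 : ℝ) ^ n * d) ^ α) := by linarith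
  calc _ ≤ max C₁ 0 * (M * K * (2 ^ α * (1 + ((2 : ℝ) ^ n * d) ^ α))) := by gcongr
    _ = _ := by ring

theorem inv_toReal_le_one {p : ℝ≥0∞} (hp : 1 ≤ p) : (p⁻¹).toReal ≤ 1 := by
  rw [← ENNReal.toReal_one]
  exact ENNReal.toReal_mono ENNReal.one_ne_top (ENNReal.inv_le_one.2 hp)

/-- Synthesis from weighted samples: the kernel norm of a multiplier carried by the frequencies
below `2^n` bounds it as an operator from the weighted `ℓ^p` space to `L^p`, up to a factor that
depends on the ratio of `2^n` to the resolution of the weights. -/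
theorem IsHeatSystem.exists_eLpNorm_series_dcoeff_le (H : IsHeatSystem μ α φ ℓ) (hh : IsFilter h)
    {p : ℝ≥0∞} (hp : 1 ≤ p) {K : ℝ} (hK : 0 ≤ K) :
    ∃ C₀ : ℝ, 0 ≤ C₀ ∧ ∀ (n : ℕ) (m : ℕ → ℂ), m.support.Finite → (∀ j, 2 ^ n < ℓ j → m j = 0) →
      ∀ (C : Finset X) (w : X → ℝ) (d : ℝ), 0 ≤ d → IsRegularMeas α K d (wMeas C w) →
      ∀ f : X → ℂ, eLpNorm (series φ m (dcoeff φ C w f)) p μ ≤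
        knorm μ φ m * ENNReal.ofReal (C₀ * (1 + ((2 : ℝ) ^ n * d) ^ α) ^ (1 - (p⁻¹).toReal)) *
          eLpNorm f p (wMeas C w) := by
  obtain ⟨C₁, hC₁, hC⟩ := H.exists_lintegral_kern_le hh
  have hθ := inv_toReal_le_one hp
  set θ := 1 - (p⁻¹).toReal with hθd
  have hθ0 : 0 ≤ θ := by linarith
  refine ⟨(C₁ * K) ^ θ, by positivity, fun n m hm hm0 C w d hd hw f => ?_⟩
  have h1 := eLpNorm_le_of_kernel (μ' := μ) (ν := wMeas C w)
    (measurable_kern H (adm_of_finite hm)) (B := knorm μ φ m)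
    (fun x => hC n m hm hm0 (wMeas C w) K d hK hd hw x)
    (fun y => by simpa only [kern_comm m _ y] using lintegral_kern_le_knorm m y)
    (aemeasurable_wMeas C w f) (enorm_series_dcoeff_le hm C w f) hp
  refine h1.trans_eq ?_
  congr 1
  rw [ENNReal.mul_rpow_of_nonneg _ _ hθ0, mul_right_comm,
    ← ENNReal.rpow_add_of_nonneg _ _ hθ0 ENNReal.toReal_nonneg, hθd, sub_add_cancel,
    ENNReal.rpow_one, ENNReal.ofReal_rpow_of_nonneg (by positivity) (by linarith),
    Real.mul_rpow (by positivity) (by positivity)]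

/-- The range of frequencies that a scale `L ≥ L₀` resolves. -/
theorem IsHeatSystem.exists_eLpNorm_series_dcoeff_le_low (H : IsHeatSystem μ α φ ℓ)
    (hh : IsFilter h) {p : ℝ≥0∞} (hp : 1 ≤ p) {K L₀ : ℝ} (hK : 0 ≤ K) (hL₀ : 0 < L₀) :
    ∃ C₀ : ℝ, 0 ≤ C₀ ∧ ∀ L, L₀ ≤ L → ∀ m : ℕ → ℂ, m.support.Finite →
      (∀ j, 2 * L < ℓ j → m j = 0) →
      ∀ (C : Finset X) (w : X → ℝ), IsRegularMeas α K (1 / L) (wMeas C w) →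
      ∀ f : X → ℂ, eLpNorm (series φ m (dcoeff φ C w f)) p μ ≤
        knorm μ φ m * ENNReal.ofReal C₀ * eLpNorm f p (wMeas C w) := by
  obtain ⟨C₁, hC₁, hC⟩ := H.exists_eLpNorm_series_dcoeff_le hh hp hK
  have hθ := inv_toReal_le_one hp
  have hα := H.alpha_pos
  set θ := 1 - (p⁻¹).toReal with hθd
  have hθ0 : 0 ≤ θ := by linarith
  refine ⟨C₁ * (1 + (max (1 / L₀) 4) ^ α) ^ θ, by positivity,
    fun L hL m hm hm0 C w hw f => ?_⟩
  have hLpos := hL₀.trans_le hL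
  obtain ⟨n, hn1, hn2⟩ := exists_two_pow_near (2 * L)
  refine (hC n m hm (fun j hj => hm0 j (hn1.trans_lt hj)) C w (1 / L) (by positivity) hw f).trans ?_
  have : (2 : ℝ) ^ n * (1 / L) ≤ max (1 / L₀) 4 := by
    rw [mul_one_div, div_le_iff₀ hLpos]
    refine hn2.trans (max_le ?_ ?_)
    · calc (1 : ℝ) = 1 / L₀ * L₀ := by field_simp
        _ ≤ _ := by gcongr; exact le_max_left _ _
    · rw [← mul_assoc]
      gcongr
      exact le_trans (by norm_num) (le_max_right _ _)
  gcongr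

/-- The Marcinkiewicz–Zygmund inequality: weighted samples of a diffusion polynomial are bounded
by its `L^p` norm. -/
theorem IsHeatSystem.exists_eLpNorm_wMeas_le (H : IsHeatSystem μ α φ ℓ) (hh : IsFilter h)
    {p : ℝ≥0∞} (hp : 1 ≤ p) {K L₀ : ℝ} (hK : 0 ≤ K) (hL₀ : 0 < L₀) :
    ∃ C₀ : ℝ, 0 ≤ C₀ ∧ ∀ L, L₀ ≤ L → ∀ (m a : ℕ → ℂ), m.support.Finite →
      (∀ j, L < ℓ j → m j = 0) →
      ∀ (ν : Measure X) [SFinite ν], IsRegularMeas α K (1 / L) ν →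
        eLpNorm (series φ m a) p ν ≤ ENNReal.ofReal C₀ * eLpNorm (series φ m a) p μ := by
  obtain ⟨C₁, hC₁, hC⟩ := H.exists_lintegral_kern_le hh
  obtain ⟨C₂, hC₂, hfil⟩ := H.exists_knorm_filter_le hh
  have hα := H.alpha_pos
  have hθ := inv_toReal_le_one hp
  set R : ℝ := 1 + C₁ * K * (1 + (max (1 / L₀) 4) ^ α) with hR
  have hR1 : 1 ≤ R := by
    rw [hR]
    have : 0 ≤ C₁ * K * (1 + (max (1 / L₀) 4) ^ α) := by positivity
    linarith
  refine ⟨C₂ * R, by positivity, fun L hL m a hm hm0 ν _ hν => ?_⟩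
  have hLpos := hL₀.trans_le hL
  obtain ⟨n, hn1, hn2⟩ := exists_two_pow_near (2 * L)
  have hle : (2 : ℝ) ^ n * (1 / L) ≤ max (1 / L₀) 4 := by
    rw [mul_one_div, div_le_iff₀ hLpos]
    refine hn2.trans (max_le ?_ ?_)
    · calc (1 : ℝ) = 1 / L₀ * L₀ := by field_simp
        _ ≤ _ := by gcongr; exact le_max_left _ _
    · rw [← mul_assoc]
      gcongr
      exact le_trans (by norm_num) (le_max_right _ _)
  have h2n : (0 : ℝ) < 2 ^ n := by positivity
  set g : ℕ → ℂ := fun j => (h (ℓ j / 2 ^ n) : ℂ) with hg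
  have hgfin : g.support.Finite := support_filter_finite' H hh h2n
  have hg0 : ∀ j, (2 : ℝ) ^ n < ℓ j → g j = 0 := fun j hj => by
    simp only [hg, Complex.ofReal_eq_zero]
    exact hh.eq_zero_of_le (by rw [le_div_iff₀ h2n]; linarith)
  have hcont := H.continuous_series hm a
  -- the filter `g` reproduces the polynomial, and its kernel passes Schur's test from `μ` to `ν`
  have hrep : ∀ x, series φ m a x = series φ g (coeff μ φ (series φ m a)) x := fun x => by
    rw [H.series_coeff_series g hm]
    refine series_congr (fun k => ?_) x
    by_cases hk : L < ℓ k
    · simp [hm0 k hk]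
    · have : g k = 1 := by
        simp only [hg]
        rw [hh.eq_one_of_le (div_nonneg (H.ell_nonneg k) h2n.le), Complex.ofReal_one]
        rw [div_le_iff₀ h2n]
        linarith [not_lt.1 hk]
      rw [this, one_mul]
  have hkg : knorm μ φ g ≤ ENNReal.ofReal (C₂ * R) := (hfil _ h2n).trans
    (ENNReal.ofReal_le_ofReal (le_mul_of_one_le_right (by linarith) hR1))
  have h1 := eLpNorm_le_of_kernel (μ' := ν) (ν := μ) (measurable_kern H (adm_of_finite hgfin))
    (A := ENNReal.ofReal (C₂ * R)) (B := ENNReal.ofReal (C₂ * R))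
    (fun x => (lintegral_kern_le_knorm g x).trans hkg)
    (fun y => by
      simp only [kern_comm g _ y]
      refine (hC n g hgfin hg0 ν K (1 / L) hK (by positivity) hν y).trans ?_
      refine (mul_le_mul' (hfil _ h2n) le_rfl).trans ?_
      rw [← ENNReal.ofReal_mul (by linarith)]
      refine ENNReal.ofReal_le_ofReal ?_
      gcongr
      rw [hR]
      have : C₁ * K * (1 + ((2 : ℝ) ^ n * (1 / L)) ^ α) ≤
        C₁ * K * (1 + (max (1 / L₀) 4) ^ α) := by gcongr
      linarith)
    hcont.aemeasurable
    (F := series φ m a)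
    (fun x => by
      rw [hrep x]
      exact H.enorm_series_coeff_le hgfin (integrable_of_continuous hcont) x) hp
  refine h1.trans_eq ?_
  rw [← ENNReal.rpow_add_of_nonneg _ _ (by linarith) ENNReal.toReal_nonneg, sub_add_cancel,
    ENNReal.rpow_one]

/-! ### Quadrature errors for products -/

/-- A continuous function is bounded everywhere by its essential supremum, as `μ` charges all open
sets. -/
theorem IsHeatSystem.enorm_le_eLpNorm_top (H : IsHeatSystem μ α φ ℓ) {f : X → ℂ}
    (hf : Continuous f) (x : X) : ‖f x‖ₑ ≤ eLpNorm f ⊤ μ := by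
  have := H.isOpenPosMeasure
  have hcl : IsClosed {y | ‖f y‖ₑ ≤ eLpNorm f ⊤ μ} :=
    isClosed_le hf.enorm continuous_const
  have hae : {y | ‖f y‖ₑ ≤ eLpNorm f ⊤ μ} =ᵐ[μ] Set.univ := by
    rw [eLpNorm_exponent_top]
    exact eventuallyEq_univ.2 (enorm_ae_le_eLpNormEssSup f μ)
  have := (hcl.ae_eq_univ_iff_eq).1 hae
  exact this.ge (Set.mem_univ x)

theorem eLpNorm_le_of_enorm_le {p : ℝ≥0∞} {F : X → ℂ} (hF : AEStronglyMeasurable F μ) {B : ℝ≥0∞}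
    (hB : ∀ x, ‖F x‖ₑ ≤ B) : eLpNorm F p μ ≤ B :=
  (eLpNorm_le_eLpNorm_of_exponent_le le_top hF).trans (by
    rw [eLpNorm_exponent_top]
    exact eLpNormEssSup_le_of_ae_enorm_bound (Eventually.of_forall hB))

/-- The super-polynomial decay of the product defect, from a fixed scale on. -/
theorem IsHeatSystem.exists_productDefect_le (H : IsHeatSystem μ α φ ℓ) {A : ℝ}
    (hprod : ∀ c : ℝ, 0 < c →
      Tendsto (fun L : ℝ => ENNReal.ofReal (L ^ c) * productDefect μ φ ℓ A L) atTop (𝓝 0))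
    {c L₀ : ℝ} (hc : 0 < c) (hL₀ : 0 < L₀) :
    ∃ C : ℝ, 0 < C ∧ ∀ L, L₀ ≤ L → productDefect μ φ ℓ A L ≤ ENNReal.ofReal (C * L ^ (-c)) := by
  obtain ⟨L₁, hL₁⟩ := eventually_atTop.1 ((hprod c hc).eventually (Iic_mem_nhds zero_lt_one))
  obtain ⟨C, hC1, hC⟩ := H.exists_card_phi_le
  set N := max L₁ 1 with hN
  have hN1 : 1 ≤ N := le_max_right _ _
  have hα := H.alpha_pos
  set B : ℝ := C * N ^ α with hBd
  have hB : 0 ≤ B := by positivity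
  refine ⟨1 + B * B * N ^ c, by positivity, fun L hL => ?_⟩
  have hLpos : 0 < L := hL₀.trans_le hL
  have hLc : 0 < L ^ c := by positivity
  rcases le_total L N with hLN | hLN
  -- below the scale from which the decay is known, the distance to zero is a sufficient bound
  · refine iSup₂_le fun j k => iSup₂_le fun hj hk => ?_
    refine (iInf₂_le 0 (Submodule.zero_mem _)).trans ?_
    have hcont : Continuous fun x : X => (φ j x : ℂ) * (φ k x : ℂ) :=
      (Complex.continuous_ofReal.comp (H.phi_continuous j)).mul
        (Complex.continuous_ofReal.comp (H.phi_continuous k))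
    simp only [Pi.zero_apply, sub_zero]
    refine eLpNorm_le_of_enorm_le hcont.aestronglyMeasurable fun x => ?_
    rw [← ofReal_norm, norm_mul, Complex.norm_real, Complex.norm_real]
    refine ENNReal.ofReal_le_ofReal ?_
    have h1 : ‖φ j x‖ ≤ B := (hC N hN1).2 j (hj.trans hLN) x
    have h2 : ‖φ k x‖ ≤ B := (hC N hN1).2 k (hk.trans hLN) x
    calc _ ≤ B * B := by gcongr
      _ = B * B * L ^ c * L ^ (-c) := by
          rw [mul_assoc (B * B), ← Real.rpow_add hLpos]
          simp
      _ ≤ B * B * N ^ c * L ^ (-c) := by gcongr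
      _ ≤ _ := by
          gcongr
          linarith
  · have h1 : ENNReal.ofReal (L ^ c) * productDefect μ φ ℓ A L ≤ 1 :=
      hL₁ L ((le_max_left _ _).trans hLN)
    have h2 : productDefect μ φ ℓ A L ≤ ENNReal.ofReal (L ^ (-c)) := by
      rw [Real.rpow_neg hLpos.le, ENNReal.ofReal_inv_of_pos hLc,
        ENNReal.le_inv_iff_mul_le, mul_comm]
      exact h1
    refine h2.trans (ENNReal.ofReal_le_ofReal ?_)
    refine le_mul_of_one_le_left (by positivity) ?_
    have : 0 ≤ B * B * N ^ c := by positivity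
    linarith

/-- The total variation of regular weights is bounded, as `X` is a single ball. -/
theorem exists_wMeas_univ_le {K L₀ : ℝ} (hK : 0 ≤ K) (hα : 0 < α) (hL₀ : 0 < L₀)
    [Nonempty X] : ∃ W : ℝ, 0 ≤ W ∧ ∀ L, L₀ ≤ L → ∀ (C : Finset X) (w : X → ℝ),
      IsRegularMeas α K (1 / L) (wMeas C w) → ∑ y ∈ C, |w y| ≤ W := by
  obtain ⟨x⟩ := ‹Nonempty X›
  set r := Metric.diam (Set.univ : Set X) + 1 with hr
  have hr0 : 0 < r := by
    have := Metric.diam_nonneg (s := (Set.univ : Set X))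
    linarith
  refine ⟨K * (r ^ α + (1 / L₀) ^ α), by positivity, fun L hL C w hw => ?_⟩
  have h1 := hw x r hr0
  have h2 : Metric.closedBall x r = Set.univ := by
    refine Set.eq_univ_of_forall fun y => ?_
    have := Metric.dist_le_diam_of_mem isCompact_univ.isBounded (Set.mem_univ y) (Set.mem_univ x)
    rw [Metric.mem_closedBall]
    linarith
  have h3 : wMeas C w Set.univ = ENNReal.ofReal (∑ y ∈ C, |w y|) := by
    rw [← setLIntegral_one, Measure.restrict_univ, lintegral_wMeas,
      ENNReal.ofReal_sum_of_nonneg fun _ _ => abs_nonneg _]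
    simp
  have hLpos : 0 < L := hL₀.trans_le hL
  rw [h2, h3, ENNReal.ofReal_le_ofReal_iff (by positivity)] at h1
  refine h1.trans ?_
  gcongr

/-- Quadrature is nearly exact on products of the orthonormal functions. -/
theorem IsHeatSystem.exists_dcoeff_phi_sub_le (H : IsHeatSystem μ α φ ℓ) {A : ℝ}
    (hprod : ∀ c : ℝ, 0 < c →
      Tendsto (fun L : ℝ => ENNReal.ofReal (L ^ c) * productDefect μ φ ℓ A L) atTop (𝓝 0))
    {c K L₀ : ℝ} (hc : 0 < c) (hK : 0 ≤ K) (hL₀ : 0 < L₀) :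
    ∃ C₀ : ℝ, 0 ≤ C₀ ∧ ∀ L, L₀ ≤ L → ∀ (C : Finset X) (w : X → ℝ),
      IsRegularMeas α K (1 / L) (wMeas C w) → IsQuadrature μ φ ℓ (2 * A * L) C w →
      ∀ j k, ℓ j ≤ 2 * L → ℓ k ≤ 2 * L →
        ‖dcoeff φ C w (fun x => (φ j x : ℂ)) k - coeff μ φ (fun x => (φ j x : ℂ)) k‖ ≤
          C₀ * L ^ (-c) := by
  have : Nonempty X := nonempty_of_isProbabilityMeasure μ
  obtain ⟨C₁, hC₁, hdef⟩ := H.exists_productDefect_le hprod hc (L₀ := 2 * L₀) (by linarith)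
  obtain ⟨W, hW, hWle⟩ := exists_wMeas_univ_le (X := X) hK H.alpha_pos hL₀
  refine ⟨(W + 1) * (2 * C₁ * 2 ^ (-c)), by positivity, fun L hL C w hw hq j k hj hk => ?_⟩
  have hLpos : 0 < L := hL₀.trans_le hL
  set η : ℝ := 2 * C₁ * (2 * L) ^ (-c) with hη
  have hη0 : 0 < η := by positivity
  have h1 : productDefect μ φ ℓ A (2 * L) < ENNReal.ofReal η := by
    refine (hdef (2 * L) (by linarith)).trans_lt ?_
    rw [ENNReal.ofReal_lt_ofReal_iff hη0, hη]
    have : 0 < C₁ * (2 * L) ^ (-c) := by positivity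
    linarith
  have h2 : (⨅ P ∈ polySpace φ ℓ (A * (2 * L)),
      eLpNorm (fun x => (φ j x : ℂ) * (φ k x : ℂ) - P x) ⊤ μ) < ENNReal.ofReal η := by
    refine lt_of_le_of_lt ?_ h1
    exact le_iSup₂_of_le j k (le_iSup₂_of_le hj hk le_rfl)
  obtain ⟨P, hP⟩ := iInf_lt_iff.1 h2
  obtain ⟨hPmem, hPlt⟩ := iInf_lt_iff.1 hP
  have hPc := H.continuous_of_mem_polySpace hPmem
  set g : X → ℂ := fun x => (φ j x : ℂ) * (φ k x : ℂ) with hg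
  have hgc : Continuous g :=
    (Complex.continuous_ofReal.comp (H.phi_continuous j)).mul
      (Complex.continuous_ofReal.comp (H.phi_continuous k))
  have h3 : ∀ x, ‖g x - P x‖ ≤ η := fun x => by
    have := (H.enorm_le_eLpNorm_top (hgc.sub hPc) x).trans hPlt.le
    rwa [← ofReal_norm, ENNReal.ofReal_le_ofReal_iff hη0.le] at this
  have h4 := hq P (by rwa [show 2 * A * L = A * (2 * L) by ring])
  have h5 : dcoeff φ C w (fun x => (φ j x : ℂ)) k - coeff μ φ (fun x => (φ j x : ℂ)) k =
      ∑ y ∈ C, (w y : ℂ) * (g y - P y) - ∫ y, (g y - P y) ∂μ := by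
    rw [integral_sub (integrable_of_continuous hgc) (integrable_of_continuous hPc), h4]
    simp only [dcoeff, coeff, mul_sub, Finset.sum_sub_distrib, mul_assoc, hg]
    ring
  rw [h5]
  calc _ ≤ ‖∑ y ∈ C, (w y : ℂ) * (g y - P y)‖ + ‖∫ y, (g y - P y) ∂μ‖ := norm_sub_le _ _
    _ ≤ W * η + η := by
        gcongr
        · refine (norm_sum_le _ _).trans ?_
          calc _ ≤ ∑ y ∈ C, |w y| * η := by
                refine Finset.sum_le_sum fun y _ => ?_
                rw [norm_mul, Complex.norm_real, Real.norm_eq_abs]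
                gcongr
                exact h3 y
            _ = (∑ y ∈ C, |w y|) * η := by rw [Finset.sum_mul]
            _ ≤ _ := by gcongr; exact hWle L hL C w hw
        · refine (norm_integral_le_of_norm_le_const (Eventually.of_forall h3)).trans ?_
          simp
    _ = _ := by
        rw [hη, Real.mul_rpow (by norm_num) hLpos.le]
        ring

/-- Quadrature nearly reproduces the coefficients of a diffusion polynomial of degree `L` up to
degree `2L`. The crude polynomial bounds on the number and the size of the `φ_j` are absorbed by
the super-polynomial decay of the product defect. -/
theorem IsHeatSystem.exists_enorm_series_error_le (H : IsHeatSystem μ α φ ℓ) {A : ℝ}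
    (hprod : ∀ c : ℝ, 0 < c →
      Tendsto (fun L : ℝ => ENNReal.ofReal (L ^ c) * productDefect μ φ ℓ A L) atTop (𝓝 0))
    {c K L₀ : ℝ} (hc : 0 < c) (hK : 0 ≤ K) (hL₀ : 0 < L₀) :
    ∃ C₀ : ℝ, 0 ≤ C₀ ∧ ∀ L, L₀ ≤ L → ∀ (C : Finset X) (w : X → ℝ),
      IsRegularMeas α K (1 / L) (wMeas C w) → IsQuadrature μ φ ℓ (2 * A * L) C w →
      ∀ (m a : ℕ → ℂ), m.support.Finite → (∀ j, L < ℓ j → m j = 0) →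
      ∀ (e : ℕ → ℂ) (M : ℝ), 0 ≤ M → (∀ j, 2 * L < ℓ j → e j = 0) → (∀ j, ‖e j‖ ≤ M) →
      ∀ x, ‖series φ e (fun k => dcoeff φ C w (series φ m a) k - coeff μ φ (series φ m a) k) x‖ₑ ≤
          ENNReal.ofReal (C₀ * M * L ^ (-c)) * eLpNorm (series φ m a) 1 μ := by
  have hα := H.alpha_pos
  obtain ⟨C₁, hC₁, hdc⟩ := H.exists_dcoeff_phi_sub_le hprod (c := c + 4 * α) (by positivity) hK hL₀
  obtain ⟨C₂, hC₂, hcard⟩ := H.exists_card_phi_le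
  -- `N = T L` satisfies both `1 ≤ N` and `2L ≤ N`; the four factors `N^α` below come from the number
  -- and the size of the `φ_j`, once each for the coefficients and for the resulting sum
  set T : ℝ := max (1 / L₀) 2 with hT
  have hT0 : 0 < T := lt_of_lt_of_le two_pos (le_max_right _ _)
  refine ⟨(C₂ * T ^ α) ^ 4 * C₁, by positivity,
    fun L hL C w hw hq m a hm hm0 e M hM he heM x => ?_⟩
  have hLpos : 0 < L := hL₀.trans_le hL
  set D := series φ m a with hD
  set N : ℝ := T * L with hN
  have hN2 : 2 * L ≤ N := by
    rw [hN]
    gcongr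
    exact le_max_right _ _
  have hN1 : 1 ≤ N := by
    calc (1 : ℝ) = 1 / L₀ * L₀ := by field_simp
      _ ≤ _ := by rw [hN]; gcongr; exact le_max_left _ _
  set B : ℝ := C₂ * N ^ α with hB
  have hB0 : 0 ≤ B := by positivity
  obtain ⟨hcardN, hphi⟩ := hcard N hN1
  set I : ℝ≥0∞ := eLpNorm D 1 μ with hI
  have hDc := H.continuous_series hm a
  -- the coefficients of `D`
  have hcD : ∀ j, ‖m j * a j‖ₑ ≤ ENNReal.ofReal B * I := by
    intro j
    by_cases hj : L < ℓ j
    · simp [hm0 j hj]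
    rw [← H.coeff_series hm a j, coeff, hI, eLpNorm_one_eq_lintegral_enorm,
      ← lintegral_const_mul' _ _ ENNReal.ofReal_ne_top]
    refine (enorm_integral_le_lintegral_enorm _).trans (lintegral_mono fun y => ?_)
    rw [enorm_mul, mul_comm]
    gcongr
    rw [← ofReal_norm, Complex.norm_real]
    exact ENNReal.ofReal_le_ofReal (hphi j (by linarith [not_lt.1 hj]) y)
  have hexp : ∀ k, dcoeff φ C w D k - coeff μ φ D k = ∑ j ∈ hm.toFinset, m j * a j *
      (dcoeff φ C w (fun x => (φ j x : ℂ)) k - coeff μ φ (fun x => (φ j x : ℂ)) k) := by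
    intro k
    have hs := eq_zero_of_notMem_toFinset hm
    simp_rw [mul_sub, Finset.sum_sub_distrib]
    congr 1
    · simp_rw [dcoeff, Finset.mul_sum]
      rw [Finset.sum_comm]
      refine Finset.sum_congr rfl fun y _ => ?_
      rw [hD, series_eq_sum hs, Finset.mul_sum, Finset.sum_mul]
      exact Finset.sum_congr rfl fun j _ => by ring
    · simp_rw [coeff, ← integral_const_mul]
      rw [← integral_finsetSum]
      · refine integral_congr_ae (Eventually.of_forall fun y => ?_)
        simp only
        rw [hD, series_eq_sum hs, Finset.sum_mul]
        exact Finset.sum_congr rfl fun j _ => by ring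
      · intro j _
        exact (H.integrable_mul_phi (integrable_of_continuous
          (Complex.continuous_ofReal.comp (H.phi_continuous j))) k).const_mul _
  set η : ℝ := C₁ * L ^ (-(c + 4 * α)) with hη
  have hη0 : 0 ≤ η := by positivity
  have herr : ∀ k, ℓ k ≤ 2 * L →
      ‖dcoeff φ C w D k - coeff μ φ D k‖ₑ ≤ ENNReal.ofReal (B * (B * η)) * I := by
    intro k hk
    rw [hexp]
    have hmem : ∀ j ∈ hm.toFinset, ℓ j ≤ L := fun j hj => by
      by_contra hlt
      exact (hm.mem_toFinset.1 hj) (hm0 j (not_le.1 hlt))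
    calc _ ≤ ∑ j ∈ hm.toFinset, ENNReal.ofReal (B * η) * I := by
          refine (enorm_sum_le _ _).trans (Finset.sum_le_sum fun j hj => ?_)
          rw [enorm_mul, ENNReal.ofReal_mul hB0, mul_right_comm]
          refine mul_le_mul' (hcD j) ?_
          rw [← ofReal_norm]
          exact ENNReal.ofReal_le_ofReal
            (hdc L hL C w hw hq j k (by linarith [hmem j hj]) hk)
      _ ≤ ENNReal.ofReal B * (ENNReal.ofReal (B * η) * I) := by
          rw [Finset.sum_const, nsmul_eq_mul]
          refine mul_le_mul' ?_ le_rfl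
          rw [← ENNReal.ofReal_natCast]
          exact ENNReal.ofReal_le_ofReal (hcardN _ fun j hj => by linarith [hmem j hj])
      _ = _ := by rw [← mul_assoc, ← ENNReal.ofReal_mul hB0]
  set s := (H.finite_freq (2 * L)).toFinset with hs
  have hes : ∀ j ∉ s, e j = 0 := fun j hj => he j (by simpa [hs] using hj)
  have hsmem : ∀ j ∈ s, ℓ j ≤ 2 * L := fun j hj => by simpa [hs] using hj
  rw [series_eq_sum hes]
  calc _ ≤ ∑ j ∈ s, ENNReal.ofReal (M * (B * (B * η)) * B) * I := by
        refine (enorm_sum_le _ _).trans (Finset.sum_le_sum fun j hj => ?_)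
        rw [enorm_mul, enorm_mul, ENNReal.ofReal_mul (by positivity),
          ENNReal.ofReal_mul hM, mul_right_comm _ _ I, mul_assoc _ _ I]
        refine mul_le_mul' (mul_le_mul' ?_ (herr j (hsmem j hj))) ?_
        · rw [← ofReal_norm]
          exact ENNReal.ofReal_le_ofReal (heM j)
        · rw [← ofReal_norm, Complex.norm_real]
          exact ENNReal.ofReal_le_ofReal (hphi j ((hsmem j hj).trans hN2) x)
    _ ≤ ENNReal.ofReal B * (ENNReal.ofReal (M * (B * (B * η)) * B) * I) := by
        rw [Finset.sum_const, nsmul_eq_mul]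
        refine mul_le_mul' ?_ le_rfl
        rw [← ENNReal.ofReal_natCast]
        exact ENNReal.ofReal_le_ofReal (hcardN _ fun j hj => (hsmem j hj).trans hN2)
    _ = _ := by
        rw [← mul_assoc, ← ENNReal.ofReal_mul hB0]
        congr 2
        rw [hη, hB, hN, Real.mul_rpow hT0.le hLpos.le, neg_add, Real.rpow_add hLpos,
          Real.rpow_neg hLpos.le (4 * α), mul_comm 4 α, Real.rpow_mul hLpos.le]
        have : L ^ α ≠ 0 := (Real.rpow_pos_of_pos hLpos α).ne'
        rw [show (4 : ℝ) = ((4 : ℕ) : ℝ) by norm_num, Real.rpow_natCast]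
        field_simp

/-! ### Discretization of the kernel -/

/-- The dyadic pieces form a partition of unity; at each frequency the sum is finite. -/
theorem IsHeatSystem.hasSum_piece (H : IsHeatSystem μ α φ ℓ) (hh : IsFilter h) (k : ℕ) :
    HasSum (fun n => piece h n (ℓ k)) 1 := by
  obtain ⟨M, hM⟩ := pow_unbounded_of_one_lt (2 * ℓ k) (one_lt_two)
  have hj := H.ell_nonneg k
  have h1 : ∀ N, M ≤ N → h (ℓ k / 2 ^ N) = 1 := fun N hN => by
    refine hh.eq_one_of_le (by positivity) ?_
    rw [div_le_iff₀ (by positivity)]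
    have : (2 : ℝ) ^ M ≤ 2 ^ N := pow_le_pow_right₀ one_le_two hN
    linarith
  have h2 : ∀ n ∉ Finset.range (M + 1), piece h n (ℓ k) = 0 := fun n hn => by
    obtain ⟨n, rfl⟩ : ∃ n', n = n' + 1 := Nat.exists_eq_succ_of_ne_zero (by
      rintro rfl
      simp at hn)
    have hMn : M ≤ n := by simpa using hn
    rw [piece, h1 _ hMn, h1 _ (hMn.trans n.le_succ), sub_self]
  have h3 : HasSum (fun n => piece h n (ℓ k)) (∑ n ∈ Finset.range (M + 1), piece h n (ℓ k)) :=
    hasSum_sum_of_ne_finset_zero h2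
  rwa [sum_piece, h1 M le_rfl] at h3

/-- For a diffusion polynomial `D` of degree at most `L` and a mask of type `β`, replacing the
integral in the `(s - β)`-order potential of `D` by quadrature costs `O(L^{s-β})`. Up to frequency
`2L` the quadrature is nearly exact; above that range the coefficients of `D` vanish, and the
aliased part is estimated dyadically, where the gain of `s - β` beats the loss of `α/p'` due to
oversampling. -/
theorem IsHeatSystem.exists_discretization (H : IsHeatSystem μ α φ ℓ) (hh : IsFilter h) {A : ℝ}
    (hprod : ∀ c : ℝ, 0 < c →
      Tendsto (fun L : ℝ => ENNReal.ofReal (L ^ c) * productDefect μ φ ℓ A L) atTop (𝓝 0))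
    {S : ℕ} (hS : α < S) {β : ℝ} {b : ℝ → ℝ} (hb : IsMask S β b) {p : ℝ≥0∞} (hp : 1 ≤ p) {s : ℝ}
    (hs : s < β - α * (1 - (p⁻¹).toReal)) {K L₀ : ℝ} (hK : 0 ≤ K) (hL₀ : 0 < L₀) :
    ∃ C₀ : ℝ, 0 ≤ C₀ ∧ ∀ L, L₀ ≤ L → ∀ (C : Finset X) (w : X → ℝ),
      IsRegularMeas α K (1 / L) (wMeas C w) → IsQuadrature μ φ ℓ (2 * A * L) C w →
      ∀ (m a : ℕ → ℂ), m.support.Finite → (∀ j, L < ℓ j → m j = 0) →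
      ∃ F : X → ℂ, MemX μ φ ℓ p F ∧
        eLpNorm F p μ ≤ ENNReal.ofReal (C₀ * L ^ (s - β)) * eLpNorm (series φ m a) p μ ∧
        ∀ k, coeff μ φ F k = ((b (ℓ k) * (1 + ℓ k) ^ s : ℝ) : ℂ) *
          (dcoeff φ C w (series φ m a) k - coeff μ φ (series φ m a) k) := by
  have hα := H.alpha_pos
  have hθ := inv_toReal_le_one hp
  set θ := 1 - (p⁻¹).toReal with hθd
  have hθ0 : 0 ≤ θ := by linarith
  have hsβ : 0 < β - s := by nlinarith [mul_nonneg hα.le hθ0]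
  obtain ⟨CE, hCE, hE⟩ := H.exists_enorm_series_error_le hprod (c := β - s) hsβ hK hL₀
  obtain ⟨CM, hCM, hM⟩ := hb.exists_le
  obtain ⟨CP, hCP, hP⟩ := (hasOrder_mask H hh hS hb s).exists_piece_high H hh
  obtain ⟨CS, hCS, hSyn⟩ := H.exists_eLpNorm_series_dcoeff_le hh hp hK
  obtain ⟨CZ, hCZ, hMZ⟩ := H.exists_eLpNorm_wMeas_le hh hp hK hL₀
  obtain ⟨CT, hCT, hT⟩ := exists_tsum_two_pow_le (s := s - β + α * θ) (by linarith)
  refine ⟨CE * CM + CP * (CS * 2 ^ θ) * CT * CZ, by positivity,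
    fun L hL C w hw hq m a hm hm0 => ?_⟩
  have hLpos : 0 < L := hL₀.trans_le hL
  have h2L : 0 < 2 * L := by linarith
  set D := series φ m a with hD
  have hDc := H.continuous_series hm a
  set I := eLpNorm D p μ with hI
  have hItop : I ≠ ⊤ := (memLp_of_continuous hDc p).2.ne
  set e : ℕ → ℝ := fun k => b (ℓ k) * (1 + ℓ k) ^ s with he
  -- the range where the quadrature is nearly exact
  set g : ℕ → ℂ := fun k => (h (ℓ k / (2 * L)) : ℂ) * (e k : ℂ) with hg
  have hgfin : g.support.Finite := support_filter_finite H hh h2L _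
  set P : X → ℂ := series φ g (fun k => dcoeff φ C w D k - coeff μ φ D k) with hPdef
  have heCM : ∀ k, |e k| ≤ CM := fun k => by
    have h0 := H.ell_nonneg k
    have h1 : (0 : ℝ) < 1 + ℓ k := by linarith
    have h2 := hb.pos h0
    rw [abs_of_nonneg (by positivity)]
    calc e k ≤ CM * (1 + ℓ k) ^ (-β) * (1 + ℓ k) ^ s := by
          simp only [he]
          gcongr
          exact (hM _ h0).1
      _ = CM * (1 + ℓ k) ^ (-β + s) := by rw [mul_assoc, ← Real.rpow_add h1]
      _ ≤ CM * 1 := by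
          gcongr
          exact Real.rpow_le_one_of_one_le_of_nonpos (by linarith) (by linarith)
      _ = CM := mul_one _
  have hPle : eLpNorm P p μ ≤ ENNReal.ofReal (CE * CM * L ^ (s - β)) * I := by
    refine eLpNorm_le_of_enorm_le (H.continuous_series hgfin _).aestronglyMeasurable fun x => ?_
    refine (hE L hL C w hw hq m a hm hm0 g CM hCM (fun j hj => ?_) (fun j => ?_) x).trans ?_
    · simp only [hg]
      rw [hh.eq_zero_of_le (by rw [le_div_iff₀ h2L]; linarith), Complex.ofReal_zero, zero_mul]
    · simp only [hg]
      rw [norm_mul, Complex.norm_real, Complex.norm_real, Real.norm_eq_abs, Real.norm_eq_abs]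
      exact (mul_le_of_le_one_left (abs_nonneg _) (hh.abs_le_one _)).trans (heCM j)
    · rw [neg_sub]
      gcongr
      exact eLpNorm_le_eLpNorm_of_exponent_le hp hDc.aestronglyMeasurable
  -- the dyadic pieces of the range above
  set qm : ℕ → ℕ → ℂ := fun n k => (piece h n (ℓ k) : ℂ) *
    ((e k : ℂ) * (1 - (h (ℓ k / (2 * L)) : ℂ))) with hqm
  have hqfin : ∀ n, (qm n).support.Finite := fun n => support_piece_finite H hh n _
  set Q : ℕ → X → ℂ := fun n => series φ (qm n) (dcoeff φ C w D) with hQ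
  have hQle : ∀ n, eLpNorm (Q n) p μ ≤ ENNReal.ofReal (CP * (CS * 2 ^ θ) * CZ * L ^ (-(α * θ))) * I *
      (if L < 2 ^ n then ENNReal.ofReal (((2 : ℝ) ^ n) ^ (s - β + α * θ)) else 0) := by
    intro n
    have h1 := hSyn n (qm n) (hqfin n) (fun j hj => by
      simp only [hqm]
      rw [piece_eq_zero hh hj.le, Complex.ofReal_zero, zero_mul]) C w (1 / L) (by positivity) hw D
    have h2 := hP (2 * L) n h2L
    rw [mul_div_cancel_left₀ L two_ne_zero] at h2
    have h3 := hMZ L hL m a hm hm0 (wMeas C w) hw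
    refine h1.trans ((mul_le_mul' (mul_le_mul' h2 le_rfl) h3).trans ?_)
    split_ifs with hn
    · have h2n : (0 : ℝ) < 2 ^ n := by positivity
      set x : ℝ := 2 ^ n * (1 / L) with hx
      have hx1 : 1 ≤ x := by
        rw [hx, mul_one_div, le_div_iff₀ hLpos]
        linarith
      have h4 : (1 + x ^ α) ^ θ ≤ 2 ^ θ * (2 ^ n) ^ (α * θ) * L ^ (-(α * θ)) := by
        calc (1 + x ^ α) ^ θ ≤ (2 * x ^ α) ^ θ := by
              refine Real.rpow_le_rpow (by positivity) ?_ hθ0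
              have := Real.one_le_rpow hx1 hα.le
              linarith
          _ = _ := by
              rw [Real.mul_rpow (by norm_num) (by positivity), ← Real.rpow_mul (by positivity), hx,
                Real.mul_rpow (by positivity) (by positivity), one_div,
                Real.inv_rpow hLpos.le, ← Real.rpow_neg hLpos.le, mul_assoc]
      calc _ ≤ ENNReal.ofReal (CP * (2 ^ n) ^ (s - β)) *
            ENNReal.ofReal (CS * (2 ^ θ * (2 ^ n) ^ (α * θ) * L ^ (-(α * θ)))) *
            (ENNReal.ofReal CZ * I) := by gcongr
        _ = ENNReal.ofReal (CP * (CS * 2 ^ θ) * CZ * L ^ (-(α * θ)) *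
            (2 ^ n) ^ (s - β + α * θ)) * I := by
            rw [← mul_assoc, ← ENNReal.ofReal_mul (by positivity),
              ← ENNReal.ofReal_mul (by positivity)]
            congr 2
            rw [Real.rpow_add h2n]
            ring
        _ = _ := by
            rw [ENNReal.ofReal_mul (by positivity), mul_right_comm]
    · simp
  have hQsum : ∑' n, eLpNorm (Q n) p μ ≤
      ENNReal.ofReal (CP * (CS * 2 ^ θ) * CT * CZ * L ^ (s - β)) * I := by
    refine (ENNReal.tsum_le_tsum hQle).trans ?_
    rw [ENNReal.tsum_mul_left]
    refine (mul_le_mul' le_rfl (hT L hLpos)).trans (le_of_eq ?_)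
    rw [mul_right_comm, ← ENNReal.ofReal_mul (by positivity)]
    congr 2
    rw [Real.rpow_add hLpos, Real.rpow_neg hLpos.le]
    have : L ^ (α * θ) ≠ 0 := (Real.rpow_pos_of_pos hLpos _).ne'
    field_simp
  have hQX : ∀ n, MemX μ φ ℓ p (Q n) := fun n => MemX.series H (hqfin n) _
  obtain ⟨F, hFX, hFle, hFc⟩ := MemX.exists_tsum H hp hQX
    (hQsum.trans_lt (ENNReal.mul_lt_top ENNReal.ofReal_lt_top hItop.lt_top)).ne
  have hPX : MemX μ φ ℓ p P := MemX.series H hgfin _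
  refine ⟨fun x => P x + F x, hPX.add H hp hFX, ?_, fun k => ?_⟩
  · refine (eLpNorm_add_le hPX.1.1 hFX.1.1 hp).trans ?_
    refine (add_le_add hPle (hFle.trans hQsum)).trans (le_of_eq ?_)
    rw [← add_mul, ← ENNReal.ofReal_add (by positivity) (by positivity), ← add_mul]
  · rw [H.coeff_add (hPX.integrable hp) (hFX.integrable hp), hPdef, H.coeff_series hgfin]
    have h1 : HasSum (fun n => coeff μ φ (Q n) k)
        (1 * ((e k : ℂ) * (1 - (h (ℓ k / (2 * L)) : ℂ)) * dcoeff φ C w D k)) := by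
      have h2 : HasSum (fun n => (piece h n (ℓ k) : ℂ)) 1 := by
        have := (Complex.hasSum_ofReal).2 (H.hasSum_piece hh k)
        simpa using this
      refine (h2.mul_right _).congr_fun fun n => ?_
      rw [H.coeff_series (hqfin n)]
      simp only [hqm]
      ring
    rw [(hFc k).unique h1]
    -- the exact coefficients vanish where the filter at `2L` differs from one
    have h3 : (1 - (h (ℓ k / (2 * L)) : ℂ)) * coeff μ φ D k = 0 := by
      rw [hD, H.coeff_series hm]
      by_cases hk : L < ℓ k
      · simp [hm0 k hk]
      · rw [hh.eq_one_of_le (div_nonneg (H.ell_nonneg k) h2L.le)]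
        · simp
        · rw [div_le_iff₀ h2L]
          linarith [not_lt.1 hk]
    simp only [hg]
    linear_combination (e k : ℂ) * h3

/-! ### Summability operators and the K-functional -/

/-- The multiplier of `σ_L`. -/
noncomputable def lowPass (h : ℝ → ℝ) (ℓ : ℕ → ℝ) (L : ℝ) (k : ℕ) : ℂ := (h (ℓ k / L) : ℂ)

/-- The multiplier `h(ℓ_k/L) a(ℓ_k)`. -/
noncomputable def lowPassMul (h : ℝ → ℝ) (ℓ : ℕ → ℝ) (L : ℝ) (a : ℝ → ℝ) (k : ℕ) : ℂ :=
  (h (ℓ k / L) : ℂ) * (a (ℓ k) : ℂ)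

theorem lowPass_support (H : IsHeatSystem μ α φ ℓ) (hh : IsFilter h) {L : ℝ} (hL : 0 < L) :
    (lowPass h ℓ L).support.Finite := support_filter_finite' H hh hL

theorem lowPassMul_support (H : IsHeatSystem μ α φ ℓ) (hh : IsFilter h) {L : ℝ} (hL : 0 < L)
    (a : ℝ → ℝ) : (lowPassMul h ℓ L a).support.Finite := support_filter_finite H hh hL _

theorem lowPass_eq_zero (hh : IsFilter h) {L : ℝ} (hL : 0 < L) {k : ℕ} (hk : L < ℓ k) :
    lowPass h ℓ L k = 0 := by
  rw [lowPass, hh.eq_zero_of_le (by rw [le_div_iff₀ hL]; linarith), Complex.ofReal_zero]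

theorem lowPassMul_eq_zero (hh : IsFilter h) {L : ℝ} (hL : 0 < L) (a : ℝ → ℝ) {k : ℕ}
    (hk : L < ℓ k) : lowPassMul h ℓ L a k = 0 := by
  rw [lowPassMul, hh.eq_zero_of_le (by rw [le_div_iff₀ hL]; linarith), Complex.ofReal_zero,
    zero_mul]

theorem lowPass_eq_one (hh : IsFilter h) {L : ℝ} (hL : 0 < L) {k : ℕ} (h0 : 0 ≤ ℓ k)
    (hk : 2 * ℓ k ≤ L) : lowPass h ℓ L k = 1 := by
  rw [lowPass, hh.eq_one_of_le (div_nonneg h0 hL.le), Complex.ofReal_one]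
  rw [div_le_iff₀ hL]
  linarith

/-- The operator `σ_M` reproduces the diffusion polynomials of degree at most `M/2`. -/
theorem IsHeatSystem.series_lowPass_of_mem_polySpace (H : IsHeatSystem μ α φ ℓ) (hh : IsFilter h)
    {N M : ℝ} (hM : 0 < M) (hNM : 2 * N ≤ M) {P : X → ℂ} (hP : P ∈ polySpace φ ℓ N) (x : X) :
    series φ (lowPass h ℓ M) (coeff μ φ P) x = P x := by
  have hfin : (lowPass h ℓ M).support.Finite := lowPass_support H hh hM
  unfold polySpace at hP
  induction hP using Submodule.span_induction with
  | mem f hf =>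
    obtain ⟨j, hj, rfl⟩ := hf
    have hc : ∀ k, coeff μ φ (fun x => (φ j x : ℂ)) k = if j = k then 1 else 0 :=
      integral_phi_mul H j
    unfold series
    simp_rw [hc]
    rw [tsum_eq_single j fun k hk => by simp [hk.symm]]
    rw [lowPass_eq_one hh hM (H.ell_nonneg j)]
    · simp
    · have : ℓ j ≤ N := hj
      linarith
  | zero => simp [series, coeff]
  | add f g hf hg h1 h2 =>
    have hfi : Integrable f μ := integrable_of_continuous (H.continuous_of_mem_polySpace hf)
    have hgi : Integrable g μ := integrable_of_continuous (H.continuous_of_mem_polySpace hg)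
    rw [Pi.add_apply, ← h1, ← h2, ← series_add_right hfin]
    exact series_congr (fun k => by rw [← H.coeff_add hfi hgi]; rfl) x
  | smul c f hf h1 =>
    rw [Pi.smul_apply, ← h1, smul_eq_mul, series, series, ← tsum_mul_left]
    refine tsum_congr fun k => ?_
    have : coeff μ φ (c • f) k = c * coeff μ φ f k := by
      unfold coeff
      rw [← integral_const_mul]
      refine integral_congr_ae (Eventually.of_forall fun y => ?_)
      simp [mul_assoc]
    rw [this]
    ring

theorem IsHeatSystem.exists_eLpNorm_lowPass_le (H : IsHeatSystem μ α φ ℓ) (hh : IsFilter h) :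
    ∃ C : ℝ, 1 ≤ C ∧ ∀ L, 0 < L → ∀ (p : ℝ≥0∞), 1 ≤ p → ∀ f : X → ℂ, MemLp f p μ →
      eLpNorm (series φ (lowPass h ℓ L) (coeff μ φ f)) p μ ≤ ENNReal.ofReal C * eLpNorm f p μ := by
  obtain ⟨C, hC1, hC⟩ := H.exists_knorm_filter_le hh
  refine ⟨C, hC1, fun L hL p hp f hf => ?_⟩
  exact (H.eLpNorm_series_coeff_le (lowPass_support H hh hL) hp hf).trans
    (mul_le_mul' (hC L hL) le_rfl)

/-- `σ_{2^M} f` converges to `f ∈ X^p`. -/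
theorem IsHeatSystem.exists_lowPass_approx (H : IsHeatSystem μ α φ ℓ) (hh : IsFilter h)
    {p : ℝ≥0∞} (hp : 1 ≤ p) {f : X → ℂ} (hf : MemX μ φ ℓ p f) {ε : ℝ≥0∞} (hε : 0 < ε) :
    ∃ M₀ : ℕ, ∀ M, M₀ ≤ M →
      eLpNorm (fun x => f x - series φ (lowPass h ℓ (2 ^ M)) (coeff μ φ f) x) p μ ≤ ε := by
  obtain ⟨C, hC1, hC⟩ := H.exists_eLpNorm_lowPass_le hh
  have hC0 : ENNReal.ofReal (1 + C) ≠ 0 := by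
    rw [Ne, ENNReal.ofReal_eq_zero]
    linarith
  obtain ⟨N, P, hP, hle⟩ := hf.2 (ε / ENNReal.ofReal (1 + C))
    (ENNReal.div_pos hε.ne' ENNReal.ofReal_ne_top)
  obtain ⟨M₀, hM₀⟩ := pow_unbounded_of_one_lt (2 * N) (one_lt_two)
  refine ⟨M₀, fun M hM => ?_⟩
  have h2M : (0 : ℝ) < 2 ^ M := by positivity
  have hNM : 2 * N ≤ 2 ^ M := hM₀.le.trans (pow_le_pow_right₀ one_le_two hM)
  have hfin := lowPass_support H hh h2M
  have hPc := H.continuous_of_mem_polySpace hP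
  have hfP : MemLp (fun x => f x - P x) p μ := hf.1.sub (memLp_of_continuous hPc p)
  have e : (fun x => f x - series φ (lowPass h ℓ (2 ^ M)) (coeff μ φ f) x) =
      (fun x => f x - P x) -
        series φ (lowPass h ℓ (2 ^ M)) (coeff μ φ fun x => f x - P x) := by
    funext x
    have : coeff μ φ (fun x => f x - P x) = fun k => coeff μ φ f k - coeff μ φ P k :=
      funext fun k => H.coeff_sub (hf.integrable hp) (integrable_of_continuous hPc) k
    rw [Pi.sub_apply, this, series_sub_right hfin, H.series_lowPass_of_mem_polySpace hh h2M hNM hP]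
    ring
  rw [e]
  refine (eLpNorm_sub_le hfP.1 (H.continuous_series hfin _).aestronglyMeasurable hp).trans ?_
  refine (add_le_add le_rfl (hC _ h2M p hp _ hfP)).trans ?_
  calc _ = ENNReal.ofReal (1 + C) * eLpNorm (fun x => f x - P x) p μ := by
        rw [ENNReal.ofReal_add zero_le_one (by linarith), ENNReal.ofReal_one, add_mul, one_mul]
    _ ≤ ENNReal.ofReal (1 + C) * (ε / ENNReal.ofReal (1 + C)) := by gcongr
    _ ≤ ε := ENNReal.mul_div_le

/-- To bound a quantity by the K-functional, it suffices to bound it by each competitor. -/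
theorem le_mul_kFunctional {p : ℝ≥0∞} {r δ C : ℝ} (hC : 0 < C) {f : X → ℂ} {B : ℝ≥0∞}
    (hB : ∀ f₁ g : X → ℂ, MemX μ φ ℓ p f₁ → IsDeltaPow μ φ ℓ p r f₁ g →
      B ≤ ENNReal.ofReal C * (eLpNorm (fun x => f x - f₁ x) p μ +
        ENNReal.ofReal (δ ^ r) * eLpNorm g p μ)) :
    B ≤ ENNReal.ofReal C * kFunctional μ φ ℓ p r f δ := by
  have hC0 : ENNReal.ofReal C ≠ 0 := by simpa using hC
  rw [← ENNReal.div_le_iff' hC0 ENNReal.ofReal_ne_top]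
  unfold kFunctional
  refine le_iInf₂ fun f₁ g => le_iInf₂ fun h1 h2 => ?_
  rw [ENNReal.div_le_iff' hC0 ENNReal.ofReal_ne_top]
  exact hB f₁ g h1 h2

/-- The competitor `f₁ = 0`. -/
theorem kFunctional_le (H : IsHeatSystem μ α φ ℓ) {p : ℝ≥0∞} {r δ : ℝ} (f : X → ℂ) :
    kFunctional μ φ ℓ p r f δ ≤ eLpNorm f p μ := by
  have h0 : MemX μ φ ℓ p (0 : X → ℂ) := MemX.of_polySpace H (N := 0) (Submodule.zero_mem _)
  have h1 : IsDeltaPow μ φ ℓ p r 0 0 := ⟨h0, fun k => by simp [coeff]⟩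
  refine (iInf₂_le (0 : X → ℂ) (0 : X → ℂ)).trans ((iInf₂_le h0 h1).trans (le_of_eq ?_))
  rw [eLpNorm_zero, mul_zero, add_zero]
  congr 1
  funext x
  simp

theorem kFunctional_two_mul_le {p : ℝ≥0∞} {r δ : ℝ} (hr : 0 ≤ r) (hδ : 0 ≤ δ) (f : X → ℂ) :
    kFunctional μ φ ℓ p r f (2 * δ) ≤ ENNReal.ofReal (2 ^ r) * kFunctional μ φ ℓ p r f δ := by
  refine le_mul_kFunctional (by positivity) fun f₁ g h1 h2 => ?_
  refine (iInf₂_le f₁ g).trans ((iInf₂_le h1 h2).trans ?_)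
  rw [mul_add, Real.mul_rpow two_pos.le hδ, ENNReal.ofReal_mul (by positivity), mul_assoc]
  gcongr
  refine le_mul_of_one_le_left zero_le ?_
  rw [ENNReal.one_le_ofReal]
  exact Real.one_le_rpow one_le_two hr

/-- The multiplier `a` behaves like a symbol of order `t` at the frequencies below `L ≥ L₀`. -/
def IsLowOrder {X : Type*} [MeasurableSpace X] (μ : Measure X) (φ : ℕ → X → ℝ) (ℓ : ℕ → ℝ)
    (h a : ℝ → ℝ) (t L₀ : ℝ) : Prop :=
  ∃ C : ℝ, 0 ≤ C ∧ ∀ L, L₀ ≤ L → knorm μ φ (lowPassMul h ℓ L a) ≤ ENNReal.ofReal (C * L ^ t) ∧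
    ∀ u, 0 ≤ u → u ≤ L → |a u| ≤ C * L ^ t

theorem one_add_rpow_le {t L₀ L u : ℝ} (ht : 0 ≤ t) (hL₀ : 0 < L₀) (hL : L₀ ≤ L) (hu : 0 ≤ u)
    (huL : u ≤ L) : (1 + u) ^ t ≤ (1 / L₀ + 1) ^ t * L ^ t := by
  have hLpos : 0 < L := hL₀.trans_le hL
  rw [← Real.mul_rpow (by positivity) hLpos.le]
  refine Real.rpow_le_rpow (by linarith) ?_ ht
  have : (1 : ℝ) ≤ 1 / L₀ * L := by
    rw [one_div_mul_eq_div, le_div_iff₀ hL₀]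
    linarith
  linarith

theorem isLowOrder_one (H : IsHeatSystem μ α φ ℓ) (hh : IsFilter h) (L₀ : ℝ) (hL₀ : 0 < L₀) :
    IsLowOrder μ φ ℓ h (fun _ => 1) 0 L₀ := by
  obtain ⟨C, hC1, hC⟩ := H.exists_knorm_filter_le hh
  refine ⟨C, by linarith, fun L hL => ⟨?_, fun u _ _ => ?_⟩⟩
  · have : lowPassMul h ℓ L (fun _ => 1) = fun j => (h (ℓ j / L) : ℂ) :=
      funext fun k => by simp [lowPassMul]
    rw [this, Real.rpow_zero, mul_one]
    exact hC L (hL₀.trans_le hL)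
  · simpa using hC1

theorem isLowOrder_rpow (H : IsHeatSystem μ α φ ℓ) (hh : IsFilter h) {r L₀ : ℝ} (hr : 0 < r)
    (hL₀ : 0 < L₀) : IsLowOrder μ φ ℓ h (fun u => (1 + u) ^ r) r L₀ := by
  obtain ⟨C, hC0, hC⟩ := (hasOrder_rpow H hh r).exists_low H hh hr hL₀
  refine ⟨max C ((1 / L₀ + 1) ^ r), le_max_of_le_left hC0, fun L hL => ⟨?_, fun u hu huL => ?_⟩⟩
  · refine (hC L hL).trans (ENNReal.ofReal_le_ofReal ?_)
    have : 0 ≤ L ^ r := Real.rpow_nonneg (hL₀.le.trans hL) _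
    gcongr
    exact le_max_left _ _
  · rw [abs_of_nonneg (by positivity)]
    refine (one_add_rpow_le hr.le hL₀ hL hu huL).trans ?_
    have : 0 ≤ L ^ r := Real.rpow_nonneg (hL₀.le.trans hL) _
    gcongr
    exact le_max_right _ _

theorem isLowOrder_inv_mask (H : IsHeatSystem μ α φ ℓ) (hh : IsFilter h) {S : ℕ} (hS : α < S)
    {β : ℝ} {b : ℝ → ℝ} (hb : IsMask S β b) (hβ : 0 < β) {L₀ : ℝ} (hL₀ : 0 < L₀) :
    IsLowOrder μ φ ℓ h (fun u => (b u)⁻¹) β L₀ := by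
  have h1 := hasOrder_inv_mask H hh hS hb 0
  rw [zero_add] at h1
  obtain ⟨C, hC0, hC⟩ := h1.exists_low H hh hβ hL₀
  obtain ⟨D, hD0, hD⟩ := hb.exists_le
  refine ⟨max C (D * (1 / L₀ + 1) ^ β), le_max_of_le_left hC0,
    fun L hL => ⟨?_, fun u hu huL => ?_⟩⟩
  · have e : lowPassMul h ℓ L (fun u => (b u)⁻¹) =
        fun j => (h (ℓ j / L) : ℂ) * (((1 + ℓ j) ^ (0 : ℝ) / b (ℓ j) : ℝ) : ℂ) :=
      funext fun k => by simp [lowPassMul]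
    rw [e]
    refine (hC L hL).trans (ENNReal.ofReal_le_ofReal ?_)
    have : 0 ≤ L ^ β := Real.rpow_nonneg (hL₀.le.trans hL) _
    gcongr
    exact le_max_left _ _
  · have hbu := hb.pos hu
    rw [abs_of_nonneg (by positivity)]
    have : 0 ≤ L ^ β := Real.rpow_nonneg (hL₀.le.trans hL) _
    calc (b u)⁻¹ ≤ D * (1 + u) ^ β := (hD u hu).2
      _ ≤ D * ((1 / L₀ + 1) ^ β * L ^ β) := by
          gcongr
          exact one_add_rpow_le hβ.le hL₀ hL hu huL
      _ = D * (1 / L₀ + 1) ^ β * L ^ β := by ring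
      _ ≤ _ := by gcongr; exact le_max_right _ _

/-- The direct estimate `‖f - σ_L f‖_p ≤ C ω_r(p; f, 1/L)`. -/
theorem IsHeatSystem.exists_sub_lowPass_le (H : IsHeatSystem μ α φ ℓ) (hh : IsFilter h)
    {p : ℝ≥0∞} (hp : 1 ≤ p) {r : ℝ} (hr : 0 < r) :
    ∃ C : ℝ, 0 < C ∧ ∀ L, 0 < L → ∀ f : X → ℂ, MemX μ φ ℓ p f →
      eLpNorm (fun x => f x - series φ (lowPass h ℓ L) (coeff μ φ f) x) p μ ≤
        ENNReal.ofReal C * kFunctional μ φ ℓ p r f (1 / L) := by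
  obtain ⟨C₁, hC₁, hlow⟩ := H.exists_eLpNorm_lowPass_le hh
  obtain ⟨C₂, hC₂, hhigh⟩ := (hasOrder_rpow H hh (-r)).exists_high H hh (by linarith)
  refine ⟨1 + C₁ + C₂, by linarith, fun L hL f hf => ?_⟩
  refine le_mul_kFunctional (by linarith) fun f₁ g hf₁ hg => ?_
  refine ENNReal.le_of_forall_pos_le_add fun ε hε _ => ?_
  obtain ⟨M₀, hM₀⟩ := H.exists_lowPass_approx hh hp hf₁ (ε := ε) (by exact_mod_cast hε)
  obtain ⟨M₁, hM₁⟩ := pow_unbounded_of_one_lt (2 * L) (one_lt_two)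
  set M := max M₀ M₁ with hM
  have hLM : 2 * L ≤ 2 ^ M := hM₁.le.trans (pow_le_pow_right₀ one_le_two (le_max_right _ _))
  have h2M : (0 : ℝ) < 2 ^ M := by positivity
  have hAfin := lowPass_support H hh h2M
  have hBfin := lowPass_support H hh hL
  -- for a competitor `f₁` with `g = (Δ*)^r f₁`, the difference `σ_{2^M} f₁ - σ_L f₁` is obtained from
  -- `g` by a high-pass multiplier of order `-r`
  set m : ℕ → ℂ := fun j => ((h (ℓ j / 2 ^ M) : ℂ) - (h (ℓ j / L) : ℂ)) *
    (((1 + ℓ j) ^ (-r) : ℝ) : ℂ) with hm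
  have hmfin : m.support.Finite := by
    refine (hAfin.union hBfin).subset fun j hj => ?_
    by_contra hno
    rw [Set.mem_union, not_or, Function.notMem_support, Function.notMem_support] at hno
    have h1 : (h (ℓ j / 2 ^ M) : ℂ) = 0 := hno.1
    have h2 : (h (ℓ j / L) : ℂ) = 0 := hno.2
    exact hj (by simp only [hm]; rw [h1, h2, sub_zero, zero_mul])
  have hseries : ∀ x, series φ m (coeff μ φ g) x =
      series φ (lowPass h ℓ (2 ^ M)) (coeff μ φ f₁) x -
        series φ (lowPass h ℓ L) (coeff μ φ f₁) x := fun x => by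
    have hneg : (fun k => -lowPass h ℓ L k).support.Finite := by
      refine hBfin.subset fun k hk => ?_
      simpa using hk
    rw [sub_eq_add_neg, ← series_neg_left, ← series_add_left hAfin hneg]
    refine series_congr (fun k => ?_) x
    have h1 : (0 : ℝ) < 1 + ℓ k := by linarith [H.ell_nonneg k]
    have h2 : (((1 + ℓ k) ^ (-r) : ℝ) : ℂ) * (((1 + ℓ k) ^ r : ℝ) : ℂ) = 1 := by
      rw [← Complex.ofReal_mul, ← Real.rpow_add h1]
      simp
    rw [hg.2 k]
    simp only [hm, lowPass]
    linear_combination ((h (ℓ k / 2 ^ M) : ℂ) - (h (ℓ k / L) : ℂ)) * coeff μ φ f₁ k * h2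
  have hsub : MemLp (fun x => f x - f₁ x) p μ := hf.1.sub hf₁.1
  have hcoeff : coeff μ φ (fun x => f x - f₁ x) = fun k => coeff μ φ f k - coeff μ φ f₁ k :=
    funext fun k => H.coeff_sub (hf.integrable hp) (hf₁.integrable hp) k
  set N := eLpNorm (fun x => f x - f₁ x) p μ with hN
  have e : (fun x => f x - series φ (lowPass h ℓ L) (coeff μ φ f) x) =
      (fun x => f x - f₁ x) +
      (fun x => f₁ x - series φ (lowPass h ℓ (2 ^ M)) (coeff μ φ f₁) x) +
      series φ m (coeff μ φ g) - series φ (lowPass h ℓ L) (coeff μ φ fun x => f x - f₁ x) := by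
    funext x
    simp only [Pi.sub_apply, Pi.add_apply, hseries]
    rw [hcoeff, series_sub_right hBfin]
    ring
  have hA : AEStronglyMeasurable
      (fun x => f₁ x - series φ (lowPass h ℓ (2 ^ M)) (coeff μ φ f₁) x) μ :=
    hf₁.1.1.sub (H.continuous_series hAfin _).aestronglyMeasurable
  have hB := (H.continuous_series hmfin (coeff μ φ g)).aestronglyMeasurable (μ := μ)
  have hD := (H.continuous_series hBfin
    (coeff μ φ fun x => f x - f₁ x)).aestronglyMeasurable (μ := μ)
  have b1 := hM₀ M (le_max_left _ _)
  have b2 : eLpNorm (series φ m (coeff μ φ g)) p μ ≤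
      ENNReal.ofReal (C₂ * L ^ (-r)) * eLpNorm g p μ :=
    (H.eLpNorm_series_coeff_le hmfin hp hg.1.1).trans (mul_le_mul' (hhigh L M hL hLM) le_rfl)
  have b3 := hlow L hL p hp _ hsub
  rw [e]
  refine (eLpNorm_sub_le ((hsub.1.add hA).add hB) hD hp).trans ?_
  refine (add_le_add ((eLpNorm_add_le (hsub.1.add hA) hB hp).trans
    (add_le_add (eLpNorm_add_le hsub.1 hA hp) le_rfl)) le_rfl).trans ?_
  refine (add_le_add (add_le_add (add_le_add le_rfl b1) b2) b3).trans ?_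
  have h3 : (1 / L) ^ r = L ^ (-r) := by
    rw [one_div, Real.inv_rpow hL.le, Real.rpow_neg hL.le]
  rw [h3, ENNReal.ofReal_mul hC₂, ENNReal.ofReal_add (by linarith) hC₂,
    ENNReal.ofReal_add zero_le_one (by linarith), ENNReal.ofReal_one]
  set c₁ := ENNReal.ofReal C₁
  set c₂ := ENNReal.ofReal C₂
  set l := ENNReal.ofReal (L ^ (-r))
  set G := eLpNorm g p μ
  calc N + (ε : ℝ≥0∞) + c₂ * l * G + c₁ * N ≤
        N + (ε : ℝ≥0∞) + c₂ * l * G + c₁ * N + (c₂ * N + l * G + c₁ * (l * G)) := le_self_add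
    _ = _ := by ring

/-- Low-pass multipliers of order `t ≥ r` are controlled by the K-functional. -/
theorem IsLowOrder.exists_le_kFunctional (H : IsHeatSystem μ α φ ℓ) (hh : IsFilter h)
    {a : ℝ → ℝ} {t L₀ : ℝ} (hL₀ : 0 < L₀) (ha : IsLowOrder μ φ ℓ h a t L₀) {r : ℝ}
    (ha' : ∃ C : ℝ, 0 ≤ C ∧ ∀ L, L₀ ≤ L →
      knorm μ φ (lowPassMul h ℓ L fun u => (1 + u) ^ (-r) * a u) ≤ ENNReal.ofReal (C * L ^ (t - r)))
    {p : ℝ≥0∞} (hp : 1 ≤ p) :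
    ∃ C : ℝ, 0 < C ∧ ∀ L, L₀ ≤ L → ∀ f : X → ℂ, MemX μ φ ℓ p f →
      eLpNorm (series φ (lowPassMul h ℓ L a) (coeff μ φ f)) p μ ≤
        ENNReal.ofReal (C * L ^ t) * kFunctional μ φ ℓ p r f (1 / L) := by
  obtain ⟨C₁, hC₁, hlow⟩ := ha
  obtain ⟨C₂, hC₂, hlow'⟩ := ha'
  refine ⟨1 + C₁ + C₂, by linarith, fun L hL f hf => ?_⟩
  have hLpos : 0 < L := hL₀.trans_le hL
  refine le_mul_kFunctional (by positivity) fun f₁ g hf₁ hg => ?_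
  have hfin := lowPassMul_support H hh hLpos a
  have hfin' := lowPassMul_support H hh hLpos fun u => (1 + u) ^ (-r) * a u
  have hsub : MemLp (fun x => f x - f₁ x) p μ := hf.1.sub hf₁.1
  have e : series φ (lowPassMul h ℓ L a) (coeff μ φ f) =
      series φ (lowPassMul h ℓ L a) (coeff μ φ fun x => f x - f₁ x) +
        series φ (lowPassMul h ℓ L fun u => (1 + u) ^ (-r) * a u) (coeff μ φ g) := by
    funext x
    have h1 : series φ (lowPassMul h ℓ L fun u => (1 + u) ^ (-r) * a u) (coeff μ φ g) x =
        series φ (lowPassMul h ℓ L a) (coeff μ φ f₁) x := by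
      refine series_congr (fun k => ?_) x
      have h1 : (0 : ℝ) < 1 + ℓ k := by linarith [H.ell_nonneg k]
      have h2 : (((1 + ℓ k) ^ (-r) : ℝ) : ℂ) * (((1 + ℓ k) ^ r : ℝ) : ℂ) = 1 := by
        rw [← Complex.ofReal_mul, ← Real.rpow_add h1]
        simp
      rw [hg.2 k]
      simp only [lowPassMul, Complex.ofReal_mul]
      linear_combination (h (ℓ k / L) : ℂ) * (a (ℓ k) : ℂ) * coeff μ φ f₁ k * h2
    rw [Pi.add_apply, h1, ← series_add_right hfin]
    refine series_congr (fun k => ?_) x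
    rw [H.coeff_sub (hf.integrable hp) (hf₁.integrable hp)]
    ring
  rw [e]
  refine (eLpNorm_add_le (H.continuous_series hfin _).aestronglyMeasurable
    (H.continuous_series hfin' _).aestronglyMeasurable hp).trans ?_
  refine (add_le_add ((H.eLpNorm_series_coeff_le hfin hp hsub).trans
    (mul_le_mul' (hlow L hL).1 le_rfl)) ((H.eLpNorm_series_coeff_le hfin' hp hg.1.1).trans
    (mul_le_mul' (hlow' L hL) le_rfl))).trans ?_
  have h3 : (1 / L) ^ r = L ^ (-r) := by
    rw [one_div, Real.inv_rpow hLpos.le, Real.rpow_neg hLpos.le]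
  rw [h3, mul_add, ← mul_assoc, ← ENNReal.ofReal_mul (by positivity), mul_assoc _ (L ^ t),
    ← Real.rpow_add hLpos, ← sub_eq_add_neg]
  gcongr <;> linarith

/-- Replacing the coefficients by discrete coefficients in a low-pass multiplier of order `t`. The
polynomial `σ_{L/2} f` is subtracted from `f`: on it, the quadrature is nearly exact. -/
theorem IsLowOrder.exists_dcoeff_sub_le (H : IsHeatSystem μ α φ ℓ) (hh : IsFilter h) {A : ℝ}
    (hprod : ∀ c : ℝ, 0 < c →
      Tendsto (fun L : ℝ => ENNReal.ofReal (L ^ c) * productDefect μ φ ℓ A L) atTop (𝓝 0))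
    {a : ℝ → ℝ} {t L₀ : ℝ} (hL₀ : 0 < L₀) (ha : IsLowOrder μ φ ℓ h a t L₀) {r : ℝ} (hr : 0 < r)
    {K : ℝ} (hK : 0 ≤ K) :
    ∃ C₀ : ℝ, 0 < C₀ ∧ ∀ L, L₀ ≤ L → ∀ (C : Finset X) (w : X → ℝ),
      IsRegularMeas α K (1 / L) (wMeas C w) → IsQuadrature μ φ ℓ (2 * A * L) C w →
      ∀ f : X → ℂ, Continuous f →
      eLpNorm (fun x => series φ (lowPassMul h ℓ L a) (dcoeff φ C w f) x -
          series φ (lowPassMul h ℓ (L / 2) a) (coeff μ φ f) x) ⊤ μ ≤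
        ENNReal.ofReal (C₀ * L ^ t) *
          (eLpNorm (fun x => f x - series φ (lowPass h ℓ (L / 2)) (coeff μ φ f) x) ⊤ μ +
            ENNReal.ofReal (L ^ (-r)) * eLpNorm f ⊤ μ) := by
  obtain ⟨C₁, hC₁, hlow⟩ := ha
  obtain ⟨C₂, hC₂, hsyn⟩ := H.exists_eLpNorm_series_dcoeff_le_low hh (p := ⊤) le_top hK hL₀
  obtain ⟨C₃, hC₃, herr⟩ := H.exists_enorm_series_error_le hprod (c := r) hr hK hL₀
  obtain ⟨C₄, hC₄, hlp⟩ := H.exists_eLpNorm_lowPass_le hh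
  refine ⟨1 + C₁ * C₂ + C₃ * C₁ * C₄, by positivity, fun L hL C w hw hq f hf => ?_⟩
  have hLpos : 0 < L := hL₀.trans_le hL
  have hL2 : 0 < L / 2 := by linarith
  have hfin := lowPassMul_support H hh hLpos a
  have hRfin := lowPass_support H hh hL2
  set R := series φ (lowPass h ℓ (L / 2)) (coeff μ φ f) with hR
  have hRc : Continuous R := H.continuous_series hRfin _
  have hfR : Continuous fun x => f x - R x := hf.sub hRc
  have h0 : ∀ k, L < ℓ k → lowPassMul h ℓ L a k = 0 := fun k hk => lowPassMul_eq_zero hh hLpos a hk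
  have e : (fun x => series φ (lowPassMul h ℓ L a) (dcoeff φ C w f) x -
        series φ (lowPassMul h ℓ (L / 2) a) (coeff μ φ f) x) =
      series φ (lowPassMul h ℓ L a) (dcoeff φ C w fun x => f x - R x) +
      series φ (lowPassMul h ℓ L a) (fun k => dcoeff φ C w R k - coeff μ φ R k) := by
    funext x
    have h1 : series φ (lowPassMul h ℓ (L / 2) a) (coeff μ φ f) x =
        series φ (lowPassMul h ℓ L a) (coeff μ φ R) x := by
      refine series_congr (fun k => ?_) x
      rw [hR, H.coeff_series hRfin]
      by_cases hk : L / 2 < ℓ k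
      · rw [lowPassMul_eq_zero hh hL2 a hk, lowPass_eq_zero hh hL2 hk]
        ring
      · have h2 := lowPass_eq_one hh hLpos (H.ell_nonneg k) (by linarith)
        rw [lowPass] at h2
        rw [lowPassMul, lowPassMul, h2, lowPass]
        ring
    rw [h1, Pi.add_apply, ← series_sub_right hfin, ← series_add_right hfin]
    refine series_congr (fun k => ?_) x
    have h2 : dcoeff φ C w (fun x => f x - R x) k = dcoeff φ C w f k - dcoeff φ C w R k := by
      unfold dcoeff
      rw [← Finset.sum_sub_distrib]
      exact Finset.sum_congr rfl fun y _ => by ring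
    rw [h2]
    ring
  rw [e]
  set N := eLpNorm (fun x => f x - R x) ⊤ μ with hN
  have b1 : eLpNorm (series φ (lowPassMul h ℓ L a) (dcoeff φ C w fun x => f x - R x)) ⊤ μ ≤
      ENNReal.ofReal (C₁ * C₂ * L ^ t) * N := by
    refine (hsyn L hL _ hfin (fun j hj => h0 j (by linarith)) C w hw _).trans ?_
    have h1 : eLpNorm (fun x => f x - R x) ⊤ (wMeas C w) ≤ N := by
      rw [eLpNorm_exponent_top]
      exact eLpNormEssSup_le_of_ae_enorm_bound
        (Eventually.of_forall fun x => H.enorm_le_eLpNorm_top hfR x)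
    refine (mul_le_mul' (mul_le_mul' (hlow L hL).1 le_rfl) h1).trans (le_of_eq ?_)
    rw [← ENNReal.ofReal_mul (by positivity)]
    congr 2
    ring
  have b2 : eLpNorm (series φ (lowPassMul h ℓ L a) fun k => dcoeff φ C w R k - coeff μ φ R k) ⊤ μ ≤
      ENNReal.ofReal (C₃ * C₁ * C₄ * L ^ t) * (ENNReal.ofReal (L ^ (-r)) * eLpNorm f ⊤ μ) := by
    refine eLpNorm_le_of_enorm_le (H.continuous_series hfin _).aestronglyMeasurable fun x => ?_
    refine (herr L hL C w hw hq (lowPass h ℓ (L / 2)) (coeff μ φ f) hRfin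
      (fun j hj => lowPass_eq_zero hh hL2 (by linarith)) _ (C₁ * L ^ t) (by positivity)
      (fun j hj => h0 j (by linarith)) (fun j => ?_) x).trans ?_
    · by_cases hj : L < ℓ j
      · rw [h0 j hj, norm_zero]
        positivity
      · rw [lowPassMul, norm_mul, Complex.norm_real, Complex.norm_real, Real.norm_eq_abs,
          Real.norm_eq_abs]
        exact (mul_le_of_le_one_left (abs_nonneg _) (hh.abs_le_one _)).trans
          ((hlow L hL).2 _ (H.ell_nonneg j) (not_lt.1 hj))
    · have h1 : eLpNorm R 1 μ ≤ ENNReal.ofReal C₄ * eLpNorm f ⊤ μ :=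
        (eLpNorm_le_eLpNorm_of_exponent_le le_top hRc.aestronglyMeasurable).trans
          (hlp _ hL2 ⊤ le_top f (memLp_of_continuous hf ⊤))
      refine (mul_le_mul' le_rfl h1).trans (le_of_eq ?_)
      rw [← mul_assoc, ← ENNReal.ofReal_mul (by positivity), ← mul_assoc (ENNReal.ofReal _),
        ← ENNReal.ofReal_mul (by positivity)]
      congr 2
      ring
  refine (eLpNorm_add_le (H.continuous_series hfin _).aestronglyMeasurable
    (H.continuous_series hfin _).aestronglyMeasurable le_top).trans ((add_le_add b1 b2).trans ?_)
  rw [mul_add]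
  have hx : 0 ≤ C₁ * C₂ := by positivity
  have hy : 0 ≤ C₃ * C₁ * C₄ := by positivity
  gcongr <;> linarith

theorem ofReal_mul_rpow_cancel {L : ℝ} (hL : 0 < L) (C t : ℝ) :
    ENNReal.ofReal (L ^ (-t)) * ENNReal.ofReal (C * L ^ t) = ENNReal.ofReal C := by
  rw [← ENNReal.ofReal_mul (by positivity), Real.rpow_neg hL.le]
  congr 1
  have : L ^ t ≠ 0 := (Real.rpow_pos_of_pos hL t).ne'
  field_simp

/-- The hypothesis of `IsLowOrder.exists_le_kFunctional` on the shifted symbol, for the reciprocal of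
a mask. -/
theorem exists_inv_mask_low (H : IsHeatSystem μ α φ ℓ) (hh : IsFilter h) {S : ℕ} (hS : α < S)
    {β : ℝ} {b : ℝ → ℝ} (hb : IsMask S β b) {r : ℝ} (hrβ : r < β) {L₀ : ℝ} (hL₀ : 0 < L₀) :
    ∃ C : ℝ, 0 ≤ C ∧ ∀ L, L₀ ≤ L →
      knorm μ φ (lowPassMul h ℓ L fun u => (1 + u) ^ (-r) * (b u)⁻¹) ≤
        ENNReal.ofReal (C * L ^ (β - r)) := by
  obtain ⟨C, hC0, hC⟩ := (hasOrder_inv_mask H hh hS hb (-r)).exists_low H hh (by linarith) hL₀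
  refine ⟨C, hC0, fun L hL => ?_⟩
  rw [show β - r = -r + β by ring]
  exact hC L hL

/-- The hypothesis of `IsLowOrder.exists_le_kFunctional` on the shifted symbol, for `(1+u)^r`. The
shifted symbol has order zero, so the estimate comes from the boundedness of `σ_L`. -/
theorem exists_rpow_low (H : IsHeatSystem μ α φ ℓ) (hh : IsFilter h) (r : ℝ) {L₀ : ℝ}
    (hL₀ : 0 < L₀) :
    ∃ C : ℝ, 0 ≤ C ∧ ∀ L, L₀ ≤ L →
      knorm μ φ (lowPassMul h ℓ L fun u => (1 + u) ^ (-r) * (1 + u) ^ r) ≤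
        ENNReal.ofReal (C * L ^ (r - r)) := by
  obtain ⟨C, hC1, hC⟩ := H.exists_knorm_filter_le hh
  refine ⟨C, by linarith, fun L hL => ?_⟩
  rw [sub_self, Real.rpow_zero, mul_one]
  have e : (lowPassMul h ℓ L fun u => (1 + u) ^ (-r) * (1 + u) ^ r) =
      fun j => (h (ℓ j / L) : ℂ) := by
    funext k
    have h1 : (0 : ℝ) < 1 + ℓ k := by linarith [H.ell_nonneg k]
    rw [lowPassMul, ← Real.rpow_add h1]
    simp
  rw [e]
  exact hC L (hL₀.trans_le hL)

/-! ### Eignets of diffusion polynomials -/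

theorem IsHeatSystem.derivG_lowPass (H : IsHeatSystem μ α φ ℓ) (hh : IsFilter h) {L : ℝ}
    (hL : 0 < L) (b : ℝ → ℝ) (a : ℕ → ℂ) (x : X) :
    derivG μ φ ℓ b (series φ (lowPass h ℓ L) a) x =
      series φ (lowPassMul h ℓ L fun u => (b u)⁻¹) a x := by
  unfold derivG
  refine tsum_congr fun k => ?_
  rw [H.coeff_series (lowPass_support H hh hL), lowPass, lowPassMul, Complex.ofReal_inv]
  ring

theorem IsKernel.integrable_eignetOp {b : ℝ → ℝ} {G : X → X → ℝ} (hG : IsKernel μ φ ℓ b G)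
    (C : Finset X) (w : X → ℝ) (P : X → ℂ) : Integrable (eignetOp μ φ ℓ b G C w P) μ := by
  unfold eignetOp
  exact integrable_finsetSum _ fun y _ => ((hG y).1.ofReal).const_mul _

theorem IsKernel.coeff_eignetOp (H : IsHeatSystem μ α φ ℓ) {b : ℝ → ℝ} {G : X → X → ℝ}
    (hG : IsKernel μ φ ℓ b G) (C : Finset X) (w : X → ℝ) (P : X → ℂ) (k : ℕ) :
    coeff μ φ (eignetOp μ φ ℓ b G C w P) k =
      (b (ℓ k) : ℂ) * dcoeff φ C w (derivG μ φ ℓ b P) k := by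
  have h1 : ∀ x, eignetOp μ φ ℓ b G C w P x * (φ k x : ℂ) =
      ∑ y ∈ C, (w y : ℂ) * derivG μ φ ℓ b P y * ((G x y : ℂ) * (φ k x : ℂ)) := fun x => by
    rw [eignetOp, Finset.sum_mul]
    exact Finset.sum_congr rfl fun y _ => by ring
  have h2 : ∀ y, ∫ x, (G x y : ℂ) * (φ k x : ℂ) ∂μ = (b (ℓ k) : ℂ) * (φ k y : ℂ) := fun y => by
    simp_rw [← Complex.ofReal_mul]
    rw [integral_complex_ofReal, (hG y).2 k]
  unfold coeff
  simp_rw [h1]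
  rw [integral_finsetSum, dcoeff, Finset.mul_sum]
  · refine Finset.sum_congr rfl fun y _ => ?_
    rw [integral_const_mul, h2]
    ring
  · intro y _
    exact (H.integrable_mul_phi (hG y).1.ofReal k).const_mul _

/-- The eignet of a low-pass polynomial `P` with coefficients `a` differs from `P`, and its
fractional derivative from that of `P`, by what `L^{-β} ‖D_G P‖_p` controls. -/
theorem IsHeatSystem.exists_eignetOp_sub_le (H : IsHeatSystem μ α φ ℓ) (hh : IsFilter h) {A : ℝ}
    (hprod : ∀ c : ℝ, 0 < c →
      Tendsto (fun L : ℝ => ENNReal.ofReal (L ^ c) * productDefect μ φ ℓ A L) atTop (𝓝 0))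
    {S : ℕ} (hS : α < S) {β : ℝ} {b : ℝ → ℝ} (hb : IsMask S β b) {G : X → X → ℝ}
    (hG : IsKernel μ φ ℓ b G) {p : ℝ≥0∞} (hp : 1 ≤ p) {r : ℝ} (hr : 0 < r)
    (hrβ : r < β - α * (1 - (p⁻¹).toReal)) {K L₀ : ℝ} (hK : 0 ≤ K) (hL₀ : 0 < L₀) :
    ∃ C₀ : ℝ, 0 ≤ C₀ ∧ ∀ L, L₀ ≤ L → ∀ (C : Finset X) (w : X → ℝ),
      IsRegularMeas α K (1 / L) (wMeas C w) → IsQuadrature μ φ ℓ (2 * A * L) C w →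
      ∀ (a : ℕ → ℂ) (P Ψ : X → ℂ) (Λ : ℝ≥0∞), P = series φ (lowPass h ℓ L) a →
      Ψ = eignetOp μ φ ℓ b G C w P →
      ENNReal.ofReal (L ^ (-β)) * eLpNorm (series φ (lowPassMul h ℓ L fun u => (b u)⁻¹) a) p μ ≤ Λ →
      MemX μ φ ℓ p Ψ ∧ eLpNorm (fun x => Ψ x - P x) p μ ≤ ENNReal.ofReal C₀ * Λ ∧
      ∃ g : X → ℂ, IsDeltaPow μ φ ℓ p r Ψ g ∧
        ENNReal.ofReal (L ^ (-r)) * eLpNorm g p μ ≤ ENNReal.ofReal C₀ * Λ +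
          ENNReal.ofReal (L ^ (-r)) *
            eLpNorm (series φ (lowPassMul h ℓ L fun u => (1 + u) ^ r) a) p μ := by
  obtain ⟨C₁, hC₁, hdisc0⟩ := H.exists_discretization hh hprod hS hb hp (s := 0) (by linarith) hK hL₀
  obtain ⟨C₂, hC₂, hdiscr⟩ := H.exists_discretization hh hprod hS hb hp hrβ hK hL₀
  refine ⟨max C₁ C₂, le_max_of_le_left hC₁, fun L hL C w hw hq a P Ψ Λ hP hΨ hΛ => ?_⟩
  have hLpos : 0 < L := hL₀.trans_le hL
  set D := series φ (lowPassMul h ℓ L fun u => (b u)⁻¹) a with hD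
  have hfin := lowPassMul_support H hh hLpos fun u => (b u)⁻¹
  have hfinr := lowPassMul_support H hh hLpos fun u => (1 + u) ^ r
  have h0 : ∀ k, L < ℓ k → lowPassMul h ℓ L (fun u => (b u)⁻¹) k = 0 := fun k hk =>
    lowPassMul_eq_zero hh hLpos _ hk
  obtain ⟨F, hFX, hFle, hFc⟩ := hdisc0 L hL C w hw hq _ a hfin h0
  obtain ⟨F', hFX', hFle', hFc'⟩ := hdiscr L hL C w hw hq _ a hfin h0
  rw [← hD] at hFle hFle' hFc hFc'
  have hPX : MemX μ φ ℓ p P := hP ▸ MemX.series H (lowPass_support H hh hLpos) a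
  have hSX : MemX μ φ ℓ p (series φ (lowPassMul h ℓ L fun u => (1 + u) ^ r) a) :=
    MemX.series H hfinr a
  have hderiv : derivG μ φ ℓ b P = D := funext fun x => by
    rw [hP, H.derivG_lowPass hh hLpos]
  have hΨi : Integrable Ψ μ := hΨ ▸ hG.integrable_eignetOp C w P
  have hΨc : ∀ k, coeff μ φ Ψ k = (b (ℓ k) : ℂ) * dcoeff φ C w D k := fun k => by
    rw [hΨ, hG.coeff_eignetOp H, hderiv]
  have hDc : ∀ k, (b (ℓ k) : ℂ) * coeff μ φ D k = (h (ℓ k / L) : ℂ) * a k := fun k => by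
    have : (b (ℓ k) : ℂ) ≠ 0 := Complex.ofReal_ne_zero.2 (hb.pos (H.ell_nonneg k)).ne'
    rw [hD, H.coeff_series hfin, lowPassMul, Complex.ofReal_inv]
    field_simp
  -- both sides are integrable with the same coefficients
  have hae : (fun x => P x + F x) =ᵐ[μ] Ψ := by
    have hi := (hPX.add H hp hFX).integrable hp
    have h1 := H.ae_eq_zero_of_coeff (hi.sub hΨi) fun k => by
      have h2 := H.coeff_sub hi hΨi k
      refine h2.trans ?_
      rw [H.coeff_add (hPX.integrable hp) (hFX.integrable hp), hΨc, hFc, hP,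
        H.coeff_series (lowPass_support H hh hLpos), lowPass, Real.rpow_zero, mul_one]
      linear_combination -(hDc k)
    filter_upwards [h1] with x hx
    simpa [sub_eq_zero] using hx
  have hrate : ∀ s C', 0 ≤ C' → ENNReal.ofReal (C' * L ^ (s - β)) * eLpNorm D p μ ≤
      ENNReal.ofReal (C' * L ^ s) * Λ := fun s C' hC' => by
    refine le_trans (le_of_eq ?_) (mul_le_mul' le_rfl hΛ)
    rw [← mul_assoc, ← ENNReal.ofReal_mul (by positivity), mul_assoc C', ← Real.rpow_add hLpos,
      sub_eq_add_neg]
  refine ⟨(hPX.add H hp hFX).congr hae, ?_, _, ⟨hSX.add H hp hFX', fun k => ?_⟩, ?_⟩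
  · have h1 : eLpNorm (fun x => Ψ x - P x) p μ = eLpNorm F p μ := by
      refine eLpNorm_congr_ae ?_
      filter_upwards [hae] with x hx
      rw [← hx]
      ring
    rw [h1]
    refine (hFle.trans (hrate 0 C₁ hC₁)).trans ?_
    rw [Real.rpow_zero, mul_one]
    gcongr
    exact le_max_left _ _
  · rw [H.coeff_add (hSX.integrable hp) (hFX'.integrable hp), hΨc, hFc', H.coeff_series hfinr,
      lowPassMul, Complex.ofReal_mul]
    linear_combination -(((1 + ℓ k) ^ r : ℝ) : ℂ) * hDc k
  · refine (mul_le_mul' le_rfl (eLpNorm_add_le hSX.1.1 hFX'.1.1 hp)).trans ?_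
    rw [mul_add, add_comm]
    refine add_le_add ?_ le_rfl
    refine (mul_le_mul' le_rfl (hFle'.trans (hrate r C₂ hC₂))).trans ?_
    rw [← mul_assoc, ofReal_mul_rpow_cancel hLpos]
    gcongr
    exact le_max_right _ _

/-- Low-pass multipliers applied to weighted samples of a continuous function. -/
theorem IsLowOrder.exists_dcoeff_le_kFunctional (H : IsHeatSystem μ α φ ℓ) (hh : IsFilter h) {A : ℝ}
    (hprod : ∀ c : ℝ, 0 < c →
      Tendsto (fun L : ℝ => ENNReal.ofReal (L ^ c) * productDefect μ φ ℓ A L) atTop (𝓝 0))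
    {a : ℝ → ℝ} {t L₀ : ℝ} (ht : 0 ≤ t) (hL₀ : 0 < L₀)
    (ha : IsLowOrder μ φ ℓ h a t (L₀ / 2)) {r : ℝ} (hr : 0 < r)
    (ha' : ∃ C : ℝ, 0 ≤ C ∧ ∀ L, L₀ / 2 ≤ L →
      knorm μ φ (lowPassMul h ℓ L fun u => (1 + u) ^ (-r) * a u) ≤ ENNReal.ofReal (C * L ^ (t - r)))
    {K : ℝ} (hK : 0 ≤ K) :
    ∃ C₀ : ℝ, 0 < C₀ ∧ ∀ L, L₀ ≤ L → ∀ (C : Finset X) (w : X → ℝ),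
      IsRegularMeas α K (1 / L) (wMeas C w) → IsQuadrature μ φ ℓ (2 * A * L) C w →
      ∀ f : X → ℂ, Continuous f → MemX μ φ ℓ ⊤ f →
      ENNReal.ofReal (L ^ (-t)) * eLpNorm (series φ (lowPassMul h ℓ L a) (dcoeff φ C w f)) ⊤ μ ≤
        ENNReal.ofReal C₀ * (kFunctional μ φ ℓ ⊤ r f (1 / L) +
          ENNReal.ofReal (L ^ (-r)) * eLpNorm f ⊤ μ) := by
  have hL₀' : 0 < L₀ / 2 := by linarith
  obtain ⟨C₁, hC₁, hsub⟩ := ha.exists_dcoeff_sub_le H hh hprod hL₀' hr hK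
  obtain ⟨C₂, hC₂, hlow⟩ := ha.exists_le_kFunctional H hh hL₀' ha' (p := ⊤) le_top
  obtain ⟨C₃, hC₃, hdir⟩ := H.exists_sub_lowPass_le hh (p := ⊤) le_top hr
  refine ⟨C₁ * (C₃ * 2 ^ r + 1) + C₂ * 2 ^ r, by positivity, fun L hL C w hw hq f hf hfX => ?_⟩
  have hLpos : 0 < L := hL₀.trans_le hL
  have hL2 : 0 < L / 2 := by linarith
  have hfin := lowPassMul_support H hh hLpos a
  have hfin2 := lowPassMul_support H hh hL2 a
  have hc1 := H.continuous_series hfin (dcoeff φ C w f)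
  have hc2 := H.continuous_series hfin2 (coeff μ φ f)
  have h2k : kFunctional μ φ ℓ ⊤ r f (1 / (L / 2)) ≤
      ENNReal.ofReal (2 ^ r) * kFunctional μ φ ℓ ⊤ r f (1 / L) := by
    rw [show 1 / (L / 2) = 2 * (1 / L) by field_simp]
    exact kFunctional_two_mul_le hr.le (by positivity) f
  set κ := kFunctional μ φ ℓ ⊤ r f (1 / L)
  set ν := ENNReal.ofReal (L ^ (-r)) * eLpNorm f ⊤ μ
  have b1 := hsub L (by linarith) C w hw hq f hf
  have b2 := (hdir _ hL2 f hfX).trans (mul_le_mul' le_rfl h2k)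
  have b3 := (hlow _ (by linarith) f hfX).trans (mul_le_mul' le_rfl h2k)
  have e : series φ (lowPassMul h ℓ L a) (dcoeff φ C w f) =
      (fun x => series φ (lowPassMul h ℓ L a) (dcoeff φ C w f) x -
        series φ (lowPassMul h ℓ (L / 2) a) (coeff μ φ f) x) +
      series φ (lowPassMul h ℓ (L / 2) a) (coeff μ φ f) := by
    funext x
    simp
  rw [e]
  have hmono : C₂ * (L / 2) ^ t ≤ C₂ * L ^ t := by
    gcongr
    linarith
  calc _ ≤ ENNReal.ofReal (L ^ (-t)) * (ENNReal.ofReal (C₁ * L ^ t) *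
        (ENNReal.ofReal C₃ * (ENNReal.ofReal (2 ^ r) * κ) + ν) +
        ENNReal.ofReal (C₂ * L ^ t) * (ENNReal.ofReal (2 ^ r) * κ)) := by
        refine mul_le_mul' le_rfl ((eLpNorm_add_le (hc1.sub hc2).aestronglyMeasurable
          hc2.aestronglyMeasurable le_top).trans (add_le_add ?_ ?_))
        · exact b1.trans (mul_le_mul' le_rfl (add_le_add b2 le_rfl))
        · exact b3.trans (mul_le_mul' (ENNReal.ofReal_le_ofReal hmono) le_rfl)
    _ = ENNReal.ofReal C₁ * (ENNReal.ofReal C₃ * (ENNReal.ofReal (2 ^ r) * κ) + ν) +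
        ENNReal.ofReal C₂ * (ENNReal.ofReal (2 ^ r) * κ) := by
        rw [mul_add, ← mul_assoc (ENNReal.ofReal (L ^ (-t))),
          ← mul_assoc (ENNReal.ofReal (L ^ (-t))), ofReal_mul_rpow_cancel hLpos,
          ofReal_mul_rpow_cancel hLpos]
    _ = ENNReal.ofReal (C₁ * (C₃ * 2 ^ r) + C₂ * 2 ^ r) * κ + ENNReal.ofReal C₁ * ν := by
        rw [ENNReal.ofReal_add (by positivity) (by positivity), ENNReal.ofReal_mul hC₁.le,
          ENNReal.ofReal_mul hC₃.le, ENNReal.ofReal_mul hC₂.le]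
        ring
    _ ≤ _ := by
        rw [mul_add]
        have h1 : 0 ≤ C₁ * (C₃ * 2 ^ r) := by positivity
        have h2 : 0 ≤ C₂ * 2 ^ r := by positivity
        gcongr <;> nlinarith

/-- A finite set whose separation is comparable to `1/L` forces `L` to be bounded below, since the
separation cannot exceed the diameter. -/
theorem exists_le_of_comparableToSeparation (X : Type*) [MetricSpace X] [CompactSpace X] (κ : ℝ) :
    ∃ L₀ : ℝ, 0 < L₀ ∧ ∀ (L : ℝ) (C : Finset X), 0 < L → ComparableToSeparation κ C L →
      L₀ ≤ L := by
  set Δ := Metric.diam (Set.univ : Set X) + 1 with hΔ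
  have hΔ0 : 0 < Δ := by
    have := Metric.diam_nonneg (s := (Set.univ : Set X))
    linarith
  refine ⟨1 / (Δ * (|κ| + 1)), by positivity, fun L C hL hC => ?_⟩
  have hne : Set.einfsep (C : Set X) ≠ ⊤ := by
    intro htop
    have h1 := hC.1
    rw [htop, ENNReal.inv_top, mul_zero, nonpos_iff_eq_zero, ENNReal.ofReal_eq_zero] at h1
    linarith
  have hns : ¬ (C : Set X).Subsingleton := fun hs => hne hs.einfsep
  obtain ⟨x, hx, y, hy, hxy⟩ := Set.not_subsingleton_iff.1 hns
  have h1 : Set.einfsep (C : Set X) ≤ ENNReal.ofReal Δ := by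
    refine (Set.einfsep_le_edist_of_mem hx hy hxy).trans ?_
    rw [edist_dist]
    refine ENNReal.ofReal_le_ofReal ?_
    have := Metric.dist_le_diam_of_mem isCompact_univ.isBounded (Set.mem_univ x) (Set.mem_univ y)
    linarith
  have h2 : (ENNReal.ofReal Δ)⁻¹ ≤ ENNReal.ofReal ((|κ| + 1) * L) := by
    refine (ENNReal.inv_le_inv.2 h1).trans (hC.2.trans ?_)
    rw [ENNReal.ofReal_mul (by positivity)]
    gcongr
    linarith [le_abs_self κ]
  rw [← ENNReal.ofReal_inv_of_pos hΔ0, ENNReal.ofReal_le_ofReal_iff (by positivity)] at h2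
  rw [div_le_iff₀ (by positivity)]
  rw [inv_le_iff_one_le_mul₀ hΔ0] at h2
  linarith

end Eignet

/-! ### Approximation by eignets -/

theorem theorem3p2
    {E : Type*} [NormedAddCommGroup E] [NormedSpace ℝ E] [FiniteDimensional ℝ E]
    {X : Type*} [MetricSpace X] [ChartedSpace E X]
    [IsManifold 𝓘(ℝ, E) ((⊤ : ℕ∞) : WithTop ℕ∞) X]
    [RiemannianBundle (fun x : X => TangentSpace 𝓘(ℝ, E) x)]
    [IsContMDiffRiemannianBundle 𝓘(ℝ, E) ((⊤ : ℕ∞) : WithTop ℕ∞) E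
      (fun x : X => TangentSpace 𝓘(ℝ, E) x)]
    [IsRiemannianManifold 𝓘(ℝ, E) X] [CompactSpace X] [ConnectedSpace X]
    [MeasurableSpace X] [BorelSpace X] (μ : Measure X) [IsProbabilityMeasure μ]
    (α : ℝ) (φ : ℕ → X → ℝ) (ℓ : ℕ → ℝ) (A : ℝ)
    (hsys : Eignet.IsDiffusionSystem E μ α φ ℓ A)
    (h : ℝ → ℝ) (hh : Eignet.IsFilter h)
    (S : ℕ) (hS : α < S) (β : ℝ) (b : ℝ → ℝ) (hb : Eignet.IsMask S β b)
    (G : X → X → ℝ) (hG : Eignet.IsKernel μ φ ℓ b G)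
    (p : ℝ≥0∞) (hp : 1 ≤ p) (hβ : α * (1 - (p⁻¹).toReal) < β)
    (r : ℝ) (hr : 0 < r) (hrβ : r < β - α * (1 - (p⁻¹).toReal))
    -- the constants in `L ~ q(C*)⁻¹` and in the regularity of the weights
    (κ₁ κ₂ : ℝ) :
    ∃ c : ℝ, 0 < c ∧ ∀ (L : ℝ) (Cs : Finset X) (ws : X → ℝ), 0 < L →
      Eignet.IsQuasiUniform Cs → Eignet.ComparableToSeparation κ₁ Cs L →
      Eignet.IsRegularWeights μ α κ₂ (1 / L) Cs ws →
      Eignet.IsQuadrature μ φ ℓ (2 * A * L) Cs ws →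
      -- part (a)
      (∀ f : X → ℂ, Eignet.MemX μ φ ℓ p f →
        let Ψ := Eignet.eignetOp μ φ ℓ b G Cs ws (Eignet.sigma μ φ ℓ h L f)
        Eignet.MemX μ φ ℓ p Ψ ∧
        (∃ g : X → ℂ, Eignet.IsDeltaPow μ φ ℓ p r Ψ g ∧
          eLpNorm (fun x => f x - Ψ x) p μ + ENNReal.ofReal (L ^ (-r)) * eLpNorm g p μ ≤
            ENNReal.ofReal c * Eignet.kFunctional μ φ ℓ p r f (1 / L)) ∧
        eLpNorm Ψ p μ ≤ ENNReal.ofReal c * eLpNorm f p μ) ∧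
      -- part (b)
      (∀ (C : Finset X) (w : X → ℝ), Eignet.IsQuasiUniform C →
        Eignet.IsRegularWeights μ α κ₂ (1 / L) C w →
        Eignet.IsQuadrature μ φ ℓ (2 * A * L) C w →
        (∀ f : X → ℂ,
          let Ψ := Eignet.eignetOp μ φ ℓ b G Cs ws (Eignet.discSigma φ ℓ h L C w f)
          Eignet.MemX μ φ ℓ p Ψ ∧
          eLpNorm Ψ p μ ≤ ENNReal.ofReal c * Eignet.discNorm p C w f) ∧
        (p = ⊤ → ∀ f : X → ℂ, Continuous f → Eignet.MemX μ φ ℓ ⊤ f →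
          let Ψ := Eignet.eignetOp μ φ ℓ b G Cs ws (Eignet.discSigma φ ℓ h L C w f)
          ∃ g : X → ℂ, Eignet.IsDeltaPow μ φ ℓ ⊤ r Ψ g ∧
            eLpNorm (fun x => f x - Ψ x) ⊤ μ + ENNReal.ofReal (L ^ (-r)) * eLpNorm g ⊤ μ ≤
              ENNReal.ofReal c * (Eignet.kFunctional μ φ ℓ ⊤ r f (1 / L) +
                ENNReal.ofReal (L ^ (-r)) * eLpNorm f ⊤ μ))) := by
  open Eignet in
  have H := hsys.isHeatSystem
  have hprod := hsys.product
  have hα := H.alpha_pos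
  have hrβ' : r < β := by
    have := mul_nonneg hα.le (sub_nonneg.2 (inv_toReal_le_one hp))
    linarith
  have hβ0 : 0 < β := hr.trans hrβ'
  -- a lower bound for `L`, which makes the constants below uniform; `L₀ / 2` serves `σ_{L/2}`
  obtain ⟨L₀, hL₀, hLle⟩ := exists_le_of_comparableToSeparation X κ₁
  obtain ⟨K, hK, hreg⟩ := exists_isRegularMeas_wMeas H κ₂
  have hL₀' : 0 < L₀ / 2 := by linarith
  have oI := isLowOrder_inv_mask H hh hS hb hβ0 hL₀'
  have oI' := exists_inv_mask_low H hh hS hb hrβ' hL₀'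
  have oR := isLowOrder_rpow H hh hr hL₀'
  have oR' := exists_rpow_low H hh r hL₀'
  have oO := isLowOrder_one H hh (L₀ / 2) hL₀'
  obtain ⟨C₀, hC₀, hcore⟩ := H.exists_eignetOp_sub_le hh hprod hS hb hG hp hr hrβ hK hL₀
  obtain ⟨C₁, hC₁, hdir⟩ := H.exists_sub_lowPass_le hh hp hr
  obtain ⟨C₂, hC₂, hI⟩ := oI.exists_le_kFunctional H hh hL₀' oI' hp
  obtain ⟨C₃, hC₃, hR⟩ := oR.exists_le_kFunctional H hh hL₀' oR' hp
  obtain ⟨C₄, hC₄, hsyn⟩ := H.exists_eLpNorm_series_dcoeff_le_low hh hp hK hL₀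
  obtain ⟨C₅, hC₅, hIlow⟩ := oI
  obtain ⟨C₆, hC₆, hOlow⟩ := H.exists_knorm_filter_le hh
  have oI := isLowOrder_inv_mask H hh hS hb hβ0 hL₀'
  obtain ⟨C₇, hC₇, hdI⟩ := oI.exists_dcoeff_le_kFunctional H hh hprod hβ0.le hL₀ hr oI' hK
  obtain ⟨C₈, hC₈, hdR⟩ := oR.exists_dcoeff_le_kFunctional H hh hprod hr.le hL₀ hr oR' hK
  obtain ⟨C₉, hC₉, hdO⟩ := oO.exists_dcoeff_sub_le H hh hprod hL₀' hr hK
  obtain ⟨C₁₀, hC₁₀, hdirT⟩ := H.exists_sub_lowPass_le hh (p := ⊤) le_top hr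
  set ca : ℝ := C₁ + 2 * C₀ * C₂ + C₃ with hca
  set cb : ℝ := C₆ * C₄ + C₀ * (C₅ * C₄) with hcb
  set cc : ℝ := (1 + C₉) * (C₁₀ * 2 ^ r + 1) + 2 * C₀ * C₇ + C₈ with hcc
  have hca0 : 0 < ca := by positivity
  have hcb0 : 0 ≤ cb := by positivity
  have hcc0 : 0 < cc := by positivity
  refine ⟨1 + ca + cb + cc, by positivity, fun L Cs ws hL _ hcomp hws hqs => ?_⟩
  have hLL := hLle L Cs hL hcomp
  have hLL' : L₀ / 2 ≤ L := by linarith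
  have hws' := hreg (1 / L) (by positivity) Cs ws hws
  have hfin := lowPass_support H hh hL
  refine ⟨fun f hf => ?_, fun C w _ hw hq => ⟨fun f => ?_, fun hpt f hfc hf => ?_⟩⟩
  · -- `P = σ_L f`: direct estimate for `f - P`, discretization estimate for `Ψ - P`
    set P := sigma μ φ ℓ h L f with hP
    have hPs : P = series φ (lowPass h ℓ L) (coeff μ φ f) := rfl
    intro Ψ
    set κ := kFunctional μ φ ℓ p r f (1 / L) with hκ
    have b1 := hdir L hL f hf
    have b2 : ENNReal.ofReal (L ^ (-β)) *
        eLpNorm (series φ (lowPassMul h ℓ L fun u => (b u)⁻¹) (coeff μ φ f)) p μ ≤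
          ENNReal.ofReal C₂ * κ := by
      refine (mul_le_mul' le_rfl (hI L hLL' f hf)).trans (le_of_eq ?_)
      rw [← mul_assoc, ofReal_mul_rpow_cancel hL]
    have b3 : ENNReal.ofReal (L ^ (-r)) *
        eLpNorm (series φ (lowPassMul h ℓ L fun u => (1 + u) ^ r) (coeff μ φ f)) p μ ≤
          ENNReal.ofReal C₃ * κ := by
      refine (mul_le_mul' le_rfl (hR L hLL' f hf)).trans (le_of_eq ?_)
      rw [← mul_assoc, ofReal_mul_rpow_cancel hL]
    obtain ⟨hΨX, hΨP, g, hg, hgle⟩ := hcore L hLL Cs ws hws' hqs (coeff μ φ f) P Ψ _ hPs rfl b2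
    have hPm : AEStronglyMeasurable P μ := (H.continuous_series hfin _).aestronglyMeasurable
    have hsub : eLpNorm (fun x => f x - Ψ x) p μ ≤
        ENNReal.ofReal C₁ * κ + ENNReal.ofReal C₀ * (ENNReal.ofReal C₂ * κ) := by
      have e : (fun x => f x - Ψ x) = (fun x => f x - P x) - fun x => Ψ x - P x := by
        funext x
        simp
      rw [e]
      exact (eLpNorm_sub_le (hf.1.1.sub hPm) (hΨX.1.1.sub hPm) hp).trans (add_le_add b1 hΨP)
    have hall : eLpNorm (fun x => f x - Ψ x) p μ + ENNReal.ofReal (L ^ (-r)) * eLpNorm g p μ ≤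
        ENNReal.ofReal ca * κ := by
      refine (add_le_add hsub (hgle.trans (add_le_add le_rfl b3))).trans (le_of_eq ?_)
      rw [hca, ENNReal.ofReal_add (by positivity) (by positivity),
        ENNReal.ofReal_add (by positivity) (by positivity), ENNReal.ofReal_mul (by positivity),
        ENNReal.ofReal_mul (by positivity), ENNReal.ofReal_ofNat]
      ring
    refine ⟨hΨX, ⟨g, hg, hall.trans ?_⟩, ?_⟩
    · exact mul_le_mul' (ENNReal.ofReal_le_ofReal (by linarith)) le_rfl
    -- boundedness, from the approximation estimate and `ω_r(p; f, δ) ≤ ‖f‖_p`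
    · have e : Ψ = f - fun x => f x - Ψ x := by
        funext x
        simp
      rw [e]
      refine (eLpNorm_sub_le hf.1.1 (hf.1.1.sub hΨX.1.1) hp).trans ?_
      calc _ ≤ eLpNorm f p μ + ENNReal.ofReal ca * eLpNorm f p μ := by
            refine add_le_add le_rfl ?_
            exact (le_self_add.trans hall).trans (mul_le_mul' le_rfl (kFunctional_le H f))
        _ = ENNReal.ofReal (1 + ca) * eLpNorm f p μ := by
            rw [ENNReal.ofReal_add zero_le_one hca0.le, ENNReal.ofReal_one, add_mul, one_mul]
        _ ≤ _ := mul_le_mul' (ENNReal.ofReal_le_ofReal (by linarith)) le_rfl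
  · -- both `P` and `D_G P` are synthesized from the samples on `C`
    set P := discSigma φ ℓ h L C w f with hP
    have hPs : P = series φ (lowPass h ℓ L) (dcoeff φ C w f) := rfl
    intro Ψ
    have hw' := hreg (1 / L) (by positivity) C w hw
    set N := discNorm p C w f with hN
    have hNle := eLpNorm_wMeas_le C w f hp
    have b1 : eLpNorm P p μ ≤ ENNReal.ofReal (C₆ * C₄) * N := by
      refine (hsyn L hLL _ hfin (fun j hj => lowPass_eq_zero hh hL (by linarith)) C w hw' f).trans ?_
      rw [ENNReal.ofReal_mul (by positivity)]
      exact mul_le_mul' (mul_le_mul' (hOlow L hL) le_rfl) hNle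
    have b2 : ENNReal.ofReal (L ^ (-β)) *
        eLpNorm (series φ (lowPassMul h ℓ L fun u => (b u)⁻¹) (dcoeff φ C w f)) p μ ≤
          ENNReal.ofReal (C₅ * C₄) * N := by
      refine (mul_le_mul' le_rfl ((hsyn L hLL _ (lowPassMul_support H hh hL _)
        (fun j hj => lowPassMul_eq_zero hh hL _ (by linarith)) C w hw' f).trans
        (mul_le_mul' (mul_le_mul' (hIlow L hLL').1 le_rfl) hNle))).trans (le_of_eq ?_)
      rw [← mul_assoc, ← mul_assoc, ofReal_mul_rpow_cancel hL, ENNReal.ofReal_mul hC₅]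
    obtain ⟨hΨX, hΨP, -⟩ := hcore L hLL Cs ws hws' hqs (dcoeff φ C w f) P Ψ _ hPs rfl b2
    have hPm : AEStronglyMeasurable P μ := (H.continuous_series hfin _).aestronglyMeasurable
    refine ⟨hΨX, ?_⟩
    have e : Ψ = P + fun x => Ψ x - P x := by
      funext x
      simp
    rw [e]
    refine (eLpNorm_add_le hPm (hΨX.1.1.sub hPm) hp).trans ((add_le_add b1 hΨP).trans ?_)
    rw [← mul_assoc, ← ENNReal.ofReal_mul hC₀, ← add_mul,
      ← ENNReal.ofReal_add (by positivity) (by positivity)]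
    exact mul_le_mul' (ENNReal.ofReal_le_ofReal (by linarith)) le_rfl
  · subst hpt
    set P := discSigma φ ℓ h L C w f with hP
    have hPs : P = series φ (lowPass h ℓ L) (dcoeff φ C w f) := rfl
    intro Ψ
    have hw' := hreg (1 / L) (by positivity) C w hw
    set κ := kFunctional μ φ ℓ ⊤ r f (1 / L) with hκ
    set ν := ENNReal.ofReal (L ^ (-r)) * eLpNorm f ⊤ μ with hν
    have b2 := hdI L hLL C w hw' hq f hfc hf
    have b3 := hdR L hLL C w hw' hq f hfc hf
    obtain ⟨hΨX, hΨP, g, hg, hgle⟩ := hcore L hLL Cs ws hws' hqs (dcoeff φ C w f) P Ψ _ hPs rfl b2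
    have hPc : Continuous P := H.continuous_series hfin _
    have hPm : AEStronglyMeasurable P μ := hPc.aestronglyMeasurable
    have hL2 : 0 < L / 2 := by linarith
    -- `P` is compared with `f` through `R = σ_{L/2} f`, on which the quadrature on `C` is nearly exact
    set R := series φ (lowPass h ℓ (L / 2)) (coeff μ φ f) with hRdef
    have hRc : Continuous R := H.continuous_series (lowPass_support H hh hL2) _
    have hone : ∀ (L' : ℝ) (a : ℕ → ℂ) (x : X), series φ (lowPassMul h ℓ L' fun _ => 1) a x =
        series φ (lowPass h ℓ L') a x := fun L' a x =>
      series_congr (fun k => by simp [lowPassMul, lowPass]) x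
    have b4 := hdO L hLL' C w hw' hq f hfc
    simp only [hone, Real.rpow_zero, mul_one] at b4
    have b5 : eLpNorm (fun x => f x - R x) ⊤ μ ≤ ENNReal.ofReal (C₁₀ * 2 ^ r) * κ := by
      refine (hdirT _ hL2 f hf).trans ?_
      rw [ENNReal.ofReal_mul hC₁₀.le, mul_assoc, show 1 / (L / 2) = 2 * (1 / L) by field_simp]
      exact mul_le_mul' le_rfl (kFunctional_two_mul_le hr.le (by positivity) f)
    have b6 : eLpNorm (fun x => f x - R x) ⊤ μ + ν ≤
        ENNReal.ofReal (C₁₀ * 2 ^ r + 1) * (κ + ν) := by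
      refine (add_le_add b5 le_rfl).trans ?_
      rw [mul_add]
      refine add_le_add (mul_le_mul' (ENNReal.ofReal_le_ofReal (by linarith)) le_rfl) ?_
      refine le_mul_of_one_le_left zero_le ?_
      rw [ENNReal.one_le_ofReal]
      have : 0 ≤ C₁₀ * 2 ^ r := by positivity
      linarith
    have hsub : eLpNorm (fun x => f x - Ψ x) ⊤ μ ≤
        ENNReal.ofReal ((1 + C₉) * (C₁₀ * 2 ^ r + 1)) * (κ + ν) +
          ENNReal.ofReal C₀ * (ENNReal.ofReal C₇ * (κ + ν)) := by
      have e : (fun x => f x - Ψ x) =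
          (fun x => f x - R x) - (fun x => P x - R x) - fun x => Ψ x - P x := by
        funext x
        simp
      rw [e]
      refine (eLpNorm_sub_le (((hfc.sub hRc).sub (hPc.sub hRc)).aestronglyMeasurable)
        (hΨX.1.1.sub hPm) le_top).trans (add_le_add ?_ hΨP)
      refine (eLpNorm_sub_le (hfc.sub hRc).aestronglyMeasurable
        (hPc.sub hRc).aestronglyMeasurable le_top).trans ?_
      refine (add_le_add (le_self_add.trans b6) (b4.trans (mul_le_mul' le_rfl b6))).trans
        (le_of_eq ?_)
      rw [ENNReal.ofReal_mul (by positivity), ENNReal.ofReal_add zero_le_one hC₉.le,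
        ENNReal.ofReal_one]
      ring
    refine ⟨g, hg, (add_le_add hsub (hgle.trans (add_le_add le_rfl b3))).trans ?_⟩
    calc _ = ENNReal.ofReal cc * (κ + ν) := by
          rw [hcc, ENNReal.ofReal_add (by positivity) (by positivity),
            ENNReal.ofReal_add (by positivity) (by positivity),
            ENNReal.ofReal_mul (p := 2 * C₀) (by positivity), ENNReal.ofReal_mul (p := 2) (by positivity),
            ENNReal.ofReal_ofNat]
          ring
      _ ≤ _ := mul_le_mul' (ENNReal.ofReal_le_ofReal (by linarith)) le_rfl
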